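/- **Definitions.** All manifolds are smooth, Hausdorff, second countable and without boundary; a metric is pseudo-Riemannian of arbitrary signature. An *almost para-quaternionic structure* on a manifold $M$ is a rank 3 subbundle $Q\subset \mathrm{End}\,TM$ which is locally spanned by smooth fields $J_1,J_2,J_3$ with $-J_1^2=J_2^2=J_3^2=\mathrm{Id}$ and $J_1J_2=-J_2J_1=J_3$; put $(\epsilon_1,\epsilon_2,\epsilon_3)=(-1,1,1)$. A *para-quaternionic Kähler manifold* $(M^{4n},Q,g)$, $n\ge 1$, is a pseudo-Riemannian manifold $(M,g)$ of dimension $4n$ with an almost para-quaternionic structure $Q$ consisting of $g$-skew-symmetric endomorphisms and preserved by the Levi-Civita connection of $g$; if $n=1$ one requires in addition that at each point the curvature tensor $R(X,Y)=[\nabla_X,\nabla_Y]-\nabla_{[X,Y]}$ admits the decomposition $R=\nu R_0+W$, where $\nu=\mathrm{scal}/(4n(n+2))$, $$R_0(X,Y)=\tfrac12\sum_\alpha\epsilon_\alpha\, g(J_\alpha X,Y)J_\alpha+\tfrac14\Big(X\wedge Y-\sum_\alpha\epsilon_\alpha\, J_\alpha X\wedge J_\alpha Y\Big),\qquad (X\wedge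 Y)Z=g(Y,Z)X-g(X,Z)Y,$$ and $W$ is a trace-free algebraic curvature tensor annihilated by $Q$ acting by derivations. **Proposition 3.8.** Let $(\widetilde M^{4n},Q,\widetilde g)$ be a para-quaternionic Kähler manifold and let $M^{4m}$, $m\ge 1$, be an (immersed) submanifold of $\widetilde M$ such that the induced metric $g=\widetilde g|_M$ is non-degenerate and such that $M$ is almost para-quaternionic, i.e. $J(T_xM)\subset T_xM$ for all $x\in M$ and $J\in Q_x$. Then $M$ is totally geodesic, i.e. its second fundamental form (the normal component $h(X,Y)$ of $\widetilde\nabla_XY$ for $X,Y$ tangent to $M$, with $\widetilde\nabla$ the Levi-Civita connection of $\widetilde g$) vanishes identically, and $(M^{4m},Q|_{TM},g)$ is a para-quaternionic Kähler manifold. -/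

import Mathlib

open scoped Manifold ContDiff Topology
open Bundle

noncomputable section

namespace ParaQuaternionic

section Algebra

variable {V : Type*} [AddCommGroup V] [Module ℝ V] [TopologicalSpace V]
  [IsTopologicalAddGroup V] [ContinuousSMul ℝ V]

/-- The para-quaternionic relations `-J₁² = J₂² = J₃² = Id`, `J₁ J₂ = -J₂ J₁ = J₃`.
A triple with the signs `(-1, 1, 1)` permuted becomes one of these after a permutation of its
members and a change of sign of the third one, so the spans of such triples are the same. -/
structure IsStandardTriple (J₁ J₂ J₃ : V →L[ℝ] V) : Prop where
  sq₁ : ∀ v, J₁ (J₁ v) = -v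
  sq₂ : ∀ v, J₂ (J₂ v) = v
  sq₃ : ∀ v, J₃ (J₃ v) = v
  mul : ∀ v, J₁ (J₂ v) = J₃ v
  anti : ∀ v, J₂ (J₁ v) = -J₃ v

/-- The endomorphism `X ∧ Y : Z ↦ ⟨Y, Z⟩ X - ⟨X, Z⟩ Y` applied to `Z`. -/
def wedge (b : V →L[ℝ] V →L[ℝ] ℝ) (X Y Z : V) : V := b Y Z • X - b X Z • Y

/-- The model curvature tensor
`R₀(X, Y) = ½ ∑ ε_α ⟨J_α X, Y⟩ J_α + ¼ (X ∧ Y - ∑ ε_α J_α X ∧ J_α Y)`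
with `(ε₁, ε₂, ε₃) = (-1, 1, 1)`, applied to `Z`. -/
def modelCurvature (b : V →L[ℝ] V →L[ℝ] ℝ) (J₁ J₂ J₃ : V →L[ℝ] V) (X Y Z : V) : V :=
  (1 / 2 : ℝ) • (-(b (J₁ X) Y • J₁ Z) + b (J₂ X) Y • J₂ Z + b (J₃ X) Y • J₃ Z) +
    (1 / 4 : ℝ) • (wedge b X Y Z -
      (-(wedge b (J₁ X) (J₁ Y) Z) + wedge b (J₂ X) (J₂ Y) Z + wedge b (J₃ X) (J₃ Y) Z))

/-- The Ricci contraction `(X, Y) ↦ tr (Z ↦ R(Z, X) Y)` of a `(1,3)`-tensor. -/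
def ricci (R : V →ₗ[ℝ] V →ₗ[ℝ] V →ₗ[ℝ] V) (X Y : V) : ℝ :=
  LinearMap.trace ℝ V ((R.flip X).flip Y)

/-- `s` is the scalar curvature of `R`: the trace of the endomorphism which the (non-degenerate)
form `b` associates with the Ricci form. -/
def IsScalarCurvature (b : V →L[ℝ] V →L[ℝ] ℝ) (R : V →ₗ[ℝ] V →ₗ[ℝ] V →ₗ[ℝ] V) (s : ℝ) : Prop :=
  ∃ Rc : V →ₗ[ℝ] V, (∀ X Y, b (Rc X) Y = ricci R X Y) ∧ s = LinearMap.trace ℝ V Rc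

/-- Algebraic curvature tensors of a pseudo-Euclidean vector space. -/
structure IsAlgebraicCurvature (b : V →L[ℝ] V →L[ℝ] ℝ)
    (W : V →ₗ[ℝ] V →ₗ[ℝ] V →ₗ[ℝ] V) : Prop where
  antisymm : ∀ X Y Z, W X Y Z = -W Y X Z
  skew : ∀ X Y Z U, b (W X Y Z) U = -b Z (W X Y U)
  bianchi : ∀ X Y Z, W X Y Z + W Y Z X + W Z X Y = 0

/-- `W` is annihilated by the members of `Q`, acting on tensors as derivations. -/
def IsInvariantUnder (Q : Submodule ℝ (V →L[ℝ] V)) (W : V →ₗ[ℝ] V →ₗ[ℝ] V →ₗ[ℝ] V) : Prop :=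
  ∀ J ∈ Q, ∀ X Y Z, J (W X Y Z) - W (J X) Y Z - W X (J Y) Z - W X Y (J Z) = 0

/-- `R = ν R₀ + W`, with `ν = scal / (4 n (n + 2))` the reduced scalar curvature of `R`
(the dimension being `4 n`) and `W` a trace-free `Q`-invariant algebraic curvature tensor.
The tensor `R₀` does not depend on the standard triple that spans `Q`. -/
def AdmitsDecomposition (n : ℕ) (b : V →L[ℝ] V →L[ℝ] ℝ) (Q : Submodule ℝ (V →L[ℝ] V))
    (R : V →ₗ[ℝ] V →ₗ[ℝ] V →ₗ[ℝ] V) : Prop :=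
  ∃ (s : ℝ) (J₁ J₂ J₃ : V →L[ℝ] V) (W : V →ₗ[ℝ] V →ₗ[ℝ] V →ₗ[ℝ] V),
    IsScalarCurvature b R s ∧
    IsStandardTriple J₁ J₂ J₃ ∧ Q = Submodule.span ℝ {J₁, J₂, J₃} ∧
    IsAlgebraicCurvature b W ∧ IsInvariantUnder Q W ∧ (∀ X Y, ricci W X Y = 0) ∧
    ∀ X Y Z, R X Y Z =
      (s / (4 * (n : ℝ) * ((n : ℝ) + 2))) • modelCurvature b J₁ J₂ J₃ X Y Z + W X Y Z

end Algebra

section Manifold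

variable {E : Type*} [NormedAddCommGroup E] [NormedSpace ℝ E]
  {M : Type*} [TopologicalSpace M] [ChartedSpace E M]

/-- A field of bilinear forms on the tangent spaces of `M`. -/
abbrev BilinField (E : Type*) [NormedAddCommGroup E] [NormedSpace ℝ E]
    (M : Type*) [TopologicalSpace M] [ChartedSpace E M] :=
  ∀ x : M, TangentSpace 𝓘(ℝ, E) x →L[ℝ] TangentSpace 𝓘(ℝ, E) x →L[ℝ] ℝ

/-- A field of endomorphisms of the tangent spaces of `M`. -/
abbrev EndField (E : Type*) [NormedAddCommGroup E] [NormedSpace ℝ E]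
    (M : Type*) [TopologicalSpace M] [ChartedSpace E M] :=
  ∀ x : M, TangentSpace 𝓘(ℝ, E) x →L[ℝ] TangentSpace 𝓘(ℝ, E) x

/-- A field of linear subspaces of the endomorphism spaces `End (T_x M)`. -/
abbrev EndSubspaceField (E : Type*) [NormedAddCommGroup E] [NormedSpace ℝ E]
    (M : Type*) [TopologicalSpace M] [ChartedSpace E M] :=
  ∀ x : M, Submodule ℝ (TangentSpace 𝓘(ℝ, E) x →L[ℝ] TangentSpace 𝓘(ℝ, E) x)

/-- A linear connection on `M`; `cov Y x v` stands for `(∇_v Y)(x)`. -/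
abbrev Connection (E : Type*) [NormedAddCommGroup E] [NormedSpace ℝ E]
    (M : Type*) [TopologicalSpace M] [ChartedSpace E M] [IsManifold 𝓘(ℝ, E) ∞ M] :=
  CovariantDerivative 𝓘(ℝ, E) E (TangentSpace 𝓘(ℝ, E) : M → Type _)

/-- The vector field `Y` is smooth near `x`. -/
def SmoothVectorFieldAt (Y : ∀ x : M, TangentSpace 𝓘(ℝ, E) x) (x : M)
    [IsManifold 𝓘(ℝ, E) ∞ M] : Prop :=
  ContMDiffAt 𝓘(ℝ, E) (𝓘(ℝ, E).prod 𝓘(ℝ, E)) ∞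
    (fun y ↦ (TotalSpace.mk' E y (Y y) : TangentBundle 𝓘(ℝ, E) M)) x

variable [IsManifold 𝓘(ℝ, E) ∞ M]

/-- The field of endomorphisms `A` is smooth near `x`. -/
def SmoothEndFieldAt (A : EndField E M) (x : M) : Prop :=
  ContMDiffAt 𝓘(ℝ, E) (𝓘(ℝ, E).prod 𝓘(ℝ, E →L[ℝ] E)) ∞
    (fun y ↦ TotalSpace.mk' (E →L[ℝ] E)
      (E := fun y : M ↦ TangentSpace 𝓘(ℝ, E) y →L[ℝ] TangentSpace 𝓘(ℝ, E) y) y (A y)) x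

/-- Pseudo-Riemannian metrics of arbitrary signature: smooth fields of non-degenerate symmetric
bilinear forms. -/
structure IsPseudoRiemannian (g : BilinField E M) : Prop where
  symm : ∀ x u v, g x u v = g x v u
  nondegenerate : ∀ x u, (∀ v, g x u v = 0) → u = 0
  smooth : ContMDiff 𝓘(ℝ, E) (𝓘(ℝ, E).prod 𝓘(ℝ, E →L[ℝ] E →L[ℝ] ℝ)) ∞
    (fun y ↦ TotalSpace.mk' (E →L[ℝ] E →L[ℝ] ℝ)
      (E := fun y : M ↦ TangentSpace 𝓘(ℝ, E) y →L[ℝ] TangentSpace 𝓘(ℝ, E) y →L[ℝ] ℝ) y (g y))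

/-- The Levi-Civita connection: torsion-free, `∇g = 0`. -/
structure IsLeviCivita (g : BilinField E M) (cov : Connection E M) : Prop where
  torsion_free : ∀ (x : M) (X Y : ∀ x : M, TangentSpace 𝓘(ℝ, E) x),
    MDiffAt (T% X) x → MDiffAt (T% Y) x →
      cov Y x (X x) - cov X x (Y x) = VectorField.mlieBracket 𝓘(ℝ, E) X Y x
  metric : ∀ (x : M) (X Y : ∀ x : M, TangentSpace 𝓘(ℝ, E) x) (v : TangentSpace 𝓘(ℝ, E) x),
    MDiffAt (T% X) x → MDiffAt (T% Y) x →
      mfderiv 𝓘(ℝ, E) 𝓘(ℝ, ℝ) (fun y ↦ g y (X y) (Y y)) x v =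
        g x (cov X x v) (Y x) + g x (X x) (cov Y x v)

/-- Almost para-quaternionic structures: rank 3 subbundles of `End TM` that are locally generated
by smooth standard triples. -/
def IsAlmostParaQuaternionic (Q : EndSubspaceField E M) : Prop :=
  (∀ x, Module.finrank ℝ (Q x) = 3) ∧
  ∀ x₀ : M, ∃ U : Set M, IsOpen U ∧ x₀ ∈ U ∧ ∃ J₁ J₂ J₃ : EndField E M,
    ∀ x ∈ U, SmoothEndFieldAt J₁ x ∧ SmoothEndFieldAt J₂ x ∧ SmoothEndFieldAt J₃ x ∧
      IsStandardTriple (J₁ x) (J₂ x) (J₃ x) ∧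
      Q x = Submodule.span ℝ {J₁ x, J₂ x, J₃ x}

/-- The connection preserves `Q`: for every local smooth section `A` of `Q`, the endomorphism
`∇_v A : Y ↦ ∇_v (A Y) - A (∇_v Y)` belongs to `Q`. -/
def Preserves (cov : Connection E M) (Q : EndSubspaceField E M) : Prop :=
  ∀ (x : M) (A : EndField E M), SmoothEndFieldAt A x → (∀ᶠ y in 𝓝 x, A y ∈ Q y) →
    ∀ v : TangentSpace 𝓘(ℝ, E) x, ∃ B ∈ Q x,
      ∀ Y : ∀ x : M, TangentSpace 𝓘(ℝ, E) x, MDiffAt (T% Y) x →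
        cov (fun y ↦ A y (Y y)) x v - A x (cov Y x v) = B (Y x)

/-- `R` is the curvature tensor of the connection at `x`:
`R(X, Y) Z = ∇_X ∇_Y Z - ∇_Y ∇_X Z - ∇_[X, Y] Z`. -/
def IsCurvatureAt (cov : Connection E M) (x : M)
    (R : TangentSpace 𝓘(ℝ, E) x →ₗ[ℝ] TangentSpace 𝓘(ℝ, E) x →ₗ[ℝ]
      TangentSpace 𝓘(ℝ, E) x →ₗ[ℝ] TangentSpace 𝓘(ℝ, E) x) : Prop :=
  ∀ X Y Z : ∀ x : M, TangentSpace 𝓘(ℝ, E) x,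
    SmoothVectorFieldAt X x → SmoothVectorFieldAt Y x → SmoothVectorFieldAt Z x →
      R (X x) (Y x) (Z x) =
        cov (fun y ↦ cov Z y (Y y)) x (X x) - cov (fun y ↦ cov Z y (X y)) x (Y x) -
          cov Z x (VectorField.mlieBracket 𝓘(ℝ, E) X Y x)

/-- Para-quaternionic Kähler manifolds `(M, Q, g)`: `Q` is an almost para-quaternionic structure
of `g`-skew-symmetric endomorphisms, preserved by the Levi-Civita connection of the
pseudo-Riemannian metric `g`; in dimension 4 one requires moreover that the curvature tensor admits
the decomposition `R = ν R₀ + W`. -/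
structure IsParaQuaternionicKahler (g : BilinField E M) (Q : EndSubspaceField E M) : Prop where
  metric : IsPseudoRiemannian g
  structure_ : IsAlmostParaQuaternionic Q
  skew : ∀ x, ∀ J ∈ Q x, ∀ u v, g x (J u) v = -g x u (J v)
  parallel : ∃ cov : Connection E M, IsLeviCivita g cov ∧ Preserves cov Q ∧
    (Module.finrank ℝ E = 4 → ∀ x, ∃ R, IsCurvatureAt cov x R ∧
      AdmitsDecomposition 1 (g x) (Q x) R)

end Manifold

section Submanifold

variable {E : Type*} [NormedAddCommGroup E] [NormedSpace ℝ E]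
  {M : Type*} [TopologicalSpace M] [ChartedSpace E M]
  {E' : Type*} [NormedAddCommGroup E'] [NormedSpace ℝ E']
  {N : Type*} [TopologicalSpace N] [ChartedSpace E' N]

/-- The metric induced on `M` by a map `f : M → N`. -/
def inducedMetric (f : M → N) (g : BilinField E' N) : BilinField E M := fun x ↦
  ((ContinuousLinearMap.precomp ℝ (mfderiv 𝓘(ℝ, E) 𝓘(ℝ, E') f x)).comp (g (f x))).comp
    (mfderiv 𝓘(ℝ, E) 𝓘(ℝ, E') f x)

theorem inducedMetric_apply (f : M → N) (g : BilinField E' N) (x : M)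
    (u v : TangentSpace 𝓘(ℝ, E) x) :
    inducedMetric f g x u v =
      g (f x) (mfderiv 𝓘(ℝ, E) 𝓘(ℝ, E') f x u) (mfderiv 𝓘(ℝ, E) 𝓘(ℝ, E') f x v) := rfl

/-- The tangent space `T_x M`, as a subspace of `T_{f x} N`. -/
def tangentRange (E : Type*) [NormedAddCommGroup E] [NormedSpace ℝ E] {M : Type*}
    [TopologicalSpace M] [ChartedSpace E M] {E' : Type*} [NormedAddCommGroup E']
    [NormedSpace ℝ E'] {N : Type*} [TopologicalSpace N] [ChartedSpace E' N]
    (f : M → N) (x : M) : Submodule ℝ (TangentSpace 𝓘(ℝ, E') (f x)) :=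
  LinearMap.range (mfderiv 𝓘(ℝ, E) 𝓘(ℝ, E') f x).toLinearMap

/-- The submanifold is non-degenerate: the induced metric is non-degenerate on each `T_x M`. -/
def IsNondegenerate (E : Type*) [NormedAddCommGroup E] [NormedSpace ℝ E] {M : Type*}
    [TopologicalSpace M] [ChartedSpace E M] {E' : Type*} [NormedAddCommGroup E']
    [NormedSpace ℝ E'] {N : Type*} [TopologicalSpace N] [ChartedSpace E' N]
    (f : M → N) (g : BilinField E' N) : Prop :=
  ∀ (x : M) (u : TangentSpace 𝓘(ℝ, E) x), (∀ v, inducedMetric f g x u v = 0) → u = 0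

/-- The tangent bundle of the submanifold is `Q`-invariant. -/
def IsAlmostParaQuaternionicSubmanifold (E : Type*) [NormedAddCommGroup E] [NormedSpace ℝ E]
    {M : Type*} [TopologicalSpace M] [ChartedSpace E M] {E' : Type*} [NormedAddCommGroup E']
    [NormedSpace ℝ E'] {N : Type*} [TopologicalSpace N] [ChartedSpace E' N]
    (f : M → N) (Q : EndSubspaceField E' N) : Prop :=
  ∀ (x : M), ∀ J ∈ Q (f x), ∀ w ∈ tangentRange E f x, J w ∈ tangentRange E f x

/-- The restriction `Q|_{TM}`: the endomorphisms of `T_x M` that are restrictions of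
members of `Q`. -/
def inducedStructure (f : M → N) (Q : EndSubspaceField E' N) : EndSubspaceField E M := fun x ↦
  { carrier := {A | ∃ J ∈ Q (f x), ∀ u,
      mfderiv 𝓘(ℝ, E) 𝓘(ℝ, E') f x (A u) = J (mfderiv 𝓘(ℝ, E) 𝓘(ℝ, E') f x u)}
    zero_mem' := ⟨0, (Q (f x)).zero_mem, fun u ↦ by simp⟩
    add_mem' := by
      rintro A B ⟨J, hJ, hA⟩ ⟨K, hK, hB⟩
      exact ⟨J + K, (Q (f x)).add_mem hJ hK, fun u ↦ by simp [hA, hB]⟩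
    smul_mem' := by
      rintro c A ⟨J, hJ, hA⟩
      exact ⟨c • J, (Q (f x)).smul_mem c hJ, fun u ↦ by simp [hA]⟩ }

variable [IsManifold 𝓘(ℝ, E) ∞ M] [IsManifold 𝓘(ℝ, E') ∞ N]

/-- `h` is the second fundamental form of the submanifold: `h(X, Y)` is the normal component of
`∇_X Y` for `X`, `Y` tangent to `M`. Here the derivative is that of the ambient connection, taken
of any local extension `Ytilde` of `Y` to the ambient manifold. -/
def IsSecondFundamentalForm (f : M → N) (g : BilinField E' N) (cov : Connection E' N)
    (h : ∀ x : M, TangentSpace 𝓘(ℝ, E) x →ₗ[ℝ] TangentSpace 𝓘(ℝ, E) x →ₗ[ℝ]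
      TangentSpace 𝓘(ℝ, E') (f x)) : Prop :=
  (∀ x u v, ∀ w ∈ tangentRange E f x, g (f x) (h x u v) w = 0) ∧
  ∀ (x : M) (u : TangentSpace 𝓘(ℝ, E) x) (Y : ∀ x : M, TangentSpace 𝓘(ℝ, E) x)
    (Ytilde : ∀ y : N, TangentSpace 𝓘(ℝ, E') y),
    SmoothVectorFieldAt Y x → SmoothVectorFieldAt Ytilde (f x) →
    (∀ᶠ p in 𝓝 x, Ytilde (f p) = mfderiv 𝓘(ℝ, E) 𝓘(ℝ, E') f p (Y p)) →
      cov Ytilde (f x) (mfderiv 𝓘(ℝ, E) 𝓘(ℝ, E') f x u) - h x u (Y x) ∈ tangentRange E f x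

/-- The submanifold is totally geodesic: its second fundamental form, with respect to the
Levi-Civita connection of the ambient manifold, exists and vanishes. -/
def IsTotallyGeodesic (E : Type*) [NormedAddCommGroup E] [NormedSpace ℝ E] {M : Type*}
    [TopologicalSpace M] [ChartedSpace E M] [IsManifold 𝓘(ℝ, E) ∞ M] {E' : Type*}
    [NormedAddCommGroup E'] [NormedSpace ℝ E'] {N : Type*} [TopologicalSpace N]
    [ChartedSpace E' N] [IsManifold 𝓘(ℝ, E') ∞ N] (f : M → N) (g : BilinField E' N) : Prop :=
  ∃ cov : Connection E' N, IsLeviCivita g cov ∧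
    ∃ h : ∀ x : M, TangentSpace 𝓘(ℝ, E) x →ₗ[ℝ] TangentSpace 𝓘(ℝ, E) x →ₗ[ℝ]
      TangentSpace 𝓘(ℝ, E') (f x),
      IsSecondFundamentalForm f g cov h ∧ ∀ x u v, h x u v = 0

end Submanifold

end ParaQuaternionic

end

/-!
An invariant submanifold is totally geodesic for an algebraic reason. Since the Levi-Civita
connection `∇` preserves `Q`, differentiating a section of `Q` creates no normal component, so the
second fundamental form satisfies `h(X, J Y) = J h(X, Y)` for `J` in `Q`, and by symmetry `h(J X,
Y) = J h(X, Y)`. Computing `h(J₁ X, J₂ Y)` in the two possible ways gives `J₁ J₂ h = J₂ J₁ h`,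
that is `2 J₃ h = 0`, and `J₃` is invertible (`cov_mem_of_smooth`, `cov_mem`).

Derivatives of tangent fields being tangent, `∇` induces a connection on `M`
(`inducedConnection`). It is computed with extensions of vector fields to the ambient manifold,
which exist because an immersion has smooth local left inverses (`exists_isLocalRetraction`). The
Gauss formula `mfderiv_inducedConnection` shows that this is the Levi-Civita connection of the
induced metric, that its curvature is the restriction of the ambient one (`mfderiv_curvature`),
and that it preserves the restriction of `Q` (`preserves_inducedStructure`).

What is left is the curvature condition if `dim M = 4`. If `M` is open in the ambient manifold, it
is the assumption on the latter. Otherwise `T_x M` has a non-zero orthogonal complement. The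
curvature of a connection that preserves `Q` has commutators `[R(X, Y), J_α]` in `Q`
(`Preserves.curvature_commutator`), hence given by three 2-forms `w_α`. The Bianchi identity with
two arguments tangent to `M` and two normal ones forces the restrictions of the `w_α` to `T_x M`
to be one common multiple of the fundamental forms, up to signs
(`IsSkewTriple.exists_commutators_on`); here normal test vectors that are not null are needed, and
the non-degeneracy of the submanifold provides them. So the curvature of `M` has the commutators
of `c R₀`, the difference `W = R - c R₀` commutes with `Q`, and an algebraic curvature tensor with
that property is trace-free and `Q`-invariant, while taking traces identifies `c` as the reduced
scalar curvature (`IsSkewTriple.admitsDecomposition`).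
-/

set_option linter.unusedSectionVars false

namespace ParaQuaternionic

/-! ### Linear algebra of para-quaternionic triples -/

section Triples

variable {V : Type*} [AddCommGroup V] [Module ℝ V] [TopologicalSpace V]
  [IsTopologicalAddGroup V] [ContinuousSMul ℝ V]

namespace IsStandardTriple

variable {J₁ J₂ J₃ : V →L[ℝ] V} (hJ : IsStandardTriple J₁ J₂ J₃)
include hJ

theorem mul₁₃ (v : V) : J₁ (J₃ v) = -J₂ v := by
  rw [← hJ.mul, hJ.sq₁]

theorem mul₃₁ (v : V) : J₃ (J₁ v) = J₂ v := by
  rw [← hJ.mul, hJ.anti, map_neg, hJ.mul₁₃, neg_neg]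

theorem mul₂₃ (v : V) : J₂ (J₃ v) = -J₁ v := by
  rw [← hJ.mul, hJ.anti, ← hJ.mul, hJ.sq₂]

theorem mul₃₂ (v : V) : J₃ (J₂ v) = J₁ v := by
  rw [← hJ.mul, hJ.sq₂]

end IsStandardTriple

/-- A non-degenerate symmetric form together with a standard triple of skew endomorphisms. -/
structure IsSkewTriple (b : V →L[ℝ] V →L[ℝ] ℝ) (J₁ J₂ J₃ : V →L[ℝ] V) : Prop
    extends IsStandardTriple J₁ J₂ J₃ where
  symm : ∀ u v, b u v = b v u
  nondegenerate : ∀ u, (∀ v, b u v = 0) → u = 0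
  skew₁ : ∀ u v, b (J₁ u) v = -b u (J₁ v)
  skew₂ : ∀ u v, b (J₂ u) v = -b u (J₂ v)
  skew₃ : ∀ u v, b (J₃ u) v = -b u (J₃ v)

namespace IsSkewTriple

variable {b : V →L[ℝ] V →L[ℝ] ℝ} {J₁ J₂ J₃ : V →L[ℝ] V} (h : IsSkewTriple b J₁ J₂ J₃)
include h

theorem form₁_antisymm (u v : V) : b (J₁ u) v = -b (J₁ v) u := by
  rw [h.skew₁, h.symm]

theorem form₂_antisymm (u v : V) : b (J₂ u) v = -b (J₂ v) u := by
  rw [h.skew₂, h.symm]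

theorem form₃_antisymm (u v : V) : b (J₃ u) v = -b (J₃ v) u := by
  rw [h.skew₃, h.symm]

theorem form₁_self (u : V) : b (J₁ u) u = 0 := by
  have := h.form₁_antisymm u u; linarith

theorem form₂_self (u : V) : b (J₂ u) u = 0 := by
  have := h.form₂_antisymm u u; linarith

theorem form₃_self (u : V) : b (J₃ u) u = 0 := by
  have := h.form₃_antisymm u u; linarith

/-- The vectors `Z`, `J₁ Z`, `J₂ Z`, `J₃ Z` are mutually orthogonal, and their squares are
`a`, `a`, `-a`, `-a`. -/
theorem forms_apply (z : V) :
    (b (J₁ z) (J₁ z) = b z z ∧ b (J₂ z) (J₁ z) = 0 ∧ b (J₃ z) (J₁ z) = 0) ∧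
    (b (J₁ z) (J₂ z) = 0 ∧ b (J₂ z) (J₂ z) = -b z z ∧ b (J₃ z) (J₂ z) = 0) ∧
    (b (J₁ z) (J₃ z) = 0 ∧ b (J₂ z) (J₃ z) = 0 ∧ b (J₃ z) (J₃ z) = -b z z) := by
  have hJ := h.toIsStandardTriple
  have s1 := h.form₁_self z
  have s2 := h.form₂_self z
  have s3 := h.form₃_self z
  rw [h.symm] at s1 s2 s3
  refine ⟨⟨?_, ?_, ?_⟩, ⟨?_, ?_, ?_⟩, ⟨?_, ?_, ?_⟩⟩ <;>
    simp [h.skew₁, h.skew₂, h.skew₃, hJ.sq₁, hJ.sq₂, hJ.sq₃, hJ.mul, hJ.anti, hJ.mul₁₃, hJ.mul₃₁,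
      hJ.mul₂₃, hJ.mul₃₂, s1, s2, s3]

theorem mem_span_iff {A : V →L[ℝ] V} :
    A ∈ Submodule.span ℝ {J₁, J₂, J₃} ↔ ∃ a₁ a₂ a₃ : ℝ, a₁ • J₁ + a₂ • J₂ + a₃ • J₃ = A := by
  rw [Submodule.mem_span_triple]

end IsSkewTriple

end Triples

section Curvature

variable {V : Type*} [AddCommGroup V] [Module ℝ V] [TopologicalSpace V]
  [IsTopologicalAddGroup V] [ContinuousSMul ℝ V]

/-- Interchange of the two pairs of arguments of an algebraic curvature tensor. -/
theorem IsAlgebraicCurvature.pair_symm {b : V →L[ℝ] V →L[ℝ] ℝ}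
    {R : V →ₗ[ℝ] V →ₗ[ℝ] V →ₗ[ℝ] V} (hs : ∀ u v, b u v = b v u) (hR : IsAlgebraicCurvature b R)
    (x y z u : V) : b (R x y z) u = b (R z u x) y := by
  have B (x y z u : V) : b (R x y z) u + b (R y z x) u + b (R z x y) u = 0 := by
    rw [← add_apply, ← map_add, ← add_apply, ← map_add,
      hR.bianchi]; simp
  have A (x y z u : V) : b (R x y z) u = -b (R y x z) u := by rw [hR.antisymm]; simp
  have S (x y z u : V) : b (R x y z) u = -b (R x y u) z := by rw [hR.skew, hs]
  linarith [B x y z u, B y z u x, B z u x y, B u x y z, A x y z u, A y z x u, A z x y u,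
    A z u x y, A u x y z, S x y z u, S y z x u, S z x y u, S y z u x, S z u y x, S u y z x,
    S z u x y, S u x z y, S x z u y, S u x y z, S x y u z, S y u x z, A y u x z, A x z u y,
    A u y z x, A y u z x, A z x u y, A z u y x, A x u y z, A x u z y]

/-- The commutators of a curvature tensor with the members of a standard triple are those of
`c R₀`, with `R₀` the model curvature. -/
structure HasModelCommutators (b : V →L[ℝ] V →L[ℝ] ℝ) (J₁ J₂ J₃ : V →L[ℝ] V)
    (R : V →ₗ[ℝ] V →ₗ[ℝ] V →ₗ[ℝ] V) (c : ℝ) : Prop where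
  comm₁ : ∀ x y z, R x y (J₁ z) - J₁ (R x y z) = c • (b (J₃ x) y • J₂ z - b (J₂ x) y • J₃ z)
  comm₂ : ∀ x y z, R x y (J₂ z) - J₂ (R x y z) = c • (b (J₃ x) y • J₁ z - b (J₁ x) y • J₃ z)
  comm₃ : ∀ x y z, R x y (J₃ z) - J₃ (R x y z) = c • (b (J₁ x) y • J₂ z - b (J₂ x) y • J₁ z)

/-- The model curvature as a trilinear map. -/
noncomputable def modelCurvatureHom (b : V →L[ℝ] V →L[ℝ] ℝ) (J₁ J₂ J₃ : V →L[ℝ] V) :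
    V →ₗ[ℝ] V →ₗ[ℝ] V →ₗ[ℝ] V :=
  LinearMap.mk₂ ℝ (fun x y ↦
    { toFun := fun z ↦ modelCurvature b J₁ J₂ J₃ x y z
      map_add' := fun z z' ↦ by simp only [modelCurvature, wedge, map_add]; module
      map_smul' := fun c z ↦ by
        simp only [modelCurvature, wedge, map_smul, RingHom.id_apply, smul_eq_mul]; module })
    (fun x x' y ↦ by
      ext z
      simp only [modelCurvature, wedge, map_add, add_apply, LinearMap.coe_mk,
        AddHom.coe_mk, LinearMap.add_apply]
      module)
    (fun c x y ↦ by
      ext z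
      simp only [modelCurvature, wedge, map_smul, smul_apply, LinearMap.coe_mk,
        AddHom.coe_mk, LinearMap.smul_apply, smul_eq_mul]
      module)
    (fun x y y' ↦ by
      ext z
      simp only [modelCurvature, wedge, map_add, add_apply, LinearMap.coe_mk,
        AddHom.coe_mk, LinearMap.add_apply]
      module)
    (fun c x y ↦ by
      ext z
      simp only [modelCurvature, wedge, map_smul, smul_apply, LinearMap.coe_mk,
        AddHom.coe_mk, LinearMap.smul_apply, smul_eq_mul]
      module)

@[simp]
theorem modelCurvatureHom_apply (b : V →L[ℝ] V →L[ℝ] ℝ) (J₁ J₂ J₃ : V →L[ℝ] V) (x y z : V) :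
    modelCurvatureHom b J₁ J₂ J₃ x y z = modelCurvature b J₁ J₂ J₃ x y z := rfl

namespace IsSkewTriple

variable {b : V →L[ℝ] V →L[ℝ] ℝ} {J₁ J₂ J₃ : V →L[ℝ] V} (h : IsSkewTriple b J₁ J₂ J₃)
include h

theorem isAlgebraicCurvature_model : IsAlgebraicCurvature b (modelCurvatureHom b J₁ J₂ J₃) where
  antisymm x y z := by
    simp only [modelCurvatureHom_apply, modelCurvature, wedge]
    rw [h.form₁_antisymm x y, h.form₂_antisymm x y, h.form₃_antisymm x y]
    module
  skew x y z u := by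
    simp only [modelCurvatureHom_apply, modelCurvature, wedge, map_add, map_sub, map_smul, map_neg,
      add_apply, sub_apply, smul_apply,
      neg_apply, smul_eq_mul]
    rw [h.symm z (J₁ u), h.symm z (J₂ u), h.symm z (J₃ u), h.symm z (J₁ x), h.symm z (J₂ x),
      h.symm z (J₃ x), h.symm z (J₁ y), h.symm z (J₂ y), h.symm z (J₃ y), h.form₁_antisymm u z,
      h.form₂_antisymm u z, h.form₃_antisymm u z, h.symm z x, h.symm z y]
    ring
  bianchi x y z := by
    simp only [modelCurvatureHom_apply, modelCurvature, wedge]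
    rw [h.form₁_antisymm z x, h.form₂_antisymm z x, h.form₃_antisymm z x,
      h.form₁_antisymm z y, h.form₂_antisymm z y, h.form₃_antisymm z y,
      h.form₁_antisymm y x, h.form₂_antisymm y x, h.form₃_antisymm y x,
      h.symm z x, h.symm z y, h.symm y x]
    module

theorem hasModelCommutators_model :
    HasModelCommutators b J₁ J₂ J₃ (modelCurvatureHom b J₁ J₂ J₃) 1 := by
  have hJ := h.toIsStandardTriple
  constructor <;> intro x y z <;>
  · simp only [modelCurvatureHom_apply, modelCurvature, wedge, map_add, map_sub, map_smul, map_neg,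
      hJ.sq₁, hJ.sq₂, hJ.sq₃, hJ.mul, hJ.anti, hJ.mul₁₃, hJ.mul₃₁, hJ.mul₂₃, hJ.mul₃₂, h.skew₁,
      h.skew₂, h.skew₃, neg_smul, smul_neg, sub_neg_eq_add, neg_neg]
    module

end IsSkewTriple

end Curvature

/-! ### Ricci contractions -/

section Ricci

variable {V : Type*} [AddCommGroup V] [Module ℝ V] [TopologicalSpace V]
  [IsTopologicalAddGroup V] [ContinuousSMul ℝ V]

theorem ricci_eq_trace (R : V →ₗ[ℝ] V →ₗ[ℝ] V →ₗ[ℝ] V) (x y : V) (A : V →ₗ[ℝ] V)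
    (hA : ∀ z, A z = R z x y) : ricci R x y = LinearMap.trace ℝ V A := by
  unfold ricci
  congr 1
  ext z
  simp [hA]

variable [FiniteDimensional ℝ V]

/-- The trace of the rank one endomorphism `z ↦ l z • w`. -/
theorem trace_form_smul (l : V →ₗ[ℝ] ℝ) (w : V) :
    LinearMap.trace ℝ V (l.smulRight w) = l w := by
  simp

theorem IsStandardTriple.trace₁ {J₁ J₂ J₃ : V →L[ℝ] V} (hJ : IsStandardTriple J₁ J₂ J₃) :
    LinearMap.trace ℝ V J₁.toLinearMap = 0 := by
  have e : J₁.toLinearMap = -((J₂.toLinearMap ∘ₗ J₁.toLinearMap) ∘ₗ J₂.toLinearMap) := by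
    ext v; simp [hJ.anti, hJ.mul₃₂]
  have e' : J₂.toLinearMap ∘ₗ (J₂.toLinearMap ∘ₗ J₁.toLinearMap) = J₁.toLinearMap := by
    ext v; simp [hJ.sq₂]
  have := congrArg (LinearMap.trace ℝ V) e
  rw [map_neg, LinearMap.trace_comp_comm', e'] at this
  linarith

theorem IsStandardTriple.trace₂ {J₁ J₂ J₃ : V →L[ℝ] V} (hJ : IsStandardTriple J₁ J₂ J₃) :
    LinearMap.trace ℝ V J₂.toLinearMap = 0 := by
  have e : J₂.toLinearMap = (J₁.toLinearMap ∘ₗ J₂.toLinearMap) ∘ₗ J₁.toLinearMap := by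
    ext v; simp [hJ.mul, hJ.mul₃₁]
  have e' : J₁.toLinearMap ∘ₗ (J₁.toLinearMap ∘ₗ J₂.toLinearMap) = -J₂.toLinearMap := by
    ext v; simp [hJ.sq₁]
  have := congrArg (LinearMap.trace ℝ V) e
  rw [LinearMap.trace_comp_comm', e', map_neg] at this
  linarith

theorem IsStandardTriple.trace₃ {J₁ J₂ J₃ : V →L[ℝ] V} (hJ : IsStandardTriple J₁ J₂ J₃) :
    LinearMap.trace ℝ V J₃.toLinearMap = 0 := by
  have e : J₃.toLinearMap = (J₁.toLinearMap ∘ₗ J₃.toLinearMap) ∘ₗ J₁.toLinearMap := by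
    ext v; simp [hJ.mul₁₃, hJ.anti]
  have e' : J₁.toLinearMap ∘ₗ (J₁.toLinearMap ∘ₗ J₃.toLinearMap) = -J₃.toLinearMap := by
    ext v; simp [hJ.sq₁]
  have := congrArg (LinearMap.trace ℝ V) e
  rw [LinearMap.trace_comp_comm', e', map_neg] at this
  linarith

/-- The model curvature is Einstein: `Ric(R₀) = (n + 2) b` in dimension `4 n`. -/
theorem IsSkewTriple.ricci_model {b : V →L[ℝ] V →L[ℝ] ℝ} {J₁ J₂ J₃ : V →L[ℝ] V}
    (h : IsSkewTriple b J₁ J₂ J₃) {n : ℕ} (hn : Module.finrank ℝ V = 4 * n) (x y : V) :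
    ricci (modelCurvatureHom b J₁ J₂ J₃) x y = ((n : ℝ) + 2) * b x y := by
  have hJ := h.toIsStandardTriple
  -- the functional `z ↦ b (J z) u`
  let l (J : V →L[ℝ] V) (u : V) : V →ₗ[ℝ] ℝ :=
    { toFun := fun z ↦ b (J z) u
      map_add' := fun z z' ↦ by simp
      map_smul' := fun c z ↦ by simp }
  let i : V →L[ℝ] V := ContinuousLinearMap.id ℝ V
  rw [ricci_eq_trace _ x y
    ((1 / 2 : ℝ) • (-(l J₁ x).smulRight (J₁ y) + (l J₂ x).smulRight (J₂ y)
        + (l J₃ x).smulRight (J₃ y)) +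
      (1 / 4 : ℝ) • (b x y • i.toLinearMap - (l i y).smulRight x
        - (-(b (J₁ x) y • J₁.toLinearMap - (l J₁ y).smulRight (J₁ x))
          + (b (J₂ x) y • J₂.toLinearMap - (l J₂ y).smulRight (J₂ x))
          + (b (J₃ x) y • J₃.toLinearMap - (l J₃ y).smulRight (J₃ x)))))
    (fun z ↦ by simp [modelCurvature, wedge, l, i])]
  simp only [map_add, map_sub, map_smul, map_neg, trace_form_smul, hJ.trace₁, hJ.trace₂, hJ.trace₃]
  have hi : LinearMap.trace ℝ V i.toLinearMap = 4 * n := by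
    have : i.toLinearMap = LinearMap.id := rfl
    rw [this, LinearMap.trace_id, hn]; push_cast; ring
  rw [hi]
  simp [l, i, hJ.sq₁, hJ.sq₂, hJ.sq₃, h.symm y x]
  ring

/-- By the pair symmetry of curvature tensors, commutation of `W(x, y)` with a skew endomorphism `J`
is also a condition on the arguments `x`, `y`. It makes `W` invariant under `J`. -/
theorem IsAlgebraicCurvature.invariant_of_commute {b : V →L[ℝ] V →L[ℝ] ℝ}
    {W : V →ₗ[ℝ] V →ₗ[ℝ] V →ₗ[ℝ] V} (hs : ∀ u v, b u v = b v u)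
    (hn : ∀ u, (∀ v, b u v = 0) → u = 0) (hW : IsAlgebraicCurvature b W)
    {J : V →L[ℝ] V} (hJ : ∀ u v, b (J u) v = -b u (J v))
    (hc : ∀ x y z, W x y (J z) = J (W x y z)) (x y z : V) :
    W (J x) y z = -W x (J y) z := by
  rw [← add_eq_zero_iff_eq_neg]
  refine hn _ fun u ↦ ?_
  rw [map_add, add_apply, hW.pair_symm hs, hW.pair_symm hs x, hc, hJ]
  ring

theorem trace_eq_zero_of_skew {b : V →L[ℝ] V →L[ℝ] ℝ}
    (hn : ∀ u, (∀ v, b u v = 0) → u = 0) (A : V →ₗ[ℝ] V) (hA : ∀ u v, b (A u) v = -b u (A v)) :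
    LinearMap.trace ℝ V A = 0 := by
  let β : V →ₗ[ℝ] Module.Dual ℝ V :=
    { toFun := fun u ↦ (b u).toLinearMap
      map_add' := fun u v ↦ by ext; simp
      map_smul' := fun c v ↦ by ext; simp }
  have hβ : Function.Injective β := by
    rw [injective_iff_map_eq_zero]
    exact fun u hu ↦ hn u fun v ↦ LinearMap.congr_fun hu v
  let e : V ≃ₗ[ℝ] Module.Dual ℝ V :=
    LinearEquiv.ofInjectiveOfFinrankEq β hβ Subspace.dual_finrank_eq.symm
  have h : e.conj (-A) = Module.Dual.transpose (R := ℝ) A := by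
    ext l v
    obtain ⟨u, rfl⟩ := e.surjective l
    simp only [LinearEquiv.conj_apply_apply, LinearEquiv.symm_apply_apply]
    change b (-A u) v = b u (A v)
    rw [map_neg, neg_apply, hA, neg_neg]
  have h' := congrArg (LinearMap.trace ℝ (Module.Dual ℝ V)) h
  rw [LinearMap.trace_conj', LinearMap.trace_transpose', map_neg] at h'
  linarith

/-- An algebraic curvature tensor that commutes with a standard triple of skew endomorphisms is
Ricci-flat. As `J₁ W(x, y)` anticommutes with `J₂`, its trace vanishes, so that the trace of the
Bianchi identity composed with `J₁` gives `Ric(x, J₁ y) = Ric(y, J₁ x)`. The invariance of `W` under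
`J₁` gives `Ric(J₁ x, J₁ y) = Ric(x, y)`. Hence `Ric` is antisymmetric; it is symmetric as well. -/
theorem IsSkewTriple.ricci_eq_zero_of_commute {b : V →L[ℝ] V →L[ℝ] ℝ} {J₁ J₂ J₃ : V →L[ℝ] V}
    (h : IsSkewTriple b J₁ J₂ J₃) {W : V →ₗ[ℝ] V →ₗ[ℝ] V →ₗ[ℝ] V} (hW : IsAlgebraicCurvature b W)
    (h₁ : ∀ x y z, W x y (J₁ z) = J₁ (W x y z)) (h₂ : ∀ x y z, W x y (J₂ z) = J₂ (W x y z))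
    (x y : V) : ricci W x y = 0 := by
  have hJ := h.toIsStandardTriple
  have key (x y z : V) : W z x y = W z y x - W x y z := by
    have := hW.bianchi z x y
    rw [hW.antisymm y z x] at this
    rw [← sub_eq_zero, ← this]; abel
  have symm (x y : V) : ricci W x y = ricci W y x := by
    rw [ricci_eq_trace W x y ((W.flip y).flip x - W x y) (fun z ↦ by simp [key x y z]), map_sub,
      trace_eq_zero_of_skew h.nondegenerate (W x y) (hW.skew x y), sub_zero]
    rfl
  have tr₁ (x y : V) : LinearMap.trace ℝ V (J₁.toLinearMap ∘ₗ W x y) = 0 := by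
    have e : J₁.toLinearMap ∘ₗ W x y =
        -((J₂.toLinearMap ∘ₗ (J₁.toLinearMap ∘ₗ W x y)) ∘ₗ J₂.toLinearMap) := by
      ext v; simp [h₂, hJ.anti, hJ.mul₃₂]
    have e' : J₂.toLinearMap ∘ₗ (J₂.toLinearMap ∘ₗ (J₁.toLinearMap ∘ₗ W x y)) =
        J₁.toLinearMap ∘ₗ W x y := by
      ext v; simp [hJ.sq₂]
    have := congrArg (LinearMap.trace ℝ V) e
    rw [map_neg, LinearMap.trace_comp_comm' J₂.toLinearMap, e'] at this
    linarith
  have swap (x y : V) : ricci W x (J₁ y) = ricci W y (J₁ x) := by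
    rw [ricci_eq_trace W x (J₁ y) (J₁.toLinearMap ∘ₗ ((W.flip y).flip x) - J₁.toLinearMap ∘ₗ W x y)
      (fun z ↦ by simp [h₁, key x y z]), map_sub, tr₁, sub_zero]
    symm
    apply ricci_eq_trace
    intro z
    simp [h₁]
  have inv (x y : V) : ricci W (J₁ x) (J₁ y) = ricci W x y := by
    rw [ricci_eq_trace W (J₁ x) (J₁ y)
      (-((J₁.toLinearMap ∘ₗ ((W.flip x).flip y)) ∘ₗ J₁.toLinearMap)) (fun z ↦ by
        have := hW.invariant_of_commute h.symm h.nondegenerate h.skew₁ h₁ z x (J₁ y)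
        rw [eq_neg_iff_add_eq_zero, add_comm, ← eq_neg_iff_add_eq_zero] at this
        simp [this, h₁]), map_neg, LinearMap.trace_comp_comm']
    symm
    rw [ricci_eq_trace W x y (-(J₁.toLinearMap ∘ₗ (J₁.toLinearMap ∘ₗ ((W.flip x).flip y))))
      (fun z ↦ by simp [hJ.sq₁]), map_neg]
  have h3 := swap (J₁ x) y
  rw [inv, hJ.sq₁, symm] at h3
  have h4 : ricci W y (-x) = -ricci W y x := by
    rw [ricci_eq_trace W y (-x) (-((W.flip y).flip x)) (fun z ↦ by simp), map_neg]; rfl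
  rw [h4] at h3
  rw [symm]
  linarith

/-- An algebraic curvature tensor whose commutators with the triple are those of `c R₀` admits the
decomposition `R = ν R₀ + W`; automatically `c = ν`. -/
theorem IsSkewTriple.admitsDecomposition {b : V →L[ℝ] V →L[ℝ] ℝ} {J₁ J₂ J₃ : V →L[ℝ] V}
    (h : IsSkewTriple b J₁ J₂ J₃) {n : ℕ} (hn : 0 < n) (hV : Module.finrank ℝ V = 4 * n)
    {R : V →ₗ[ℝ] V →ₗ[ℝ] V →ₗ[ℝ] V} (hR : IsAlgebraicCurvature b R) {c : ℝ}
    (hc : HasModelCommutators b J₁ J₂ J₃ R c) :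
    AdmitsDecomposition n b (Submodule.span ℝ {J₁, J₂, J₃}) R := by
  set R₀ := modelCurvatureHom b J₁ J₂ J₃ with hR₀
  have hA := h.isAlgebraicCurvature_model
  have hC := h.hasModelCommutators_model
  rw [← hR₀] at hA hC
  set W : V →ₗ[ℝ] V →ₗ[ℝ] V →ₗ[ℝ] V := R - c • R₀ with hWdef
  have hWa (x y z : V) : W x y z = R x y z - c • R₀ x y z := by simp [hWdef]
  have hW : IsAlgebraicCurvature b W := by
    refine ⟨fun x y z ↦ ?_, fun x y z u ↦ ?_, fun x y z ↦ ?_⟩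
    · rw [hWa, hWa, hR.antisymm, hA.antisymm]; module
    · simp only [hWa, map_sub, map_smul, sub_apply, smul_apply, hR.skew x y z u, hA.skew x y z u,
        smul_eq_mul]
      ring
    · rw [hWa, hWa, hWa]
      linear_combination (norm := module) hR.bianchi x y z - c • hA.bianchi x y z
  have h₁ (x y z : V) : W x y (J₁ z) = J₁ (W x y z) := by
    rw [hWa, hWa, map_sub, map_smul]
    linear_combination (norm := module) hc.comm₁ x y z - c • hC.comm₁ x y z
  have h₂ (x y z : V) : W x y (J₂ z) = J₂ (W x y z) := by
    rw [hWa, hWa, map_sub, map_smul]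
    linear_combination (norm := module) hc.comm₂ x y z - c • hC.comm₂ x y z
  have h₃ (x y z : V) : W x y (J₃ z) = J₃ (W x y z) := by
    rw [hWa, hWa, map_sub, map_smul]
    linear_combination (norm := module) hc.comm₃ x y z - c • hC.comm₃ x y z
  have hric := h.ricci_eq_zero_of_commute hW h₁ h₂
  have hn' : (n : ℝ) ≠ 0 := by positivity
  have hn2 : (n : ℝ) + 2 ≠ 0 := by positivity
  refine ⟨4 * n * (n + 2) * c, J₁, J₂, J₃, W, ⟨(c * (n + 2)) • LinearMap.id, fun x y ↦ ?_, ?_⟩,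
    h.toIsStandardTriple, rfl, hW, ?_, hric, fun x y z ↦ ?_⟩
  · have e := ricci_eq_trace R x y (c • (R₀.flip x).flip y + (W.flip x).flip y)
      (fun z ↦ by simp [hWa])
    have e₀ : LinearMap.trace ℝ V ((R₀.flip x).flip y) = (n + 2) * b x y := h.ricci_model hV x y
    have e₁ : LinearMap.trace ℝ V ((W.flip x).flip y) = 0 := hric x y
    rw [e, map_add, map_smul, e₀, e₁]
    simp [mul_assoc]
  · rw [map_smul, LinearMap.trace_id, hV]
    push_cast
    simp only [smul_eq_mul]
    ring
  · intro J hJ x y z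
    obtain ⟨a₁, a₂, a₃, rfl⟩ := h.mem_span_iff.1 hJ
    have i₁ := hW.invariant_of_commute h.symm h.nondegenerate h.skew₁ h₁ x y z
    have i₂ := hW.invariant_of_commute h.symm h.nondegenerate h.skew₂ h₂ x y z
    have i₃ := hW.invariant_of_commute h.symm h.nondegenerate h.skew₃ h₃ x y z
    simp only [add_apply, smul_apply, map_add, map_smul, LinearMap.add_apply,
      LinearMap.smul_apply, i₁, i₂, i₃, h₁, h₂, h₃]
    module
  · rw [hWa]
    have : 4 * (n : ℝ) * (n + 2) * c / (4 * n * (n + 2)) = c := by field_simp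
    rw [this, hR₀, modelCurvatureHom_apply]
    module

end Ricci

/-! ### Curvature on a non-degenerate invariant subspace -/

section Subspace

variable {V : Type*} [AddCommGroup V] [Module ℝ V] [TopologicalSpace V]
  [IsTopologicalAddGroup V] [ContinuousSMul ℝ V]

theorem exists_self_ne_zero {b : V →L[ℝ] V →L[ℝ] ℝ} (hs : ∀ u v, b u v = b v u)
    {L : Submodule ℝ V} {u v : V} (hu : u ∈ L) (hv : v ∈ L) (huv : b u v ≠ 0) :
    ∃ z ∈ L, b z z ≠ 0 := by
  by_contra! H
  have h1 := H (u + v) (L.add_mem hu hv)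
  simp only [map_add, add_apply, H u hu, H v hv, hs v u] at h1
  exact huv (by linarith)

theorem exists_self_ne_zero_of_nondegenerate {b : V →L[ℝ] V →L[ℝ] ℝ} (hs : ∀ u v, b u v = b v u)
    {L : Submodule ℝ V} (hL : L ≠ ⊥) (hnd : ∀ u ∈ L, (∀ v ∈ L, b u v = 0) → u = 0) :
    ∃ z ∈ L, b z z ≠ 0 := by
  obtain ⟨u, hu, hu0⟩ := L.exists_mem_ne_zero_of_ne_bot hL
  have : ∃ v ∈ L, b u v ≠ 0 := by
    by_contra! H
    exact hu0 (hnd u hu H)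
  obtain ⟨v, hv, huv⟩ := this
  exact exists_self_ne_zero hs hu hv huv

/-- The orthogonal complement of a proper non-degenerate subspace contains a vector that is not
null. -/
theorem exists_orthogonal_self_ne_zero [FiniteDimensional ℝ V] {b : V →L[ℝ] V →L[ℝ] ℝ}
    (hs : ∀ u v, b u v = b v u) (hn : ∀ u, (∀ v, b u v = 0) → u = 0)
    {L : Submodule ℝ V} (hL : L ≠ ⊤) (hnd : ∀ u ∈ L, (∀ v ∈ L, b u v = 0) → u = 0) :
    ∃ z, (∀ v ∈ L, b v z = 0) ∧ b z z ≠ 0 := by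
  let β : L →ₗ[ℝ] Module.Dual ℝ L :=
    { toFun := fun u ↦ (b u).toLinearMap ∘ₗ L.subtype
      map_add' := fun u v ↦ by ext; simp
      map_smul' := fun c v ↦ by ext; simp }
  have hβ : Function.Injective β := by
    rw [injective_iff_map_eq_zero]
    exact fun u hu ↦ Subtype.ext (hnd u u.2 fun v hv ↦ LinearMap.congr_fun hu ⟨v, hv⟩)
  have hβs : Function.Surjective β :=
    (LinearMap.injective_iff_surjective_of_finrank_eq_finrank Subspace.dual_finrank_eq.symm).1 hβ
  have proj (v : V) : ∃ l ∈ L, ∀ w ∈ L, b w (v - l) = 0 := by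
    obtain ⟨l, hl⟩ := hβs ((b v).toLinearMap ∘ₗ L.subtype)
    refine ⟨l, l.2, fun w hw ↦ ?_⟩
    have : b l w = b v w := LinearMap.congr_fun hl ⟨w, hw⟩
    rw [map_sub, hs, hs w l, this, sub_self]
  let P : Submodule ℝ V :=
    { carrier := {z | ∀ v ∈ L, b v z = 0}
      zero_mem' := fun v _ ↦ map_zero _
      add_mem' := fun {x y} hx hy v hv ↦ by rw [map_add, hx v hv, hy v hv, add_zero]
      smul_mem' := fun c x hx v hv ↦ by rw [map_smul, hx v hv, smul_zero] }
  obtain ⟨v, -, hv⟩ := SetLike.exists_of_lt (lt_top_iff_ne_top.2 hL)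
  obtain ⟨l, hl, hlv⟩ := proj v
  obtain ⟨z, hz, hz'⟩ : ∃ z ∈ P, b z z ≠ 0 := by
    refine exists_self_ne_zero_of_nondegenerate hs (fun hP ↦ ?_) fun u hu huP ↦ hn u fun w ↦ ?_
    · have : v - l ∈ P := hlv
      rw [hP, Submodule.mem_bot, sub_eq_zero] at this
      exact hv (this ▸ hl)
    · obtain ⟨k, hk, hkw⟩ := proj w
      have h1 := huP _ hkw
      have h2 := hu k hk
      rw [map_sub, hs u k, h2, sub_zero] at h1
      exact h1
  exact ⟨z, hz, hz'⟩

namespace IsSkewTriple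

variable {b : V →L[ℝ] V →L[ℝ] ℝ} {J₁ J₂ J₃ : V →L[ℝ] V} (h : IsSkewTriple b J₁ J₂ J₃)
include h

/-- The identity and the members of a standard triple are linearly independent, already when
they are applied to a vector that is not null. -/
theorem coeff_eq_zero {z : V} (hz : b z z ≠ 0) {a₀ a₁ a₂ a₃ : ℝ}
    (ha : a₀ • z + a₁ • J₁ z + a₂ • J₂ z + a₃ • J₃ z = 0) :
    a₀ = 0 ∧ a₁ = 0 ∧ a₂ = 0 ∧ a₃ = 0 := by
  obtain ⟨⟨f11, f21, f31⟩, ⟨f12, f22, f32⟩, ⟨f13, f23, f33⟩⟩ := h.forms_apply z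
  have t (w : V) : a₀ * b z w + a₁ * b (J₁ z) w + a₂ * b (J₂ z) w + a₃ * b (J₃ z) w = 0 := by
    have := congrArg (fun v ↦ b v w) ha
    simpa using this
  have t0 := t z
  have t1 := t (J₁ z)
  have t2 := t (J₂ z)
  have t3 := t (J₃ z)
  rw [h.form₁_self, h.form₂_self, h.form₃_self] at t0
  rw [h.symm z, h.form₁_self, f11, f21, f31] at t1
  rw [h.symm z, h.form₂_self, f12, f22, f32] at t2
  rw [h.symm z, h.form₃_self, f13, f23, f33] at t3
  refine ⟨?_, ?_, ?_, ?_⟩ <;> exact (mul_eq_zero.1 (by linarith)).resolve_right hz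

/-- An endomorphism that normalizes the span of the triple acts on it like an element of the span:
its commutators with the triple are described by three coefficients. -/
theorem exists_commutator_coeff {z₀ : V} (hz₀ : b z₀ z₀ ≠ 0) (T : V →ₗ[ℝ] V)
    (hT : ∀ J ∈ Submodule.span ℝ {J₁, J₂, J₃}, ∃ C ∈ Submodule.span ℝ {J₁, J₂, J₃},
      ∀ z, T (J z) - J (T z) = C z) :
    ∃ w₁ w₂ w₃ : ℝ, (∀ z, T (J₁ z) - J₁ (T z) = w₃ • J₂ z - w₂ • J₃ z) ∧
      (∀ z, T (J₂ z) - J₂ (T z) = w₁ • J₃ z + w₃ • J₁ z) ∧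
      (∀ z, T (J₃ z) - J₃ (T z) = -(w₁ • J₂ z) - w₂ • J₁ z) := by
  have hJ := h.toIsStandardTriple
  have hex (J : V →L[ℝ] V) (hJQ : J ∈ ({J₁, J₂, J₃} : Set (V →L[ℝ] V))) :
      ∃ a₁ a₂ a₃ : ℝ, ∀ z, T (J z) - J (T z) = a₁ • J₁ z + a₂ • J₂ z + a₃ • J₃ z := by
    obtain ⟨C, hC, hCz⟩ := hT J (Submodule.subset_span hJQ)
    obtain ⟨a₁, a₂, a₃, rfl⟩ := h.mem_span_iff.1 hC
    exact ⟨a₁, a₂, a₃, hCz⟩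
  obtain ⟨a₁, a₂, a₃, ha⟩ := hex J₁ (by simp)
  obtain ⟨b₁, b₂, b₃, hb⟩ := hex J₂ (by simp)
  obtain ⟨c₁, c₂, c₃, hc⟩ := hex J₃ (by simp)
  -- differentiate `J₁² = -1`
  obtain ⟨e₁, -, -, -⟩ := h.coeff_eq_zero (a₀ := -2 * a₁) (a₁ := 0) (a₂ := 0) (a₃ := 0) hz₀ (by
    have p := ha (J₁ z₀)
    have q := congrArg J₁ (ha z₀)
    simp only [map_add, map_sub, map_smul, hJ.sq₁, hJ.mul, hJ.anti, hJ.mul₁₃, hJ.mul₃₁,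
      map_neg] at p q
    linear_combination (norm := module) - p - q)
  -- differentiate `J₂² = 1`
  obtain ⟨e₂, -, -, -⟩ := h.coeff_eq_zero (a₀ := 2 * b₂) (a₁ := 0) (a₂ := 0) (a₃ := 0) hz₀ (by
    have p := hb (J₂ z₀)
    have q := congrArg J₂ (hb z₀)
    simp only [map_add, map_sub, map_smul, hJ.sq₂, hJ.mul, hJ.anti, hJ.mul₂₃, hJ.mul₃₂] at p q
    linear_combination (norm := module) - p - q)
  -- differentiate `J₁ J₂ = J₃`
  obtain ⟨f₀, f₁, f₂, f₃⟩ := h.coeff_eq_zero (a₀ := a₂ - b₁) (a₁ := a₃ - c₁)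
    (a₂ := -b₃ - c₂) (a₃ := a₁ + b₂ - c₃) hz₀ (by
      have p := ha (J₂ z₀)
      have q := congrArg J₁ (hb z₀)
      have r := hc z₀
      simp only [map_add, map_sub, map_smul, hJ.sq₁, hJ.sq₂, hJ.mul, hJ.mul₁₃, hJ.mul₃₂] at p q r
      linear_combination (norm := module) r - p - q)
  have e₁' : a₁ = 0 := by linarith
  have e₂' : b₂ = 0 := by linarith
  refine ⟨b₃, -a₃, a₂, fun z ↦ ?_, fun z ↦ ?_, fun z ↦ ?_⟩
  · rw [ha, e₁']; module
  · rw [hb, e₂', show a₂ = b₁ by linarith]; module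
  · rw [hc, show c₁ = a₃ by linarith, show c₂ = -b₃ by linarith, show c₃ = 0 by linarith]; module

variable {R : V →ₗ[ℝ] V →ₗ[ℝ] V →ₗ[ℝ] V} {L : Submodule ℝ V}

/-- The commutator of `R(x, y)` with `J` and the one of `R(z, u)` with `J` are dual to each other
when `x, y` belong to an invariant subspace `L` and `z, u` to its orthogonal complement. Indeed
the first Bianchi identity expresses both through the mixed terms `⟨R(x, z) y, u⟩`, in which
`R(x, z)` may be regarded as commuting with `J`. -/
theorem commutator_duality (hR : IsAlgebraicCurvature b R)
    (hQ : ∀ x y, ∀ J ∈ Submodule.span ℝ {J₁, J₂, J₃}, ∃ C ∈ Submodule.span ℝ {J₁, J₂, J₃},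
      ∀ z, R x y (J z) - J (R x y z) = C z)
    (hinv : ∀ J ∈ Submodule.span ℝ {J₁, J₂, J₃}, ∀ v ∈ L, J v ∈ L)
    {J : V →L[ℝ] V} (hJ : J ∈ Submodule.span ℝ {J₁, J₂, J₃}) (hJs : ∀ u v, b (J u) v = -b u (J v))
    {x y z u : V} (hx : x ∈ L) (hy : y ∈ L) (hz : ∀ v ∈ L, b v z = 0) (hu : ∀ v ∈ L, b v u = 0) :
    b (R x y (J z) - J (R x y z)) u = -b (R z u (J x) - J (R z u x)) y := by
  have hperp {z : V} (hz : ∀ v ∈ L, b v z = 0) : ∀ v ∈ L, b v (J z) = 0 := fun v hv ↦ by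
    rw [← neg_eq_zero, ← hJs]; exact hz _ (hinv J hJ v hv)
  have F₁ (p q c d : V) (hc : c ∈ L) (hd : ∀ v ∈ L, b v d = 0) :
      b (R p q (J c)) d = -b (R p q c) (J d) := by
    obtain ⟨C, hC, hCz⟩ := hQ p q J hJ
    have := hd _ (hinv C hC c hc)
    rw [← hCz, map_sub, sub_apply, hJs] at this
    linarith
  have F₂ (p q c d : V) (hp : p ∈ L) (hq : ∀ v ∈ L, b v q = 0) :
      b (R (J p) q c) d = -b (R p (J q) c) d := by
    rw [hR.pair_symm h.symm, F₁ _ _ _ _ hp hq, hR.pair_symm h.symm p]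
  have B (p q r s : V) : b (R p q r) s = b (R p r q) s - b (R q r p) s := by
    have := congrArg (fun v ↦ b v s) (hR.bianchi p q r)
    rw [hR.antisymm r p q] at this
    simp only [map_add, map_neg, add_apply, neg_apply, map_zero, zero_apply] at this
    linarith
  rw [map_sub, sub_apply, map_sub, sub_apply, hJs, hJs, hR.pair_symm h.symm z u (J x),
    hR.pair_symm h.symm z u x]
  linarith [B x y (J z) u, B x y z (J u), B (J x) y z u, B x (J y) z u, F₁ x z y u hy hu,
    F₁ y z x u hx hu, F₂ x z y u hx hz, F₂ y z x u hy hz]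

/-- On a proper non-degenerate invariant subspace `L`, the commutators of a curvature tensor that
normalizes the span of the triple are those of a multiple of the model curvature. -/
theorem exists_commutators_on [FiniteDimensional ℝ V] (hR : IsAlgebraicCurvature b R)
    (hQ : ∀ x y, ∀ J ∈ Submodule.span ℝ {J₁, J₂, J₃}, ∃ C ∈ Submodule.span ℝ {J₁, J₂, J₃},
      ∀ z, R x y (J z) - J (R x y z) = C z)
    (hinv : ∀ J ∈ Submodule.span ℝ {J₁, J₂, J₃}, ∀ v ∈ L, J v ∈ L)
    (hnd : ∀ u ∈ L, (∀ v ∈ L, b u v = 0) → u = 0) (hbot : L ≠ ⊥) (htop : L ≠ ⊤) :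
    ∃ c : ℝ, ∀ x ∈ L, ∀ y ∈ L, ∀ z,
      R x y (J₁ z) - J₁ (R x y z) = c • (b (J₃ x) y • J₂ z - b (J₂ x) y • J₃ z) ∧
      R x y (J₂ z) - J₂ (R x y z) = c • (b (J₃ x) y • J₁ z - b (J₁ x) y • J₃ z) ∧
      R x y (J₃ z) - J₃ (R x y z) = c • (b (J₁ x) y • J₂ z - b (J₂ x) y • J₁ z) := by
  obtain ⟨x₀, hx₀, hx₀'⟩ := exists_self_ne_zero_of_nondegenerate h.symm hbot hnd
  obtain ⟨z₀, hz₀, hz₀'⟩ := exists_orthogonal_self_ne_zero h.symm h.nondegenerate htop hnd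
  have m₁ : J₁ ∈ Submodule.span ℝ {J₁, J₂, J₃} := Submodule.subset_span (by simp)
  have m₂ : J₂ ∈ Submodule.span ℝ {J₁, J₂, J₃} := Submodule.subset_span (by simp)
  have m₃ : J₃ ∈ Submodule.span ℝ {J₁, J₂, J₃} := Submodule.subset_span (by simp)
  have hperp {J : V →L[ℝ] V} (hJ : J ∈ Submodule.span ℝ {J₁, J₂, J₃})
      (hJs : ∀ u v, b (J u) v = -b u (J v)) : ∀ v ∈ L, b v (J z₀) = 0 := fun v hv ↦ by
    rw [← neg_eq_zero, ← hJs]; exact hz₀ _ (hinv J hJ v hv)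
  have hw (x y : V) := h.exists_commutator_coeff hx₀' (R x y) (hQ x y)
  choose w₁ w₂ w₃ hw₁ hw₂ hw₃ using hw
  have E₁ {x y z u : V} (hx : x ∈ L) (hy : y ∈ L) (hz : ∀ v ∈ L, b v z = 0)
      (hu : ∀ v ∈ L, b v u = 0) :
      w₃ x y * b (J₂ z) u - w₂ x y * b (J₃ z) u =
        -(w₃ z u * b (J₂ x) y - w₂ z u * b (J₃ x) y) := by
    have := h.commutator_duality hR hQ hinv m₁ h.skew₁ hx hy hz hu
    rw [hw₁, hw₁] at this
    simpa using this
  have E₂ {x y z u : V} (hx : x ∈ L) (hy : y ∈ L) (hz : ∀ v ∈ L, b v z = 0)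
      (hu : ∀ v ∈ L, b v u = 0) :
      w₁ x y * b (J₃ z) u + w₃ x y * b (J₁ z) u =
        -(w₁ z u * b (J₃ x) y + w₃ z u * b (J₁ x) y) := by
    have := h.commutator_duality hR hQ hinv m₂ h.skew₂ hx hy hz hu
    rw [hw₂, hw₂] at this
    simpa [add_comm] using this
  have E₃ {x y z u : V} (hx : x ∈ L) (hy : y ∈ L) (hz : ∀ v ∈ L, b v z = 0)
      (hu : ∀ v ∈ L, b v u = 0) :
      w₁ x y * b (J₂ z) u + w₂ x y * b (J₁ z) u =
        -(w₁ z u * b (J₂ x) y + w₂ z u * b (J₁ x) y) := by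
    have := h.commutator_duality hR hQ hinv m₃ h.skew₃ hx hy hz hu
    rw [hw₃, hw₃] at this
    simp only [map_sub, map_neg, map_smul, sub_apply, neg_apply, smul_apply, smul_eq_mul] at this
    linarith
  -- test vectors: `(z₀, Jᵢ z₀)` in the complement and `(x₀, Jᵢ x₀)` in `L` separate the three forms
  obtain ⟨⟨f11, f21, f31⟩, ⟨f12, f22, f32⟩, ⟨f13, f23, f33⟩⟩ := h.forms_apply z₀
  obtain ⟨⟨g11, g21, g31⟩, ⟨g12, g22, g32⟩, ⟨g13, g23, g33⟩⟩ := h.forms_apply x₀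
  have p₁ := hperp m₁ h.skew₁
  have p₂ := hperp m₂ h.skew₂
  have p₃ := hperp m₃ h.skew₃
  have q₁ := hinv _ m₁ x₀ hx₀
  have q₂ := hinv _ m₂ x₀ hx₀
  have q₃ := hinv _ m₃ x₀ hx₀
  set N := b z₀ z₀
  have A₁ {x y : V} (hx : x ∈ L) (hy : y ∈ L) :
      N * w₁ x y = w₁ z₀ (J₂ z₀) * b (J₂ x) y + w₂ z₀ (J₂ z₀) * b (J₁ x) y := by
    have := E₃ hx hy hz₀ p₂
    rw [f22, f12] at this; linarith
  have A₂ {x y : V} (hx : x ∈ L) (hy : y ∈ L) :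
      N * w₁ x y = w₁ z₀ (J₃ z₀) * b (J₃ x) y + w₃ z₀ (J₃ z₀) * b (J₁ x) y := by
    have := E₂ hx hy hz₀ p₃
    rw [f33, f13] at this; linarith
  have A₃ {x y : V} (hx : x ∈ L) (hy : y ∈ L) :
      N * w₃ x y = -(w₁ z₀ (J₁ z₀) * b (J₃ x) y + w₃ z₀ (J₁ z₀) * b (J₁ x) y) := by
    have := E₂ hx hy hz₀ p₁
    rw [f31, f11] at this; linarith
  have A₄ {x y : V} (hx : x ∈ L) (hy : y ∈ L) :
      N * w₃ x y = w₃ z₀ (J₂ z₀) * b (J₂ x) y - w₂ z₀ (J₂ z₀) * b (J₃ x) y := by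
    have := E₁ hx hy hz₀ p₂
    rw [f22, f32] at this; linarith
  have A₅ {x y : V} (hx : x ∈ L) (hy : y ∈ L) :
      N * w₂ x y = -(w₁ z₀ (J₁ z₀) * b (J₂ x) y + w₂ z₀ (J₁ z₀) * b (J₁ x) y) := by
    have := E₃ hx hy hz₀ p₁
    rw [f21, f11] at this; linarith
  have A₆ {x y : V} (hx : x ∈ L) (hy : y ∈ L) :
      N * w₂ x y = -(w₃ z₀ (J₃ z₀) * b (J₂ x) y - w₂ z₀ (J₃ z₀) * b (J₃ x) y) := by
    have := E₁ hx hy hz₀ p₃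
    rw [f23, f33] at this; linarith
  have k₁ : w₁ z₀ (J₂ z₀) = 0 := by
    have r := A₁ hx₀ q₂
    rw [A₂ hx₀ q₂, g12, g22, g32] at r
    exact (mul_eq_zero.1 (by linarith)).resolve_right hx₀'
  have k₂ : w₃ z₀ (J₁ z₀) = 0 := by
    have r := A₃ hx₀ q₁
    rw [A₄ hx₀ q₁, g11, g21, g31] at r
    exact (mul_eq_zero.1 (by linarith)).resolve_right hx₀'
  have k₃ : w₂ z₀ (J₁ z₀) = 0 := by
    have r := A₅ hx₀ q₁
    rw [A₆ hx₀ q₁, g11, g21, g31] at r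
    exact (mul_eq_zero.1 (by linarith)).resolve_right hx₀'
  have k₄ : w₁ z₀ (J₁ z₀) = w₂ z₀ (J₂ z₀) := by
    have r := A₃ hx₀ q₃
    rw [A₄ hx₀ q₃, g13, g23, g33] at r
    exact mul_right_cancel₀ hx₀' (by linarith)
  refine ⟨-w₂ z₀ (J₂ z₀) / N, fun x hx y hy z ↦ ?_⟩
  have hN (a : ℝ) {s t : ℝ} (hst : N * s = a * t) : s = a / N * t := by
    rw [div_mul_eq_mul_div, eq_div_iff hz₀', ← hst, mul_comm]
  have r₁ := hN (w₂ z₀ (J₂ z₀)) (by rw [A₁ hx hy, k₁]; ring : N * w₁ x y = _ * b (J₁ x) y)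
  have r₂ := hN (-w₂ z₀ (J₂ z₀)) (by rw [A₅ hx hy, k₃, k₄]; ring : N * w₂ x y = _ * b (J₂ x) y)
  have r₃ := hN (-w₂ z₀ (J₂ z₀)) (by rw [A₃ hx hy, k₂, k₄]; ring : N * w₃ x y = _ * b (J₃ x) y)
  rw [hw₁, hw₂, hw₃, r₁, r₂, r₃]
  refine ⟨?_, ?_, ?_⟩ <;> module

end IsSkewTriple

end Subspace

/-! ### Transport of the curvature decomposition -/

section Transport

variable {V : Type*} [AddCommGroup V] [Module ℝ V] [TopologicalSpace V]
  [IsTopologicalAddGroup V] [ContinuousSMul ℝ V]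
  {V' : Type*} [AddCommGroup V'] [Module ℝ V'] [TopologicalSpace V']
  [IsTopologicalAddGroup V'] [ContinuousSMul ℝ V']

theorem ricci_transport (φ : V ≃L[ℝ] V') {R : V →ₗ[ℝ] V →ₗ[ℝ] V →ₗ[ℝ] V}
    {R' : V' →ₗ[ℝ] V' →ₗ[ℝ] V' →ₗ[ℝ] V'} (hR : ∀ x y z, φ (R x y z) = R' (φ x) (φ y) (φ z))
    (x y : V) : ricci R x y = ricci R' (φ x) (φ y) := by
  unfold ricci
  rw [← LinearMap.trace_conj' _ φ.toLinearEquiv]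
  congr 1
  ext z
  obtain ⟨z, rfl⟩ := φ.surjective z
  rw [LinearEquiv.conj_apply_apply]
  change φ (R (φ.symm (φ z)) x y) = R' (φ z) (φ x) (φ y)
  rw [φ.symm_apply_apply, hR]

/-- The curvature decomposition is natural under linear isometries. -/
theorem AdmitsDecomposition.transport (φ : V ≃L[ℝ] V') {n : ℕ} {b : V →L[ℝ] V →L[ℝ] ℝ}
    {b' : V' →L[ℝ] V' →L[ℝ] ℝ} {Q : Submodule ℝ (V →L[ℝ] V)} {Q' : Submodule ℝ (V' →L[ℝ] V')}
    {R : V →ₗ[ℝ] V →ₗ[ℝ] V →ₗ[ℝ] V} {R' : V' →ₗ[ℝ] V' →ₗ[ℝ] V' →ₗ[ℝ] V'}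
    (hb : ∀ x y, b x y = b' (φ x) (φ y))
    (hQ : ∀ A, A ∈ Q ↔ ∃ J ∈ Q', ∀ u, φ (A u) = J (φ u))
    (hR : ∀ x y z, φ (R x y z) = R' (φ x) (φ y) (φ z)) (h : AdmitsDecomposition n b' Q' R') :
    AdmitsDecomposition n b Q R := by
  obtain ⟨s, J₁, J₂, J₃, W', ⟨Rc, hRc, rfl⟩, hJ, hQ', hW', hinv, hric, hdec⟩ := h
  let pull (J : V' →L[ℝ] V') : V →L[ℝ] V := φ.symm.toContinuousLinearMap ∘L J ∘L
    φ.toContinuousLinearMap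
  have hpull (J : V' →L[ℝ] V') (u : V) : φ (pull J u) = J (φ u) := by simp [pull]
  let W : V →ₗ[ℝ] V →ₗ[ℝ] V →ₗ[ℝ] V := LinearMap.mk₂ ℝ
    (fun x y ↦ φ.symm.toLinearEquiv.toLinearMap ∘ₗ W' (φ x) (φ y) ∘ₗ φ.toLinearEquiv.toLinearMap)
    (fun x x' y ↦ by ext; simp) (fun c x y ↦ by ext; simp)
    (fun x x' y ↦ by ext; simp) (fun c x y ↦ by ext; simp)
  have hW (x y z : V) : φ (W x y z) = W' (φ x) (φ y) (φ z) := by simp [W]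
  have inj {u v : V} (huv : φ u = φ v) : u = v := φ.injective huv
  refine ⟨LinearMap.trace ℝ V' Rc, pull J₁, pull J₂, pull J₃, W,
    ⟨φ.symm.toLinearEquiv.conj Rc, fun x y ↦ ?_, ?_⟩, ?_, ?_, ?_, ?_, fun x y ↦ ?_, fun x y z ↦ ?_⟩
  · rw [hb, ricci_transport φ hR, ← hRc]
    congr 2
    simp [LinearEquiv.conj_apply]
  · exact (LinearMap.trace_conj' _ _).symm
  · constructor <;> intro v <;> apply inj <;>
      simp only [hpull, hJ.sq₁, hJ.sq₂, hJ.sq₃, hJ.mul, hJ.anti, map_neg]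
  · ext A
    rw [hQ, hQ', Submodule.mem_span_triple]
    constructor
    · rintro ⟨J, hJ', hA⟩
      obtain ⟨a₁, a₂, a₃, rfl⟩ := Submodule.mem_span_triple.1 hJ'
      refine ⟨a₁, a₂, a₃, ?_⟩
      ext u
      apply inj
      simp [hA, hpull]
    · rintro ⟨a₁, a₂, a₃, rfl⟩
      refine ⟨_, Submodule.mem_span_triple.2 ⟨a₁, a₂, a₃, rfl⟩, fun u ↦ ?_⟩
      simp [hpull]
  · refine ⟨fun x y z ↦ inj ?_, fun x y z u ↦ ?_, fun x y z ↦ inj ?_⟩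
    · rw [map_neg, hW, hW, hW'.antisymm]
    · rw [hb, hb, hW, hW, hW'.skew]
    · rw [map_add, map_add, hW, hW, hW, hW'.bianchi, map_zero]
  · intro A hA x y z
    obtain ⟨J, hJ', hA⟩ := (hQ A).1 hA
    apply inj
    simp only [map_sub, hA, hW, map_zero]
    exact hinv J hJ' _ _ _
  · rw [ricci_transport φ hW, hric]
  · apply inj
    rw [hR, hdec, map_add, map_smul, hW]
    congr 2
    simp only [modelCurvature, wedge, map_add, map_sub, map_smul, map_neg, hpull, hb]

end Transport

/-! ### Smooth homomorphisms of vector bundles -/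

section HomBundle

variable {E : Type*} [NormedAddCommGroup E] [NormedSpace ℝ E]
  {M : Type*} [TopologicalSpace M] [ChartedSpace E M]
  {F₁ : Type*} [NormedAddCommGroup F₁] [NormedSpace ℝ F₁] [FiniteDimensional ℝ F₁]
  {V₁ : M → Type*} [TopologicalSpace (TotalSpace F₁ V₁)] [∀ x, AddCommGroup (V₁ x)]
  [∀ x, Module ℝ (V₁ x)] [∀ x, TopologicalSpace (V₁ x)] [FiberBundle F₁ V₁] [VectorBundle ℝ F₁ V₁]
  {F₂ : Type*} [NormedAddCommGroup F₂] [NormedSpace ℝ F₂]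
  {V₂ : M → Type*} [TopologicalSpace (TotalSpace F₂ V₂)] [∀ x, AddCommGroup (V₂ x)]
  [∀ x, Module ℝ (V₂ x)] [∀ x, TopologicalSpace (V₂ x)] [FiberBundle F₂ V₂] [VectorBundle ℝ F₂ V₂]
  [∀ x, IsTopologicalAddGroup (V₂ x)] [∀ x, ContinuousSMul ℝ (V₂ x)]

/-- A field of linear maps out of a vector bundle of finite rank is `C^k` if it sends `C^k`
sections to `C^k` sections. -/
theorem contMDiffAt_hom_of_apply {k : ℕ∞ω} [ContMDiffVectorBundle k F₁ V₁ 𝓘(ℝ, E)]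
    (φ : ∀ y, V₁ y →L[ℝ] V₂ y) {x : M}
    (h : ∀ σ : ∀ y, V₁ y, CMDiffAt k (T% σ) x → CMDiffAt k (T% (fun y ↦ φ y (σ y))) x) :
    ContMDiffAt 𝓘(ℝ, E) (𝓘(ℝ, E).prod 𝓘(ℝ, F₁ →L[ℝ] F₂)) k
      (fun y ↦ TotalSpace.mk' (F₁ →L[ℝ] F₂) (E := fun y ↦ V₁ y →L[ℝ] V₂ y) y (φ y)) x := by
  classical
  rw [contMDiffAt_hom_bundle]
  refine ⟨contMDiffAt_id, ?_⟩
  let e₁ := trivializationAt F₁ V₁ x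
  let e₂ := trivializationAt F₂ V₂ x
  have hx₁ : x ∈ e₁.baseSet := FiberBundle.mem_baseSet_trivializationAt F₁ V₁ x
  have hx₂ : x ∈ e₂.baseSet := FiberBundle.mem_baseSet_trivializationAt F₂ V₂ x
  let b := Module.finBasis ℝ F₁
  let w : Fin (Module.finrank ℝ F₁) → M → F₂ := fun i y ↦ (e₂ ⟨y, φ y (e₁.localFrame b i y)⟩).2
  have hw : ∀ i, CMDiffAt k (w i) x := fun i ↦ by
    exact (contMDiffAt_section (IB := 𝓘(ℝ, E)) _).1
      (h _ (contMDiffAt_localFrame_of_mem k e₁ b i hx₁))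
  let c : Fin (Module.finrank ℝ F₁) → (F₂ →L[ℝ] F₁ →L[ℝ] F₂) := fun i ↦
    ContinuousLinearMap.smulRightL ℝ F₁ F₂ (LinearMap.toContinuousLinearMap (b.coord i))
  have hsum : CMDiffAt k (fun y ↦ ∑ i, c i (w i y)) x :=
    ContMDiffAt.sum fun i _ ↦ (c i).contMDiff.contMDiffAt.comp x (hw i)
  refine hsum.congr_of_eventuallyEq ?_
  filter_upwards [e₁.open_baseSet.mem_nhds hx₁, e₂.open_baseSet.mem_nhds hx₂] with y hy₁ hy₂
  ext v
  simp only [ContinuousLinearMap.inCoordinates, ContinuousLinearMap.comp_apply,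
    sum_apply]
  conv_lhs => rw [← b.sum_repr v]
  simp only [map_sum, map_smul]
  refine Finset.sum_congr rfl fun i _ ↦ ?_
  simp [c, w, e₁, e₂] at hy₁ hy₂ ⊢
  congr 1
  simp [Bundle.Trivialization.localFrame, Bundle.Trivialization.basisAt, hy₁, hy₂,
    Trivialization.coe_linearMapAt_of_mem]

end HomBundle

/-! ### Push-forward of vector fields and smoothness of metrics -/

section Pushforward

variable {E : Type*} [NormedAddCommGroup E] [NormedSpace ℝ E]
  {M : Type*} [TopologicalSpace M] [ChartedSpace E M] [IsManifold 𝓘(ℝ, E) ∞ M]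
  {E' : Type*} [NormedAddCommGroup E'] [NormedSpace ℝ E']
  {N : Type*} [TopologicalSpace N] [ChartedSpace E' N] [IsManifold 𝓘(ℝ, E') ∞ N]
  {E'' : Type*} [NormedAddCommGroup E''] [NormedSpace ℝ E'']
  {P : Type*} [TopologicalSpace P] [ChartedSpace E'' P] [IsManifold 𝓘(ℝ, E'') ∞ P]

/-- If `v` is a smooth field of tangent vectors along `b`, then `df v` is a smooth field along
`f ∘ b`. -/
theorem contMDiffAt_pushforward {f : M → N} {b : P → M} {p : P}
    {v : ∀ p : P, TangentSpace 𝓘(ℝ, E) (b p)}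
    (hf : CMDiffAt ∞ f (b p))
    (hv : ContMDiffAt 𝓘(ℝ, E'') (𝓘(ℝ, E).prod 𝓘(ℝ, E)) ∞
      (fun p ↦ (⟨b p, v p⟩ : TangentBundle 𝓘(ℝ, E) M)) p) :
    ContMDiffAt 𝓘(ℝ, E'') (𝓘(ℝ, E').prod 𝓘(ℝ, E')) ∞
      (fun p ↦ (⟨f (b p), mfderiv 𝓘(ℝ, E) 𝓘(ℝ, E') f (b p) (v p)⟩ : TangentBundle 𝓘(ℝ, E') N))
      p := by
  have hb : CMDiffAt ∞ b p := (contMDiffAt_totalSpace.1 hv).1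
  refine ContMDiffAt.clm_apply_of_inCoordinates (F₁ := E) (F₂ := E')
    (E₁ := (TangentSpace 𝓘(ℝ, E) : M → Type _)) (E₂ := (TangentSpace 𝓘(ℝ, E') : N → Type _))
    (b₁ := b) (b₂ := fun p ↦ f (b p))
    (ϕ := fun p ↦ mfderiv 𝓘(ℝ, E) 𝓘(ℝ, E') f (b p)) ?_ hv (hf.comp p hb)
  have h1 : ContMDiffAt (𝓘(ℝ, E'').prod 𝓘(ℝ, E)) 𝓘(ℝ, E') ∞
      (Function.uncurry fun (_ : P) ↦ f) (p, b p) :=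
    ContMDiffAt.comp (p, b p) hf contMDiffAt_snd
  exact ContMDiffAt.mfderiv (fun _ ↦ f) b h1 hb (by simp)

theorem mdifferentiableAt_pushforward {f : M → N} {b : P → M} {p : P}
    {v : ∀ p : P, TangentSpace 𝓘(ℝ, E) (b p)} (hf : CMDiffAt ∞ f (b p)) (hb : CMDiffAt ∞ b p)
    (hv : MDifferentiableAt 𝓘(ℝ, E'') (𝓘(ℝ, E).prod 𝓘(ℝ, E))
      (fun p ↦ (⟨b p, v p⟩ : TangentBundle 𝓘(ℝ, E) M)) p) :
    MDifferentiableAt 𝓘(ℝ, E'') (𝓘(ℝ, E').prod 𝓘(ℝ, E'))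
      (fun p ↦ (⟨f (b p), mfderiv 𝓘(ℝ, E) 𝓘(ℝ, E') f (b p) (v p)⟩ : TangentBundle 𝓘(ℝ, E') N))
      p := by
  refine MDifferentiableAt.clm_apply_of_inCoordinates (F₁ := E) (F₂ := E')
    (E₁ := (TangentSpace 𝓘(ℝ, E) : M → Type _)) (E₂ := (TangentSpace 𝓘(ℝ, E') : N → Type _))
    (b₁ := b) (b₂ := fun p ↦ f (b p))
    (ϕ := fun p ↦ mfderiv 𝓘(ℝ, E) 𝓘(ℝ, E') f (b p)) ?_ hv
    ((hf.comp p hb).mdifferentiableAt (by simp))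
  have h1 : ContMDiffAt (𝓘(ℝ, E'').prod 𝓘(ℝ, E)) 𝓘(ℝ, E') ∞
      (Function.uncurry fun (_ : P) ↦ f) (p, b p) :=
    ContMDiffAt.comp (p, b p) hf contMDiffAt_snd
  exact (ContMDiffAt.mfderiv (m := ∞) (fun _ ↦ f) b h1 hb (by simp)).mdifferentiableAt (by simp)

/-- The derivative of a smooth function along a smooth field of tangent vectors is smooth. -/
theorem contMDiffAt_mfderiv_apply {φ : M → ℝ} {x : M}
    {X : ∀ y : M, TangentSpace 𝓘(ℝ, E) y} (hφ : CMDiffAt ∞ φ x) (hX : CMDiffAt ∞ (T% X) x) :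
    CMDiffAt ∞ (fun y ↦ (d% φ y (X y))) x := by
  have := contMDiffAt_pushforward (b := id) (v := X) hφ hX
  refine (contMDiffAt_totalSpace.1 this).2.congr_of_eventuallyEq (Filter.Eventually.of_forall ?_)
  intro y
  simp [mvfderiv]
  rfl

end Pushforward

section Metric

variable {E : Type*} [NormedAddCommGroup E] [NormedSpace ℝ E]
  {M : Type*} [TopologicalSpace M] [ChartedSpace E M] [IsManifold 𝓘(ℝ, E) ∞ M]
  {E'' : Type*} [NormedAddCommGroup E''] [NormedSpace ℝ E'']
  {P : Type*} [TopologicalSpace P] [ChartedSpace E'' P]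
  {g : BilinField E M}

theorem IsPseudoRiemannian.contMDiffAt_apply (hg : IsPseudoRiemannian g) {b : P → M}
    {p : P} {v w : ∀ p, TangentSpace 𝓘(ℝ, E) (b p)}
    (hv : ContMDiffAt 𝓘(ℝ, E'') (𝓘(ℝ, E).prod 𝓘(ℝ, E)) ∞
      (fun p ↦ (⟨b p, v p⟩ : TangentBundle 𝓘(ℝ, E) M)) p)
    (hw : ContMDiffAt 𝓘(ℝ, E'') (𝓘(ℝ, E).prod 𝓘(ℝ, E)) ∞
      (fun p ↦ (⟨b p, w p⟩ : TangentBundle 𝓘(ℝ, E) M)) p) :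
    CMDiffAt ∞ (fun p ↦ g (b p) (v p) (w p)) p := by
  have hb : CMDiffAt ∞ b p := (contMDiffAt_totalSpace.1 hv).1
  have : ContMDiffAt 𝓘(ℝ, E'') (𝓘(ℝ, E).prod 𝓘(ℝ)) ∞
      (fun m ↦ TotalSpace.mk' ℝ (E := Bundle.Trivial M ℝ) (b m) (g (b m) (v m) (w m))) p := by
    apply ContMDiffAt.clm_bundle_apply₂ (F₁ := E) (F₂ := E)
    · exact ContMDiffAt.comp p hg.smooth.contMDiffAt hb
    · exact hv
    · exact hw
  exact (contMDiffAt_totalSpace.1 this).2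

theorem IsPseudoRiemannian.mdifferentiableAt_apply (hg : IsPseudoRiemannian g)
    {x : M} {v w : ∀ p, TangentSpace 𝓘(ℝ, E) p}
    (hv : MDiffAt (T% v) x) (hw : MDiffAt (T% w) x) :
    MDiffAt (fun p ↦ g p (v p) (w p)) x := by
  have : MDifferentiableAt 𝓘(ℝ, E) (𝓘(ℝ, E).prod 𝓘(ℝ))
      (fun m ↦ TotalSpace.mk' ℝ (E := Bundle.Trivial M ℝ) m (g m (v m) (w m))) x := by
    apply MDifferentiableAt.clm_bundle_apply₂ (F₁ := E) (F₂ := E)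
    · exact hg.smooth.contMDiffAt.mdifferentiableAt (by simp)
    · exact hv
    · exact hw
  exact ((mdifferentiableAt_totalSpace _ _).1 this).2

/-- A bilinear field which is smooth on smooth vector fields is smooth. -/
theorem contMDiffAt_bilinField_of_apply [FiniteDimensional ℝ E] {x : M}
    (h : ∀ X Y : ∀ y : M, TangentSpace 𝓘(ℝ, E) y, CMDiffAt ∞ (T% X) x → CMDiffAt ∞ (T% Y) x →
      CMDiffAt ∞ (fun y ↦ g y (X y) (Y y)) x) :
    ContMDiffAt 𝓘(ℝ, E) (𝓘(ℝ, E).prod 𝓘(ℝ, E →L[ℝ] E →L[ℝ] ℝ)) ∞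
    (fun y ↦ TotalSpace.mk' (E →L[ℝ] E →L[ℝ] ℝ)
      (E := fun y : M ↦ TangentSpace 𝓘(ℝ, E) y →L[ℝ] TangentSpace 𝓘(ℝ, E) y →L[ℝ] ℝ) y (g y))
      x := by
  refine contMDiffAt_hom_of_apply (F₁ := E) (V₁ := (TangentSpace 𝓘(ℝ, E) : M → Type _))
    (F₂ := E →L[ℝ] ℝ) (V₂ := fun y : M ↦ TangentSpace 𝓘(ℝ, E) y →L[ℝ] Bundle.Trivial M ℝ y)
    g fun X hX ↦ ?_
  refine contMDiffAt_hom_of_apply (F₁ := E) (V₁ := (TangentSpace 𝓘(ℝ, E) : M → Type _))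
    (F₂ := ℝ) (V₂ := Bundle.Trivial M ℝ) (fun y ↦ g y (X y)) fun Y hY ↦ ?_
  exact contMDiffAt_totalSpace.2 ⟨contMDiffAt_id, h X Y hX hY⟩

/-- A vector field is smooth if its scalar products with smooth vector fields are smooth:
the isomorphism `TM ≃ T*M` given by the metric has a smooth inverse. -/
theorem IsPseudoRiemannian.contMDiffAt_of_apply [FiniteDimensional ℝ E]
    (hg : IsPseudoRiemannian g) {x : M} {W : ∀ y : M, TangentSpace 𝓘(ℝ, E) y}
    (h : ∀ Z : ∀ y : M, TangentSpace 𝓘(ℝ, E) y, CMDiffAt ∞ (T% Z) x →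
      CMDiffAt ∞ (fun y ↦ g y (W y) (Z y)) x) : CMDiffAt ∞ (T% W) x := by
  let T : M → Type _ := TangentSpace 𝓘(ℝ, E)
  let D : M → Type _ := fun y : M ↦ TangentSpace 𝓘(ℝ, E) y →L[ℝ] Bundle.Trivial M ℝ y
  have hα : ContMDiffAt 𝓘(ℝ, E) (𝓘(ℝ, E).prod 𝓘(ℝ, E →L[ℝ] ℝ)) ∞
      (fun y ↦ TotalSpace.mk' (E →L[ℝ] ℝ)
        (E := fun y : M ↦ TangentSpace 𝓘(ℝ, E) y →L[ℝ] Bundle.Trivial M ℝ y) y (g y (W y))) x := by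
    refine contMDiffAt_hom_of_apply (F₁ := E) (V₁ := (TangentSpace 𝓘(ℝ, E) : M → Type _))
      (F₂ := ℝ) (V₂ := Bundle.Trivial M ℝ) (fun y ↦ g y (W y)) fun Y hY ↦ ?_
    exact contMDiffAt_totalSpace.2 ⟨contMDiffAt_id, h Y hY⟩
  have hα' := (contMDiffAt_section (IB := 𝓘(ℝ, E)) _).1 hα
  have hA := ((contMDiffAt_hom_bundle _).1 (hg.smooth x)).2
  simp only at hA
  set A : M → (E →L[ℝ] E →L[ℝ] ℝ) := fun y ↦
    ContinuousLinearMap.inCoordinates E T (E →L[ℝ] ℝ) D x y x y (g y) with hAdef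
  have hA : CMDiffAt ∞ A x := hA
  rw [contMDiffAt_section]
  have hx₁ : x ∈ (trivializationAt E T x).baseSet := FiberBundle.mem_baseSet_trivializationAt E T x
  have hx₂ : x ∈ (trivializationAt (E →L[ℝ] ℝ) D x).baseSet :=
    FiberBundle.mem_baseSet_trivializationAt _ D x
  -- in a trivialization the metric is an invertible map `E → E*`
  have key : ∀ y, y ∈ (trivializationAt E T x).baseSet →
      y ∈ (trivializationAt (E →L[ℝ] ℝ) D x).baseSet → ∃ Φ : E ≃L[ℝ] (E →L[ℝ] ℝ),
      (Φ : E →L[ℝ] (E →L[ℝ] ℝ)) = A y ∧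
      Φ ((trivializationAt E T x) ⟨y, W y⟩).2 =
        ((trivializationAt (E →L[ℝ] ℝ) D x) ⟨y, g y (W y)⟩).2 := by
    intro y hy₁ hy₂
    have : FiniteDimensional ℝ (TangentSpace 𝓘(ℝ, E) y) := inferInstanceAs (FiniteDimensional ℝ E)
    let e₁ := (trivializationAt E T x).continuousLinearEquivAt ℝ y hy₁
    let e₂ := (trivializationAt (E →L[ℝ] ℝ) D x).continuousLinearEquivAt ℝ y hy₂
    have happ : ∀ v : E, A y v = e₂ (g y (e₁.symm v)) := fun v ↦ by
      rw [hAdef]; simp only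
      rw [ContinuousLinearMap.inCoordinates_eq hy₁ hy₂]; rfl
    have hinj : Function.Injective (A y) := by
      rw [injective_iff_map_eq_zero]
      intro v hv
      rw [happ] at hv
      have h0 : g y (e₁.symm v) = 0 := by simpa using hv
      have := hg.nondegenerate y (e₁.symm v) fun w ↦ by rw [h0]; rfl
      simpa using this
    have hrank : Module.finrank ℝ E = Module.finrank ℝ (E →L[ℝ] ℝ) := by
      rw [(LinearMap.toContinuousLinearMap (𝕜 := ℝ) (E := E) (F' := ℝ)).symm.finrank_eq]
      exact (Subspace.dual_finrank_eq (K := ℝ) (V := E)).symm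
    let Φ :=
      (LinearEquiv.ofInjectiveOfFinrankEq (A y).toLinearMap hinj hrank).toContinuousLinearEquiv
    have hΦ : ∀ v, Φ v = A y v := fun v ↦ rfl
    refine ⟨Φ, by ext v : 1; exact hΦ v, ?_⟩
    rw [hΦ, happ]
    have : e₁.symm ((trivializationAt E T x) ⟨y, W y⟩).2 = W y := by
      rw [ContinuousLinearEquiv.symm_apply_eq]; rfl
    rw [this]; rfl
  obtain ⟨Φ, hΦ, -⟩ := key x hx₁ hx₂
  have hinv : CMDiffAt ∞ (fun y ↦ ContinuousLinearMap.inverse (A y)) x := by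
    have h1 : ContDiffAt ℝ ∞ ContinuousLinearMap.inverse (A x) := by
      rw [← hΦ]; exact contDiffAt_map_inverse Φ
    exact h1.contMDiffAt.comp x hA
  refine (hinv.clm_apply hα').congr_of_eventuallyEq ?_
  filter_upwards [(trivializationAt E T x).open_baseSet.mem_nhds hx₁,
    (trivializationAt (E →L[ℝ] ℝ) D x).open_baseSet.mem_nhds hx₂] with y hy₁ hy₂
  obtain ⟨Ψ, hΨ, hΨ'⟩ := key y hy₁ hy₂
  change _ = ContinuousLinearMap.inverse (A y)
    ((trivializationAt (E →L[ℝ] ℝ) D x) ⟨y, g y (W y)⟩).2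
  rw [← hΨ, ContinuousLinearMap.inverse_equiv, ← hΨ']
  exact (Ψ.symm_apply_apply _).symm

end Metric

/-! ### Smooth vector fields and smooth tensoriality -/

section SmoothFields

open VectorField

variable {E : Type*} [NormedAddCommGroup E] [NormedSpace ℝ E]
  {M : Type*} [TopologicalSpace M] [ChartedSpace E M] [IsManifold 𝓘(ℝ, E) ∞ M]
  {x : M} {X Y Z : ∀ y : M, TangentSpace 𝓘(ℝ, E) y}

theorem eventually_mdifferentiableAt (hX : CMDiffAt ∞ (T% X) x) :
    ∀ᶠ y in 𝓝 x, MDiffAt (T% X) y := by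
  have h1 : CMDiffAt 1 (T% X) x := hX.of_le ENat.LEInfty.out
  exact ((contMDiffAt_iff_contMDiffAt_nhds (by simp)).1 h1).mono
    fun y hy ↦ hy.mdifferentiableAt (by simp)

theorem eventually_mdifferentiableAt_fun {φ : M → ℝ} (hφ : CMDiffAt ∞ φ x) :
    ∀ᶠ y in 𝓝 x, MDiffAt φ y := by
  have h1 : CMDiffAt 1 φ x := hφ.of_le ENat.LEInfty.out
  exact ((contMDiffAt_iff_contMDiffAt_nhds (by simp)).1 h1).mono
    fun y hy ↦ hy.mdifferentiableAt (by simp)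

theorem mdiffAt (hX : CMDiffAt ∞ (T% X) x) : MDiffAt (T% X) x := hX.mdifferentiableAt (by simp)

theorem contMDiffAt_mlieBracket [FiniteDimensional ℝ E] (hX : CMDiffAt ∞ (T% X) x)
    (hY : CMDiffAt ∞ (T% Y) x) : CMDiffAt ∞ (T% (mlieBracket 𝓘(ℝ, E) X Y)) x := by
  have := FiniteDimensional.complete ℝ E
  have : IsManifold 𝓘(ℝ, E) (((⊤ : ℕ∞) : ℕ∞ω) + 1) M := inferInstanceAs (IsManifold 𝓘(ℝ, E) ∞ M)
  have : IsManifold 𝓘(ℝ, E) (minSmoothness ℝ 2) M := by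
    rw [minSmoothness_of_isRCLikeNormedField]
    exact IsManifold.of_le (n := ∞) ENat.LEInfty.out
  exact ContMDiffAt.mlieBracket_vectorField (m := ⊤) (n := ⊤) hX hY (by simp)

theorem contMDiffAt_extend_tangent (x : M) (v : TangentSpace 𝓘(ℝ, E) x) :
    CMDiffAt ∞ (T% (FiberBundle.extend E v : ∀ y : M, TangentSpace 𝓘(ℝ, E) y)) x :=
  FiberBundle.contMDiffAt_extend ..

/-- The Lie bracket is the commutator of derivations: `X (Y φ) - Y (X φ) = [X, Y] φ`. This is read
off from the Jacobi identity for `X`, `Y` and `φ Z` at a point where `Z` does not vanish. -/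
theorem mvfderiv_mvfderiv_sub [FiniteDimensional ℝ E] {φ : M → ℝ} (hφ : CMDiffAt ∞ φ x)
    (hX : CMDiffAt ∞ (T% X) x) (hY : CMDiffAt ∞ (T% Y) x) :
    d% (fun y ↦ d% φ y (Y y)) x (X x) - d% (fun y ↦ d% φ y (X y)) x (Y x) =
      d% φ x (mlieBracket 𝓘(ℝ, E) X Y x) := by
  have := FiniteDimensional.complete ℝ E
  have : IsManifold 𝓘(ℝ, E) (minSmoothness ℝ 3) M := by
    rw [minSmoothness_of_isRCLikeNormedField]
    exact IsManifold.of_le (n := ∞) ENat.LEInfty.out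
  have : IsManifold 𝓘(ℝ, E) (minSmoothness ℝ 2) M := by
    rw [minSmoothness_of_isRCLikeNormedField]
    exact IsManifold.of_le (n := ∞) ENat.LEInfty.out
  rcases subsingleton_or_nontrivial (TangentSpace 𝓘(ℝ, E) x) with hs | hs
  · rw [Subsingleton.elim (X x) 0, Subsingleton.elim (Y x) 0,
      Subsingleton.elim (mlieBracket 𝓘(ℝ, E) X Y x) 0]
    simp
  obtain ⟨z, hz⟩ := exists_ne (0 : TangentSpace 𝓘(ℝ, E) x)
  set Z : ∀ y : M, TangentSpace 𝓘(ℝ, E) y := FiberBundle.extend E z with hZdef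
  have hZ : CMDiffAt ∞ (T% Z) x := contMDiffAt_extend_tangent x z
  have hZx : Z x = z := by simp [hZdef]
  have h2 : ∀ {W : ∀ y : M, TangentSpace 𝓘(ℝ, E) y}, CMDiffAt ∞ (T% W) x →
      CMDiffAt (minSmoothness ℝ 2) (T% W) x := fun h ↦ by
    rw [minSmoothness_of_isRCLikeNormedField]; exact h.of_le ENat.LEInfty.out
  have hφZ : CMDiffAt ∞ (T% (φ • Z)) x := hφ.smul_section hZ
  have e1 : ∀ {W : ∀ y : M, TangentSpace 𝓘(ℝ, E) y}, CMDiffAt ∞ (T% W) x →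
      mlieBracket 𝓘(ℝ, E) W (φ • Z) =ᶠ[𝓝 x]
        (fun y ↦ d% φ y (W y)) • Z + φ • mlieBracket 𝓘(ℝ, E) W Z := fun {W} hW ↦ by
    filter_upwards [eventually_mdifferentiableAt hZ, eventually_mdifferentiableAt_fun hφ]
      with y hy hy'
    rw [mlieBracket_smul_right hy' hy]; rfl
  have e2 : ∀ {W W' : ∀ y : M, TangentSpace 𝓘(ℝ, E) y}, CMDiffAt ∞ (T% W) x →
      CMDiffAt ∞ (T% W') x → mlieBracket 𝓘(ℝ, E) W' (mlieBracket 𝓘(ℝ, E) W (φ • Z)) x =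
        d% (fun y ↦ d% φ y (W y)) x (W' x) • Z x + d% φ x (W x) • mlieBracket 𝓘(ℝ, E) W' Z x
        + (d% φ x (W' x) • mlieBracket 𝓘(ℝ, E) W Z x
          + φ x • mlieBracket 𝓘(ℝ, E) W' (mlieBracket 𝓘(ℝ, E) W Z) x) := fun {W W'} hW hW' ↦ by
    have hWφ := contMDiffAt_mfderiv_apply hφ hW
    have hWZ := contMDiffAt_mlieBracket hW hZ
    rw [Filter.EventuallyEq.mlieBracket_vectorField_eq (Filter.EventuallyEq.refl _ W') (e1 hW),
      mlieBracket_add_right (mdiffAt (hWφ.smul_section hZ)) (mdiffAt (hφ.smul_section hWZ)),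
      mlieBracket_smul_right (hWφ.mdifferentiableAt (by simp)) (mdiffAt hZ),
      mlieBracket_smul_right (hφ.mdifferentiableAt (by simp)) (mdiffAt hWZ)]
  have j1 := leibniz_identity_mlieBracket_apply (h2 hX) (h2 hY) (h2 hφZ)
  have j2 := leibniz_identity_mlieBracket_apply (h2 hX) (h2 hY) (h2 hZ)
  have hXY := contMDiffAt_mlieBracket hX hY
  rw [e2 hY hX, e2 hX hY, mlieBracket_smul_right (hφ.mdifferentiableAt (by simp)) (mdiffAt hZ), j2]
    at j1
  have : (d% (fun y ↦ d% φ y (Y y)) x (X x) - d% (fun y ↦ d% φ y (X y)) x (Y x) -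
      d% φ x (mlieBracket 𝓘(ℝ, E) X Y x)) • z = 0 := by
    rw [← hZx]
    linear_combination (norm := module) j1
  rcases smul_eq_zero.1 this with h | h
  · linarith
  · exact absurd h hz

variable {A : Type*} [AddCommGroup A] [Module ℝ A]

/-- An operation on vector fields is tensorial at `x` if it is additive and homogeneous over germs
of smooth functions on fields that are smooth at `x`. -/
structure IsSmoothTensorialAt (Φ : (∀ y : M, TangentSpace 𝓘(ℝ, E) y) → A) (x : M) : Prop where
  add : ∀ {X Y}, CMDiffAt ∞ (T% X) x → CMDiffAt ∞ (T% Y) x → Φ (X + Y) = Φ X + Φ Y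
  smul : ∀ {φ : M → ℝ} {X}, CMDiffAt ∞ φ x → CMDiffAt ∞ (T% X) x → Φ (φ • X) = φ x • Φ X

namespace IsSmoothTensorialAt

variable {Φ : (∀ y : M, TangentSpace 𝓘(ℝ, E) y) → A}

theorem congr_of_eventuallyEq (hΦ : IsSmoothTensorialAt Φ x) (hX : CMDiffAt ∞ (T% X) x)
    (hY : CMDiffAt ∞ (T% Y) x) (h : ∀ᶠ y in 𝓝 x, X y = Y y) : Φ X = Φ Y := by
  classical
  -- the indicator function of the set where the two fields agree is smooth at `x`
  let ψ (y : M) : ℝ := if X y = Y y then 1 else 0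
  have hψx : ψ x = 1 := by simp [ψ, h.self_of_nhds]
  have hψ : ψ • X = ψ • Y := by
    funext y
    by_cases hy : X y = Y y <;> simp [ψ, hy]
  have hψ' : CMDiffAt ∞ ψ x :=
    (contMDiffAt_const (c := (1 : ℝ))).congr_of_eventuallyEq (h.mono fun y hy ↦ by simp [ψ, hy])
  have h1 := hΦ.smul hψ' hX
  rw [hψ, hΦ.smul hψ' hY, hψx, one_smul, one_smul] at h1
  exact h1.symm

theorem sum (hΦ : IsSmoothTensorialAt Φ x) {ι : Type*} {s : Finset ι}
    (σ : ι → ∀ y : M, TangentSpace 𝓘(ℝ, E) y) (hσ : ∀ i ∈ s, CMDiffAt ∞ (T% (σ i)) x) :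
    Φ (fun y ↦ ∑ i ∈ s, σ i y) = ∑ i ∈ s, Φ (σ i) := by
  classical
  induction s using Finset.induction_on with
  | empty =>
    have h0 : CMDiffAt ∞ (T% (0 : ∀ y : M, TangentSpace 𝓘(ℝ, E) y)) x :=
      (contMDiff_zeroSection ℝ (TangentSpace 𝓘(ℝ, E) : M → Type _)).contMDiffAt
    have := hΦ.add h0 h0
    simp only [Finset.sum_empty]
    change Φ 0 = 0
    simpa using this
  | insert a s ha h =>
    simp only [Finset.mem_insert, forall_eq_or_imp] at hσ
    simp only [Finset.sum_insert ha, ← h hσ.2]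
    exact hΦ.add hσ.1 (.sum_section hσ.2)

theorem congr_of_eq [FiniteDimensional ℝ E] (hΦ : IsSmoothTensorialAt Φ x)
    (hX : CMDiffAt ∞ (T% X) x) (hY : CMDiffAt ∞ (T% Y) x) (h : X x = Y x) : Φ X = Φ Y := by
  let t := trivializationAt E (TangentSpace 𝓘(ℝ, E) : M → Type _) x
  have x_mem : x ∈ t.baseSet := FiberBundle.mem_baseSet_trivializationAt E _ x
  let b := Module.finBasis ℝ E
  let s := t.localFrame b
  let c := t.localFrameCoeff 𝓘(ℝ, E) b
  have hs (i) : CMDiffAt ∞ (T% (s i)) x := contMDiffAt_localFrame_of_mem ∞ _ b i x_mem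
  have hc {X : ∀ y : M, TangentSpace 𝓘(ℝ, E) y} (hX : CMDiffAt ∞ (T% X) x) (i) :
      CMDiffAt ∞ (LinearMap.piApply (c i) X) x := contMDiffAt_localFrameCoeff b x_mem hX i
  have key {X : ∀ y : M, TangentSpace 𝓘(ℝ, E) y} (hX : CMDiffAt ∞ (T% X) x) :
      Φ X = ∑ i, c i x (X x) • Φ (s i) := by
    rw [hΦ.congr_of_eventuallyEq hX (.sum_section fun i _ ↦ (hc hX i).smul_section (hs i))
      (t.eventually_eq_localFrame_sum_coeff_smul b x_mem),
      hΦ.sum _ fun i _ ↦ (hc hX i).smul_section (hs i)]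
    exact Finset.sum_congr rfl fun i _ ↦ hΦ.smul (hc hX i) (hs i)
  rw [key hX, key hY, h]

/-- The linear map on the tangent space defined by a tensorial operation. -/
noncomputable def toLinearMap [FiniteDimensional ℝ E] (hΦ : IsSmoothTensorialAt Φ x) :
    TangentSpace 𝓘(ℝ, E) x →ₗ[ℝ] A where
  toFun v := Φ (FiberBundle.extend E v)
  map_add' u v := by
    have hu := contMDiffAt_extend_tangent x u
    have hv := contMDiffAt_extend_tangent x v
    rw [← hΦ.add hu hv]
    exact hΦ.congr_of_eq (contMDiffAt_extend_tangent x _) (hu.add_section hv) (by simp)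
  map_smul' a v := by
    have hv := contMDiffAt_extend_tangent x v
    have ha : CMDiffAt ∞ (fun _ : M ↦ a) x := contMDiffAt_const
    rw [RingHom.id_apply, ← hΦ.smul ha hv]
    exact hΦ.congr_of_eq (contMDiffAt_extend_tangent x _) (ha.smul_section hv) (by simp)

end IsSmoothTensorialAt

end SmoothFields

/-! ### Curvature of the Levi-Civita connection -/

section Connection

open VectorField

variable {E : Type*} [NormedAddCommGroup E] [NormedSpace ℝ E]
  {M : Type*} [TopologicalSpace M] [ChartedSpace E M] [IsManifold 𝓘(ℝ, E) ∞ M]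
  {x : M} {X Y Z : ∀ y : M, TangentSpace 𝓘(ℝ, E) y} {cov : Connection E M}
  {A : EndField E M} {Q : EndSubspaceField E M} {g : BilinField E M}

theorem cov_add (hX : MDiffAt (T% X) x) (hY : MDiffAt (T% Y) x) (v : TangentSpace 𝓘(ℝ, E) x) :
    cov (X + Y) x v = cov X x v + cov Y x v := by
  rw [cov.isCovariantDerivativeOnUniv.add hX hY]; rfl

theorem cov_smul {φ : M → ℝ} (hφ : MDiffAt φ x) (hX : MDiffAt (T% X) x)
    (v : TangentSpace 𝓘(ℝ, E) x) :
    cov (φ • X) x v = φ x • cov X x v + d% φ x v • X x := by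
  rw [cov.isCovariantDerivativeOnUniv.leibniz hX hφ]; rfl

theorem cov_congr (hX : MDiffAt (T% X) x) (h : X =ᶠ[𝓝 x] Y) : cov X x = cov Y x :=
  cov.isCovariantDerivativeOnUniv.congr_of_eventuallyEq hX
    (hX.congr_of_eventuallyEq (h.symm.mono fun y hy ↦ by simp [hy])) Filter.univ_mem h

theorem SmoothEndFieldAt.apply (hA : SmoothEndFieldAt A x) (hX : CMDiffAt ∞ (T% X) x) :
    CMDiffAt ∞ (T% (fun y ↦ A y (X y))) x :=
  ContMDiffAt.clm_bundle_apply (F₁ := E) (F₂ := E)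
    (E₁ := (TangentSpace 𝓘(ℝ, E) : M → Type _)) (E₂ := (TangentSpace 𝓘(ℝ, E) : M → Type _)) hA hX

theorem SmoothEndFieldAt.mdiff_apply (hA : SmoothEndFieldAt A x) (hX : MDiffAt (T% X) x) :
    MDiffAt (T% (fun y ↦ A y (X y))) x :=
  MDifferentiableAt.clm_bundle_apply (F₁ := E) (F₂ := E)
    (E₁ := (TangentSpace 𝓘(ℝ, E) : M → Type _)) (E₂ := (TangentSpace 𝓘(ℝ, E) : M → Type _))
    (ContMDiffAt.mdifferentiableAt hA (by simp)) hX

theorem smoothEndFieldAt_of_apply [FiniteDimensional ℝ E]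
    (h : ∀ X : ∀ y : M, TangentSpace 𝓘(ℝ, E) y, CMDiffAt ∞ (T% X) x →
      CMDiffAt ∞ (T% (fun y ↦ A y (X y))) x) : SmoothEndFieldAt A x :=
  contMDiffAt_hom_of_apply (F₁ := E) (F₂ := E)
    (V₁ := (TangentSpace 𝓘(ℝ, E) : M → Type _)) (V₂ := (TangentSpace 𝓘(ℝ, E) : M → Type _)) A h

theorem IsLeviCivita.mvfderiv_apply (hc : IsLeviCivita g cov) (hX : MDiffAt (T% X) x)
    (hY : MDiffAt (T% Y) x) (v : TangentSpace 𝓘(ℝ, E) x) :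
    d% (fun y ↦ g y (X y) (Y y)) x v = g x (cov X x v) (Y x) + g x (X x) (cov Y x v) :=
  hc.metric x X Y v hX hY

theorem IsLeviCivita.koszul (hc : IsLeviCivita g cov) (hg : IsPseudoRiemannian g)
    (hX : MDiffAt (T% X) x) (hY : MDiffAt (T% Y) x) (hZ : MDiffAt (T% Z) x) :
    g x (cov Y x (X x)) (Z x) = (1 / 2 : ℝ) *
      (d% (fun y ↦ g y (Y y) (Z y)) x (X x) + d% (fun y ↦ g y (X y) (Z y)) x (Y x)
        - d% (fun y ↦ g y (X y) (Y y)) x (Z x) + g x (mlieBracket 𝓘(ℝ, E) X Y x) (Z x)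
        - g x (mlieBracket 𝓘(ℝ, E) X Z x) (Y x) - g x (mlieBracket 𝓘(ℝ, E) Y Z x) (X x)) := by
  rw [hc.mvfderiv_apply hY hZ, hc.mvfderiv_apply hX hZ, hc.mvfderiv_apply hX hY,
    ← hc.torsion_free x X Y hX hY, ← hc.torsion_free x X Z hX hZ, ← hc.torsion_free x Y Z hY hZ]
  simp only [map_sub, sub_apply]
  rw [hg.symm x (X x) (cov Y x (Z x)), hg.symm x (Y x) (cov Z x (X x)),
    hg.symm x (X x) (cov Z x (Y x))]
  ring

/-- The Levi-Civita connection differentiates smooth fields to smooth fields, as one sees from the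
Koszul formula. -/
theorem IsLeviCivita.contMDiffAt_cov [FiniteDimensional ℝ E] (hc : IsLeviCivita g cov)
    (hg : IsPseudoRiemannian g) (hX : CMDiffAt ∞ (T% X) x) (hY : CMDiffAt ∞ (T% Y) x) :
    CMDiffAt ∞ (T% (fun y ↦ cov Y y (X y))) x := by
  refine hg.contMDiffAt_of_apply fun Z hZ ↦ ?_
  have hd : ∀ {U V W : ∀ y : M, TangentSpace 𝓘(ℝ, E) y}, CMDiffAt ∞ (T% U) x →
      CMDiffAt ∞ (T% V) x → CMDiffAt ∞ (T% W) x →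
      CMDiffAt ∞ (fun y ↦ d% (fun y ↦ g y (U y) (V y)) y (W y)) x := fun hU hV hW ↦
    contMDiffAt_mfderiv_apply (hg.contMDiffAt_apply (b := id) hU hV) hW
  have hb : ∀ {U V W : ∀ y : M, TangentSpace 𝓘(ℝ, E) y}, CMDiffAt ∞ (T% U) x →
      CMDiffAt ∞ (T% V) x → CMDiffAt ∞ (T% W) x →
      CMDiffAt ∞ (fun y ↦ g y (mlieBracket 𝓘(ℝ, E) U V y) (W y)) x := fun hU hV hW ↦
    hg.contMDiffAt_apply (b := id) (contMDiffAt_mlieBracket hU hV) hW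
  have := contMDiffAt_const (c := (1 / 2 : ℝ)) |>.mul
    ((((((hd hY hZ hX).add (hd hX hZ hY)).sub (hd hX hY hZ)).add (hb hX hY hZ)).sub
      (hb hX hZ hY)).sub (hb hY hZ hX))
  refine this.congr_of_eventuallyEq ?_
  filter_upwards [eventually_mdifferentiableAt hX, eventually_mdifferentiableAt hY,
    eventually_mdifferentiableAt hZ] with y h1 h2 h3
  rw [hc.koszul hg h1 h2 h3]
  rfl

/-- The curvature operator `∇_X ∇_Y Z - ∇_Y ∇_X Z - ∇_[X, Y] Z` of vector fields. -/
noncomputable def curvatureOp (cov : Connection E M) (x : M)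
    (X Y Z : ∀ y : M, TangentSpace 𝓘(ℝ, E) y) : TangentSpace 𝓘(ℝ, E) x :=
  cov (fun y ↦ cov Z y (Y y)) x (X x) - cov (fun y ↦ cov Z y (X y)) x (Y x) -
    cov Z x (mlieBracket 𝓘(ℝ, E) X Y x)

theorem curvatureOp_swap : curvatureOp cov x X Y Z = -curvatureOp cov x Y X Z := by
  rw [curvatureOp, curvatureOp, mlieBracket_swap_apply, map_neg]; abel

variable (hsm : ∀ (x : M) (X Y : ∀ y : M, TangentSpace 𝓘(ℝ, E) y),
  CMDiffAt ∞ (T% X) x → CMDiffAt ∞ (T% Y) x → CMDiffAt ∞ (T% (fun y ↦ cov Y y (X y))) x)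
include hsm

theorem isSmoothTensorialAt_curvatureOp_left [FiniteDimensional ℝ E]
    (hZ : CMDiffAt ∞ (T% Z) x) :
    IsSmoothTensorialAt (fun X ↦ curvatureOp cov x X Y Z) x where
  add {X X'} hX hX' := by
    have e : (fun y ↦ cov Z y ((X + X') y)) = (fun y ↦ cov Z y (X y)) + fun y ↦ cov Z y (X' y) := by
      funext y; exact map_add _ _ _
    simp only [curvatureOp]
    rw [e, cov_add (mdiffAt (hsm x _ _ hX hZ)) (mdiffAt (hsm x _ _ hX' hZ)),
      mlieBracket_add_left (mdiffAt hX) (mdiffAt hX'), map_add, Pi.add_apply, map_add]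
    abel
  smul {φ X} hφ hX := by
    have := FiniteDimensional.complete ℝ E
    have e : (fun y ↦ cov Z y ((φ • X) y)) = φ • (fun y ↦ cov Z y (X y)) := by
      funext y; exact map_smul _ _ _
    simp only [curvatureOp]
    rw [e, cov_smul (hφ.mdifferentiableAt (by simp)) (mdiffAt (hsm x _ _ hX hZ)),
      mlieBracket_smul_left (hφ.mdifferentiableAt (by simp)) (mdiffAt hX), map_add, map_smul,
      map_smul]
    change cov _ x (φ x • X x) - _ - _ = _
    rw [map_smul]
    module

theorem isSmoothTensorialAt_curvatureOp_middle [FiniteDimensional ℝ E]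
    (hZ : CMDiffAt ∞ (T% Z) x) :
    IsSmoothTensorialAt (fun Y ↦ curvatureOp cov x X Y Z) x where
  add {Y Y'} hY hY' := by
    have := (isSmoothTensorialAt_curvatureOp_left (Y := X) hsm hZ).add hY hY'
    rw [curvatureOp_swap, this, curvatureOp_swap (X := X), curvatureOp_swap (X := X)]; abel
  smul {φ Y} hφ hY := by
    have := (isSmoothTensorialAt_curvatureOp_left (Y := X) hsm hZ).smul hφ hY
    rw [curvatureOp_swap, this, curvatureOp_swap (X := X), smul_neg]

theorem isSmoothTensorialAt_curvatureOp_right [FiniteDimensional ℝ E]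
    (hX : CMDiffAt ∞ (T% X) x) (hY : CMDiffAt ∞ (T% Y) x) :
    IsSmoothTensorialAt (fun Z ↦ curvatureOp cov x X Y Z) x where
  add {Z Z'} hZ hZ' := by
    have key : ∀ {U V : ∀ y : M, TangentSpace 𝓘(ℝ, E) y}, CMDiffAt ∞ (T% V) x →
        cov (fun y ↦ cov (Z + Z') y (V y)) x (U x) =
        cov (fun y ↦ cov Z y (V y)) x (U x) + cov (fun y ↦ cov Z' y (V y)) x (U x) :=
      fun {U V} hV ↦ by
        have e : (fun y ↦ cov Z y (V y)) + (fun y ↦ cov Z' y (V y)) =ᶠ[𝓝 x]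
            fun y ↦ cov (Z + Z') y (V y) := by
          filter_upwards [eventually_mdifferentiableAt hZ, eventually_mdifferentiableAt hZ']
            with y h h'
          rw [cov_add h h']; rfl
        have h1 := mdiffAt (hsm x _ _ hV hZ)
        have h2 := mdiffAt (hsm x _ _ hV hZ')
        rw [← cov_congr (mdifferentiableAt_add_section h1 h2) e, cov_add h1 h2]
    simp only [curvatureOp]
    rw [key hY, key hX, cov_add (mdiffAt hZ) (mdiffAt hZ')]
    abel
  smul {φ Z} hφ hZ := by
    have hφ' := hφ.mdifferentiableAt (n := ∞) (by simp)
    have key : ∀ {U V : ∀ y : M, TangentSpace 𝓘(ℝ, E) y}, CMDiffAt ∞ (T% V) x →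
        cov (fun y ↦ cov (φ • Z) y (V y)) x (U x) =
        φ x • cov (fun y ↦ cov Z y (V y)) x (U x) + d% φ x (U x) • cov Z x (V x)
        + (d% φ x (V x) • cov Z x (U x) + d% (fun y ↦ d% φ y (V y)) x (U x) • Z x) :=
      fun {U V} hV ↦ by
        have e : φ • (fun y ↦ cov Z y (V y)) + (fun y ↦ d% φ y (V y)) • Z =ᶠ[𝓝 x]
            fun y ↦ cov (φ • Z) y (V y) := by
          filter_upwards [eventually_mdifferentiableAt hZ, eventually_mdifferentiableAt_fun hφ]
            with y h h'
          rw [cov_smul h' h]; rfl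
        have h1 := hsm x _ _ hV hZ
        have h2 := contMDiffAt_mfderiv_apply hφ hV
        have h3 := mdiffAt (hφ.smul_section h1)
        have h4 := mdiffAt (h2.smul_section hZ)
        rw [← cov_congr (mdifferentiableAt_add_section h3 h4) e, cov_add h3 h4,
          cov_smul hφ' (mdiffAt h1), cov_smul (h2.mdifferentiableAt (by simp)) (mdiffAt hZ)]
    have hb := mvfderiv_mvfderiv_sub hφ hX hY
    simp only [curvatureOp]
    rw [key hY, key hX, cov_smul hφ' (mdiffAt hZ), ← hb]
    module

/-- A connection that differentiates smooth fields to smooth fields has a curvature tensor. -/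
theorem exists_isCurvatureAt [FiniteDimensional ℝ E] (x : M) : ∃ R, IsCurvatureAt cov x R := by
  let ext : ∀ v : TangentSpace 𝓘(ℝ, E) x, ∀ y : M, TangentSpace 𝓘(ℝ, E) y :=
    fun v ↦ FiberBundle.extend E v
  have hext : ∀ v, CMDiffAt ∞ (T% (ext v)) x := contMDiffAt_extend_tangent x
  have hextx : ∀ v, ext v x = v := fun v ↦ by simp [ext]
  have hL := fun u v ↦ isSmoothTensorialAt_curvatureOp_left (Y := ext u) hsm (hext v)
  have hM := fun u v ↦ isSmoothTensorialAt_curvatureOp_middle (X := ext u) hsm (hext v)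
  have hR := fun u v ↦ isSmoothTensorialAt_curvatureOp_right hsm (hext u) (hext v)
  have hc : ∀ a : ℝ, CMDiffAt ∞ (fun _ : M ↦ a) x := fun a ↦ contMDiffAt_const
  let R := LinearMap.mk₂ ℝ (fun u v ↦ (hR u v).toLinearMap)
    (fun u u' v ↦ by
      ext w
      refine ((hL v w).congr_of_eq (hext (u + u')) ((hext u).add_section (hext u')) ?_).trans
        ((hL v w).add (hext u) (hext u'))
      simp [hextx])
    (fun a u v ↦ by
      ext w
      refine ((hL v w).congr_of_eq (hext (a • u)) ((hc a).smul_section (hext u)) ?_).trans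
        ((hL v w).smul (hc a) (hext u))
      simp [hextx])
    (fun u v v' ↦ by
      ext w
      refine ((hM u w).congr_of_eq (hext (v + v')) ((hext v).add_section (hext v')) ?_).trans
        ((hM u w).add (hext v) (hext v'))
      simp [hextx])
    (fun a u v ↦ by
      ext w
      refine ((hM u w).congr_of_eq (hext (a • v)) ((hc a).smul_section (hext v)) ?_).trans
        ((hM u w).smul (hc a) (hext v))
      simp [hextx])
  refine ⟨R, fun X Y Z hX hY hZ ↦ ?_⟩
  change curvatureOp cov x (ext (X x)) (ext (Y x)) (ext (Z x)) = curvatureOp cov x X Y Z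
  rw [(hL (Y x) (Z x)).congr_of_eq (hext _) hX (hextx _),
    (isSmoothTensorialAt_curvatureOp_middle (X := X) hsm (hext _)).congr_of_eq (hext _) hY
      (hextx _)]
  exact (isSmoothTensorialAt_curvatureOp_right hsm hX hY).congr_of_eq (hext _) hZ (hextx _)

omit hsm

/-- The curvature tensor of the Levi-Civita connection is an algebraic curvature tensor: skewness
follows by applying `X Y - Y X - [X, Y] = 0` to the function `g(Z, Z)`, and the Bianchi identity is
the Jacobi identity for vector fields. -/
theorem IsLeviCivita.isAlgebraicCurvature [FiniteDimensional ℝ E] (hc : IsLeviCivita g cov)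
    (hg : IsPseudoRiemannian g) {R : TangentSpace 𝓘(ℝ, E) x →ₗ[ℝ] TangentSpace 𝓘(ℝ, E) x →ₗ[ℝ]
      TangentSpace 𝓘(ℝ, E) x →ₗ[ℝ] TangentSpace 𝓘(ℝ, E) x} (hR : IsCurvatureAt cov x R) :
    IsAlgebraicCurvature (g x) R := by
  let ext : ∀ v : TangentSpace 𝓘(ℝ, E) x, ∀ y : M, TangentSpace 𝓘(ℝ, E) y :=
    fun v ↦ FiberBundle.extend E v
  have hext : ∀ v, CMDiffAt ∞ (T% (ext v)) x := contMDiffAt_extend_tangent x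
  have hextx : ∀ v, ext v x = v := fun v ↦ by simp [ext]
  have hR' : ∀ u v w, R u v w = curvatureOp cov x (ext u) (ext v) (ext w) := fun u v w ↦ by
    have := hR _ _ _ (hext u) (hext v) (hext w)
    rw [hextx, hextx, hextx] at this
    rw [this, curvatureOp, hextx, hextx]
  have hsm := fun {X Y : ∀ y : M, TangentSpace 𝓘(ℝ, E) y} (hX : CMDiffAt ∞ (T% X) x)
    (hY : CMDiffAt ∞ (T% Y) x) ↦ hc.contMDiffAt_cov hg hX hY
  refine ⟨fun u v w ↦ ?_, ?_, fun u v w ↦ ?_⟩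
  · rw [hR', hR', curvatureOp_swap]
  · have hself : ∀ u v w, g x (R u v w) w = 0 := fun u v w ↦ by
      have hZ := hext w
      have key : ∀ {U V : ∀ y : M, TangentSpace 𝓘(ℝ, E) y}, CMDiffAt ∞ (T% V) x →
          d% (fun y ↦ d% (fun y ↦ g y (ext w y) (ext w y)) y (V y)) x (U x) =
          2 * (g x (cov (fun y ↦ cov (ext w) y (V y)) x (U x)) (ext w x) +
            g x (cov (ext w) x (V x)) (cov (ext w) x (U x))) := fun {U V} hV ↦ by
        have h1 := mdiffAt (hsm hV hZ)
        have e : (fun y ↦ d% (fun y ↦ g y (ext w y) (ext w y)) y (V y)) =ᶠ[𝓝 x]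
            (fun y ↦ g y (cov (ext w) y (V y)) (ext w y)) +
              fun y ↦ g y (cov (ext w) y (V y)) (ext w y) := by
          filter_upwards [eventually_mdifferentiableAt hZ] with y hy
          rw [hc.mvfderiv_apply hy hy, hg.symm y (ext w y)]; rfl
        have h2 := hg.mdifferentiableAt_apply h1 (mdiffAt hZ)
        rw [mvfderiv, e.mfderiv_eq]
        change d% ((fun y ↦ g y (cov (ext w) y (V y)) (ext w y)) +
          fun y ↦ g y (cov (ext w) y (V y)) (ext w y)) x (U x) = _
        rw [mvfderiv_add h2 h2, add_apply, hc.mvfderiv_apply h1 (mdiffAt hZ)]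
        ring
      have hb := mvfderiv_mvfderiv_sub
        (hg.contMDiffAt_apply (b := id) (v := ext w) (w := ext w) hZ hZ) (hext u) (hext v)
      simp only [id] at hb
      rw [key (hext v), key (hext u), hc.mvfderiv_apply (mdiffAt hZ) (mdiffAt hZ)] at hb
      rw [hR', curvatureOp]
      simp only [map_sub, sub_apply]
      rw [hg.symm x (ext w x) _, hg.symm x (cov (ext w) x (ext u x))] at hb
      have hzx : ext w x = w := hextx w
      rw [hzx] at hb
      linarith
    intro u v w z
    have h := hself u v (w + z)
    simp only [map_add, add_apply] at h
    rw [hself, hself, hg.symm x (R u v z) w] at h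
    linarith
  · have hfin := FiniteDimensional.complete ℝ E
    have : IsManifold 𝓘(ℝ, E) (minSmoothness ℝ 3) M := by
      rw [minSmoothness_of_isRCLikeNormedField]
      exact IsManifold.of_le (n := ∞) ENat.LEInfty.out
    have h2 : ∀ {W : ∀ y : M, TangentSpace 𝓘(ℝ, E) y}, CMDiffAt ∞ (T% W) x →
        CMDiffAt (minSmoothness ℝ 2) (T% W) x := fun h ↦ by
      rw [minSmoothness_of_isRCLikeNormedField]; exact h.of_le ENat.LEInfty.out
    -- `∇_X ∇_Y Z - ∇_X ∇_Z Y - ∇_[Y, Z] X = [X, [Y, Z]]`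
    have key : ∀ {X Y Z : ∀ y : M, TangentSpace 𝓘(ℝ, E) y}, CMDiffAt ∞ (T% X) x →
        CMDiffAt ∞ (T% Y) x → CMDiffAt ∞ (T% Z) x →
        cov (fun y ↦ cov Z y (Y y)) x (X x) - cov (fun y ↦ cov Y y (Z y)) x (X x) -
          cov X x (mlieBracket 𝓘(ℝ, E) Y Z x) =
        mlieBracket 𝓘(ℝ, E) X (mlieBracket 𝓘(ℝ, E) Y Z) x := fun {X Y Z} hX hY hZ ↦ by
      have hYZ := contMDiffAt_mlieBracket hY hZ
      rw [← hc.torsion_free x X _ (mdiffAt hX) (mdiffAt hYZ)]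
      have e : (fun y ↦ cov Z y (Y y)) =ᶠ[𝓝 x]
          (fun y ↦ cov Y y (Z y)) + mlieBracket 𝓘(ℝ, E) Y Z := by
        filter_upwards [eventually_mdifferentiableAt hY, eventually_mdifferentiableAt hZ]
          with y h h'
        rw [Pi.add_apply, ← hc.torsion_free y Y Z h h']
        abel
      rw [cov_congr (mdiffAt (hsm hY hZ)) e, cov_add (mdiffAt (hsm hZ hY)) (mdiffAt hYZ)]
      abel
    rw [hR', hR', hR', curvatureOp, curvatureOp, curvatureOp]
    have k1 := key (hext u) (hext v) (hext w)
    have k2 := key (hext v) (hext w) (hext u)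
    have k3 := key (hext w) (hext u) (hext v)
    have j := leibniz_identity_mlieBracket_apply (h2 (hext u)) (h2 (hext v)) (h2 (hext w))
    have s1 : mlieBracket 𝓘(ℝ, E) (mlieBracket 𝓘(ℝ, E) (ext u) (ext v)) (ext w) x =
        -mlieBracket 𝓘(ℝ, E) (ext w) (mlieBracket 𝓘(ℝ, E) (ext u) (ext v)) x :=
      mlieBracket_swap_apply
    have s2 : mlieBracket 𝓘(ℝ, E) (ext v) (mlieBracket 𝓘(ℝ, E) (ext u) (ext w)) x =
        -mlieBracket 𝓘(ℝ, E) (ext v) (mlieBracket 𝓘(ℝ, E) (ext w) (ext u)) x := by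
      rw [mlieBracket_swap (V := ext u)]
      have := mlieBracket_const_smul_right (V := ext v) (c := (-1 : ℝ))
        (mdiffAt (contMDiffAt_mlieBracket (hext w) (hext u)))
      simpa using this
    rw [s1, s2] at j
    linear_combination (norm := module) k1 + k2 + k3 + j

/-- If the connection preserves `Q`, the commutators of the curvature operators with members of
`Q` belong to `Q`: for a local section `A` of `Q`, the endomorphism `[R(X, Y), A]` is
`∇_X ∇_Y A - ∇_Y ∇_X A - ∇_[X, Y] A`. -/
theorem Preserves.curvature_commutator [FiniteDimensional ℝ E] (hP : Preserves cov Q)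
    (hc : IsLeviCivita g cov) (hg : IsPseudoRiemannian g)
    {R : TangentSpace 𝓘(ℝ, E) x →ₗ[ℝ] TangentSpace 𝓘(ℝ, E) x →ₗ[ℝ]
      TangentSpace 𝓘(ℝ, E) x →ₗ[ℝ] TangentSpace 𝓘(ℝ, E) x} (hR : IsCurvatureAt cov x R)
    {U : Set M} (hU : IsOpen U) (hxU : x ∈ U) (hA : ∀ y ∈ U, SmoothEndFieldAt A y)
    (hAQ : ∀ y ∈ U, A y ∈ Q y) (u v : TangentSpace 𝓘(ℝ, E) x) :
    ∃ C ∈ Q x, ∀ z, R u v (A x z) - A x (R u v z) = C z := by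
  classical
  have hUn : ∀ᶠ y in 𝓝 x, y ∈ U := hU.mem_nhds hxU
  have hsm := fun {X Y : ∀ y : M, TangentSpace 𝓘(ℝ, E) y} (hX : CMDiffAt ∞ (T% X) x)
    (hY : CMDiffAt ∞ (T% Y) x) ↦ hc.contMDiffAt_cov hg hX hY
  -- the derivative of `A` along a vector field is again a local section of `Q`
  have hB : ∀ X : ∀ y : M, TangentSpace 𝓘(ℝ, E) y, ∃ B : EndField E M, ∀ y ∈ U, B y ∈ Q y ∧
      ∀ Z : ∀ y : M, TangentSpace 𝓘(ℝ, E) y, MDiffAt (T% Z) y →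
        cov (fun y ↦ A y (Z y)) y (X y) - A y (cov Z y (X y)) = B y (Z y) := fun X ↦ by
    have h : ∀ y : M, ∃ B : TangentSpace 𝓘(ℝ, E) y →L[ℝ] TangentSpace 𝓘(ℝ, E) y, y ∈ U →
        B ∈ Q y ∧ ∀ Z : ∀ y : M, TangentSpace 𝓘(ℝ, E) y, MDiffAt (T% Z) y →
        cov (fun y ↦ A y (Z y)) y (X y) - A y (cov Z y (X y)) = B (Z y) := fun y ↦ by
      by_cases hy : y ∈ U
      · obtain ⟨B, hB, h⟩ :=
          hP y A (hA y hy) ((hU.eventually_mem hy).mono fun z hz ↦ hAQ z hz) (X y)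
        exact ⟨B, fun _ ↦ ⟨hB, h⟩⟩
      · exact ⟨0, fun h ↦ absurd h hy⟩
    choose B hB using h
    exact ⟨B, hB⟩
  have hBsm : ∀ {X : ∀ y : M, TangentSpace 𝓘(ℝ, E) y} {B : EndField E M}, CMDiffAt ∞ (T% X) x →
      (∀ y ∈ U, B y ∈ Q y ∧ ∀ Z : ∀ y : M, TangentSpace 𝓘(ℝ, E) y, MDiffAt (T% Z) y →
        cov (fun y ↦ A y (Z y)) y (X y) - A y (cov Z y (X y)) = B y (Z y)) →
      SmoothEndFieldAt B x := fun {X B} hX hB ↦ by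
    refine smoothEndFieldAt_of_apply fun Z hZ ↦ ?_
    have := (hsm hX ((hA x hxU).apply hZ)).sub_section ((hA x hxU).apply (hsm hX hZ))
    refine this.congr_of_eventuallyEq ?_
    filter_upwards [hUn, eventually_mdifferentiableAt hZ] with y hy hZy
    simp only [Pi.sub_apply]
    rw [(hB y hy).2 Z hZy]
  set X : ∀ y : M, TangentSpace 𝓘(ℝ, E) y := FiberBundle.extend E u with hXdef
  set Y : ∀ y : M, TangentSpace 𝓘(ℝ, E) y := FiberBundle.extend E v with hYdef
  have hX : CMDiffAt ∞ (T% X) x := contMDiffAt_extend_tangent x u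
  have hY : CMDiffAt ∞ (T% Y) x := contMDiffAt_extend_tangent x v
  have hXx : X x = u := by simp [hXdef]
  have hYx : Y x = v := by simp [hYdef]
  obtain ⟨BX, hBX⟩ := hB X
  obtain ⟨BY, hBY⟩ := hB Y
  obtain ⟨C₁, hC₁, h₁⟩ := hP x BY (hBsm hY hBY) (hUn.mono fun y hy ↦ (hBY y hy).1) u
  obtain ⟨C₂, hC₂, h₂⟩ := hP x BX (hBsm hX hBX) (hUn.mono fun y hy ↦ (hBX y hy).1) v
  obtain ⟨C₃, hC₃, h₃⟩ := hP x A (hA x hxU) (hUn.mono fun y hy ↦ hAQ y hy)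
    (mlieBracket 𝓘(ℝ, E) X Y x)
  refine ⟨C₁ - C₂ - C₃, sub_mem (sub_mem hC₁ hC₂) hC₃, fun z ↦ ?_⟩
  set Z : ∀ y : M, TangentSpace 𝓘(ℝ, E) y := FiberBundle.extend E z with hZdef
  have hZ : CMDiffAt ∞ (T% Z) x := contMDiffAt_extend_tangent x z
  have hZx : Z x = z := by simp [hZdef]
  have hAZ := (hA x hxU).apply hZ
  have key : ∀ {X : ∀ y : M, TangentSpace 𝓘(ℝ, E) y} {B : EndField E M} (_ : CMDiffAt ∞ (T% X) x)
      (_ : ∀ y ∈ U, B y ∈ Q y ∧ ∀ Z : ∀ y : M, TangentSpace 𝓘(ℝ, E) y, MDiffAt (T% Z) y →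
        cov (fun y ↦ A y (Z y)) y (X y) - A y (cov Z y (X y)) = B y (Z y))
      (w : TangentSpace 𝓘(ℝ, E) x),
      cov (fun y ↦ cov (fun y ↦ A y (Z y)) y (X y)) x w =
        cov (fun y ↦ B y (Z y)) x w + cov (fun y ↦ A y (cov Z y (X y))) x w :=
    fun {X B} hX hB w ↦ by
      have e : (fun y ↦ cov (fun y ↦ A y (Z y)) y (X y)) =ᶠ[𝓝 x]
          (fun y ↦ B y (Z y)) + fun y ↦ A y (cov Z y (X y)) := by
        filter_upwards [hUn, eventually_mdifferentiableAt hZ] with y hy hZy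
        rw [Pi.add_apply, ← (hB y hy).2 Z hZy]
        abel
      rw [cov_congr (mdiffAt (hsm hX hAZ)) e,
        cov_add (mdiffAt ((hBsm hX hB).apply hZ)) (mdiffAt ((hA x hxU).apply (hsm hX hZ)))]
  have r1 := hR X Y (fun y ↦ A y (Z y)) hX hY hAZ
  have r2 := hR X Y Z hX hY hZ
  simp only [hXx, hYx, hZx] at r1 r2
  rw [r1, r2, key hY hBY u, key hX hBX v]
  have a1 := (hBX x hxU).2 _ (mdiffAt (hsm hY hZ))
  have a2 := (hBY x hxU).2 _ (mdiffAt (hsm hX hZ))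
  have b1 := h₁ Z (mdiffAt hZ)
  have b2 := h₂ Z (mdiffAt hZ)
  have b3 := h₃ Z (mdiffAt hZ)
  simp only [hXx, hYx, hZx] at a1 a2 b1 b2 b3
  simp only [map_sub, sub_apply]
  linear_combination (norm := module) a1 - a2 + b1 - b2 - b3
end Connection

/-! ### Local retractions of immersions and extension of vector fields -/

section Immersion

open VectorField

variable {E : Type*} [NormedAddCommGroup E] [NormedSpace ℝ E]
  {M : Type*} [TopologicalSpace M] [ChartedSpace E M] [IsManifold 𝓘(ℝ, E) ∞ M]
  {E' : Type*} [NormedAddCommGroup E'] [NormedSpace ℝ E']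
  {N : Type*} [TopologicalSpace N] [ChartedSpace E' N] [IsManifold 𝓘(ℝ, E') ∞ N]
  {f : M → N} {r : N → M} {x : M}

/-- A smooth left inverse `r` of the map `f`, defined near the point `f x`. -/
structure IsLocalRetraction (E : Type*) [NormedAddCommGroup E] [NormedSpace ℝ E]
    {M : Type*} [TopologicalSpace M] [ChartedSpace E M]
    (E' : Type*) [NormedAddCommGroup E'] [NormedSpace ℝ E']
    {N : Type*} [TopologicalSpace N] [ChartedSpace E' N]
    (f : M → N) (r : N → M) (x : M) : Prop where
  smooth : ContMDiffAt 𝓘(ℝ, E) 𝓘(ℝ, E') ∞ f x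
  smooth_retraction : ContMDiffAt 𝓘(ℝ, E') 𝓘(ℝ, E) ∞ r (f x)
  left_inverse : ∀ᶠ p in 𝓝 x, r (f p) = p

/-- In the charts in which an immersion is the inclusion `u ↦ (u, 0)`, the projection
`(u, v) ↦ u` is a local retraction. -/
theorem exists_isLocalRetraction (hf : Manifold.IsImmersionAt 𝓘(ℝ, E) 𝓘(ℝ, E') ∞ f x) :
    ∃ r, IsLocalRetraction E E' f r x := by
  obtain ⟨F, _, _, h⟩ := id hf
  let φ := h.domChart.extend 𝓘(ℝ, E)
  let ψ := h.codChart.extend 𝓘(ℝ, E')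
  have hw : ∀ p ∈ h.domChart.source, ψ (f p) = h.equiv (φ p, 0) := fun p hp ↦ by
    have hp' : p ∈ φ.source := by simpa [φ] using hp
    have := h.writtenInCharts (φ.map_source hp')
    simp only [Function.comp_apply] at this
    rw [φ.left_inv hp'] at this
    exact this
  have hret : ∀ p ∈ h.domChart.source, (h.equiv.symm (ψ (f p))).1 = φ p := fun p hp ↦ by
    rw [hw p hp, ContinuousLinearEquiv.symm_apply_apply]
  refine ⟨fun q ↦ φ.symm (h.equiv.symm (ψ q)).1, hf.contMDiffAt, ?_, ?_⟩
  · have h1 : CMDiffAt ∞ ψ (f x) :=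
      h.codChart.contMDiffAt_extend h.codChart_mem_maximalAtlas h.mem_codChart_source
    have h2 : CMDiffAt ∞ (fun q ↦ (h.equiv.symm (ψ q)).1) (f x) := by
      have : ContDiff ℝ ∞ (fun z ↦ (h.equiv.symm z).1) :=
        contDiff_fst.comp h.equiv.symm.contDiff
      exact this.contMDiff.contMDiffAt.comp (f x) h1
    have h3 : CMDiffAt ∞ φ.symm (φ x) := by
      have := contMDiffOn_extend_symm (I := 𝓘(ℝ, E)) h.domChart_mem_maximalAtlas
      refine this.contMDiffAt ?_
      have hx := φ.map_source (x := x) (by simpa [φ] using h.mem_domChart_source)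
      have h4 : (𝓘(ℝ, E)) '' h.domChart.target = h.domChart.target := by simp
      rw [h4]
      refine h.domChart.open_target.mem_nhds ?_
      simpa [φ] using hx
    refine ContMDiffAt.comp (f x) (g := φ.symm) ?_ h2
    rw [hret x h.mem_domChart_source]
    exact h3
  · filter_upwards [h.domChart.open_source.mem_nhds h.mem_domChart_source] with p hp
    rw [hret p hp]
    exact φ.left_inv (by simpa [φ] using hp)

namespace IsLocalRetraction

theorem eq (h : IsLocalRetraction E E' f r x) : r (f x) = x := h.left_inverse.self_of_nhds

theorem eventually_smooth (h : IsLocalRetraction E E' f r x) :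
    ∀ᶠ p in 𝓝 x, MDiffAt f p ∧ MDiffAt r (f p) := by
  have h1 : CMDiffAt 1 f x := h.smooth.of_le ENat.LEInfty.out
  have h2 : CMDiffAt 1 r (f x) := h.smooth_retraction.of_le ENat.LEInfty.out
  have h3 := h.smooth.continuousAt.eventually ((contMDiffAt_iff_contMDiffAt_nhds (by simp)).1 h2)
  filter_upwards [(contMDiffAt_iff_contMDiffAt_nhds (by simp)).1 h1, h3] with p hp hp'
  exact ⟨hp.mdifferentiableAt (by simp), hp'.mdifferentiableAt (by simp)⟩

theorem eventually_mfderiv (h : IsLocalRetraction E E' f r x) :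
    ∀ᶠ p in 𝓝 x, ∀ v : TangentSpace 𝓘(ℝ, E) p,
      (mfderiv 𝓘(ℝ, E') 𝓘(ℝ, E) r (f p) (mfderiv 𝓘(ℝ, E) 𝓘(ℝ, E') f p v) : E) = v := by
  filter_upwards [h.eventually_smooth, h.left_inverse.eventually_nhds] with p hp hp' v
  have h1 := mfderiv_comp p hp.2 hp.1
  have h2 : mfderiv 𝓘(ℝ, E) 𝓘(ℝ, E) (r ∘ f) p = ContinuousLinearMap.id ℝ _ := by
    have : r ∘ f =ᶠ[𝓝 p] id := hp'
    rw [this.mfderiv_eq]; exact mfderiv_id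
  rw [h2] at h1
  exact (congrArg (fun L ↦ L v) h1).symm

theorem injective_mfderiv (h : IsLocalRetraction E E' f r x) :
    Function.Injective (mfderiv 𝓘(ℝ, E) 𝓘(ℝ, E') f x) := by
  intro u v huv
  have := h.eventually_mfderiv.self_of_nhds
  have h1 := this u
  rw [huv] at h1
  exact h1.symm.trans (this v)

theorem totalSpace_eventuallyEq (h : IsLocalRetraction E E' f r x)
    {W : ∀ q : N, TangentSpace 𝓘(ℝ, E') q} {Y : ∀ p : M, TangentSpace 𝓘(ℝ, E) p}
    (hWY : ∀ᶠ p in 𝓝 x, W (f p) = mfderiv 𝓘(ℝ, E) 𝓘(ℝ, E') f p (Y p)) :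
    (T% Y) =ᶠ[𝓝 x] fun p ↦ (⟨r (f p), mfderiv 𝓘(ℝ, E') 𝓘(ℝ, E) r (f p) (W (f p))⟩ :
      TangentBundle 𝓘(ℝ, E) M) := by
  filter_upwards [hWY, h.eventually_mfderiv, h.left_inverse] with p h1 h2 h3
  refine Bundle.TotalSpace.ext h3.symm (heq_of_eq ?_)
  rw [h1]
  exact (h2 (Y p)).symm

/-- A vector field on `M` is smooth if it is `f`-related to a smooth vector field on `N`. -/
theorem contMDiffAt_of_related (h : IsLocalRetraction E E' f r x)
    {W : ∀ q : N, TangentSpace 𝓘(ℝ, E') q} {Y : ∀ p : M, TangentSpace 𝓘(ℝ, E) p}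
    (hW : CMDiffAt ∞ (T% W) (f x))
    (hWY : ∀ᶠ p in 𝓝 x, W (f p) = mfderiv 𝓘(ℝ, E) 𝓘(ℝ, E') f p (Y p)) :
    CMDiffAt ∞ (T% Y) x := by
  refine ContMDiffAt.congr_of_eventuallyEq ?_ (h.totalSpace_eventuallyEq hWY)
  exact contMDiffAt_pushforward (b := f) (v := fun p ↦ W (f p)) h.smooth_retraction
    (ContMDiffAt.comp x hW h.smooth)

end IsLocalRetraction

/-- The extension of a vector field `Y` on `M` to a neighbourhood of `f x`: the field
`df Y ∘ r` along `f ∘ r` is moved to the identity by means of a trivialization of `TN`. -/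
noncomputable def extendAlong (E' : Type*) [NormedAddCommGroup E'] [NormedSpace ℝ E']
    {N : Type*} [TopologicalSpace N] [ChartedSpace E' N] [IsManifold 𝓘(ℝ, E') ∞ N]
    (f : M → N) (r : N → M) (x : M)
    (Y : ∀ p : M, TangentSpace 𝓘(ℝ, E) p) (q : N) : TangentSpace 𝓘(ℝ, E') q :=
  (trivializationAt E' (TangentSpace 𝓘(ℝ, E') : N → Type _) (f x)).symmL ℝ q
    ((trivializationAt E' (TangentSpace 𝓘(ℝ, E') : N → Type _) (f x)).continuousLinearMapAt ℝ
      (f (r q)) (mfderiv 𝓘(ℝ, E) 𝓘(ℝ, E') f (r q) (Y (r q))))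

theorem extendAlong_add (Y Y' : ∀ p : M, TangentSpace 𝓘(ℝ, E) p) :
    extendAlong E' f r x (Y + Y') = extendAlong E' f r x Y + extendAlong E' f r x Y' := by
  funext q
  simp [extendAlong]

theorem extendAlong_smul (φ : M → ℝ) (Y : ∀ p : M, TangentSpace 𝓘(ℝ, E) p) :
    extendAlong E' f r x (φ • Y) = (φ ∘ r) • extendAlong E' f r x Y := by
  funext q
  simp [extendAlong]

namespace IsLocalRetraction

theorem extendAlong_related (h : IsLocalRetraction E E' f r x)
    (Y : ∀ p : M, TangentSpace 𝓘(ℝ, E) p) :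
    ∀ᶠ p in 𝓝 x, extendAlong E' f r x Y (f p) = mfderiv 𝓘(ℝ, E) 𝓘(ℝ, E') f p (Y p) := by
  let e := trivializationAt E' (TangentSpace 𝓘(ℝ, E') : N → Type _) (f x)
  have hx : f x ∈ e.baseSet := FiberBundle.mem_baseSet_trivializationAt E' _ (f x)
  filter_upwards [h.left_inverse, h.smooth.continuousAt.eventually (e.open_baseSet.mem_nhds hx)]
    with p hp hp'
  have h1 := congrArg (fun a ↦ e.continuousLinearMapAt ℝ (f a)
    (mfderiv 𝓘(ℝ, E) 𝓘(ℝ, E') f a (Y a))) hp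
  rw [extendAlong, h1]
  exact e.symmL_continuousLinearMapAt hp' _

theorem eventually_mem (h : IsLocalRetraction E E' f r x) :
    ∀ᶠ q in 𝓝 (f x), f (r q) ∈
      (trivializationAt E' (TangentSpace 𝓘(ℝ, E') : N → Type _) (f x)).baseSet := by
  have hc : ContinuousAt (fun q ↦ f (r q)) (f x) := by
    refine ContinuousAt.comp (g := f) ?_ h.smooth_retraction.continuousAt
    rw [h.eq]; exact h.smooth.continuousAt
  refine hc.eventually ?_
  simp only [h.eq]
  exact (trivializationAt E' (TangentSpace 𝓘(ℝ, E') : N → Type _) (f x)).open_baseSet.mem_nhds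
    (FiberBundle.mem_baseSet_trivializationAt E' _ (f x))

theorem contMDiffAt_extendAlong (h : IsLocalRetraction E E' f r x)
    {Y : ∀ p : M, TangentSpace 𝓘(ℝ, E) p} (hY : CMDiffAt ∞ (T% Y) x) :
    CMDiffAt ∞ (T% (extendAlong E' f r x Y)) (f x) := by
  have h1 : ContMDiffAt 𝓘(ℝ, E') (𝓘(ℝ, E').prod 𝓘(ℝ, E')) ∞
      (fun q ↦ (⟨f (r q), mfderiv 𝓘(ℝ, E) 𝓘(ℝ, E') f (r q) (Y (r q))⟩ :
        TangentBundle 𝓘(ℝ, E') N)) (f x) := by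
    refine contMDiffAt_pushforward (b := r) (v := fun q ↦ Y (r q)) ?_ ?_
    · rw [h.eq]; exact h.smooth
    · refine ContMDiffAt.comp (f x) (g := T% Y) ?_ h.smooth_retraction
      rw [h.eq]; exact hY
  have h2 := (contMDiffAt_totalSpace.1 h1).2
  simp only [h.eq] at h2
  rw [contMDiffAt_section]
  refine h2.congr_of_eventuallyEq ?_
  filter_upwards [h.eventually_mem,
    (trivializationAt E' (TangentSpace 𝓘(ℝ, E') : N → Type _) (f x)).open_baseSet.mem_nhds
    (FiberBundle.mem_baseSet_trivializationAt E' _ (f x))] with q hq hq'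
  rw [extendAlong, Trivialization.symmL_apply, Trivialization.apply_mk_symm _ hq']
  · simp [Trivialization.coe_linearMapAt_of_mem _ hq]
  · exact hq'

theorem mdifferentiableAt_extendAlong (h : IsLocalRetraction E E' f r x)
    {Y : ∀ p : M, TangentSpace 𝓘(ℝ, E) p} (hY : MDiffAt (T% Y) x) :
    MDiffAt (T% (extendAlong E' f r x Y)) (f x) := by
  have h1 : MDifferentiableAt 𝓘(ℝ, E') (𝓘(ℝ, E').prod 𝓘(ℝ, E'))
      (fun q ↦ (⟨f (r q), mfderiv 𝓘(ℝ, E) 𝓘(ℝ, E') f (r q) (Y (r q))⟩ :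
        TangentBundle 𝓘(ℝ, E') N)) (f x) := by
    refine mdifferentiableAt_pushforward (b := r) (v := fun q ↦ Y (r q)) ?_ h.smooth_retraction ?_
    · rw [h.eq]; exact h.smooth
    · refine MDifferentiableAt.comp (f x) (g := T% Y) ?_
        (h.smooth_retraction.mdifferentiableAt (by simp))
      rw [h.eq]; exact hY
  have h2 := ((mdifferentiableAt_totalSpace _ _).1 h1).2
  simp only [h.eq] at h2
  rw [mdifferentiableAt_section]
  refine h2.congr_of_eventuallyEq ?_
  filter_upwards [h.eventually_mem,
    (trivializationAt E' (TangentSpace 𝓘(ℝ, E') : N → Type _) (f x)).open_baseSet.mem_nhds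
    (FiberBundle.mem_baseSet_trivializationAt E' _ (f x))] with q hq hq'
  rw [extendAlong, Trivialization.symmL_apply, Trivialization.apply_mk_symm _ hq']
  · simp [Trivialization.coe_linearMapAt_of_mem _ hq]
  · exact hq'

end IsLocalRetraction

section AlongMap

variable [FiniteDimensional ℝ E'] {cov : Connection E' N}

theorem cov_sum {ι : Type*} (s : Finset ι) {q : N} (σ : ι → ∀ y : N, TangentSpace 𝓘(ℝ, E') y)
    (hσ : ∀ i ∈ s, MDiffAt (T% (σ i)) q) (v : TangentSpace 𝓘(ℝ, E') q) :
    cov (fun y ↦ ∑ i ∈ s, σ i y) q v = ∑ i ∈ s, cov (σ i) q v := by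
  classical
  induction s using Finset.induction_on with
  | empty =>
    simp only [Finset.sum_empty]
    have : cov (fun _ ↦ 0) = 0 := cov.zero
    rw [this]; rfl
  | insert a s ha h =>
    simp only [Finset.mem_insert, forall_eq_or_imp] at hσ
    simp only [Finset.sum_insert ha, ← h hσ.2]
    exact cov_add hσ.1 (.sum_section hσ.2) v

/-- A vector field on `N` that vanishes along `f` has vanishing derivatives in the directions
tangent to `f`. -/
theorem cov_mfderiv_eq_zero (hf : MDiffAt f x) {W : ∀ q : N, TangentSpace 𝓘(ℝ, E') q}
    (hW : MDiffAt (T% W) (f x)) (h0 : ∀ᶠ p in 𝓝 x, W (f p) = 0) (u : TangentSpace 𝓘(ℝ, E) x) :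
    cov W (f x) (mfderiv 𝓘(ℝ, E) 𝓘(ℝ, E') f x u) = 0 := by
  let t := trivializationAt E' (TangentSpace 𝓘(ℝ, E') : N → Type _) (f x)
  have x_mem : f x ∈ t.baseSet := FiberBundle.mem_baseSet_trivializationAt E' _ (f x)
  let b := Module.finBasis ℝ E'
  let s := t.localFrame b
  let c := t.localFrameCoeff 𝓘(ℝ, E') b
  have hs (i) : MDiffAt (T% (s i)) (f x) :=
    (contMDiffAt_localFrame_of_mem 1 _ b i x_mem).mdifferentiableAt (by simp)
  have hc (i) : MDiffAt (LinearMap.piApply (c i) W) (f x) :=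
    mdifferentiableAt_localFrameCoeff b x_mem hW i
  have e : W =ᶠ[𝓝 (f x)] fun y ↦ ∑ i, (LinearMap.piApply (c i) W • s i) y :=
    t.eventually_eq_localFrame_sum_coeff_smul b x_mem
  rw [cov_congr hW e]
  refine (cov_sum Finset.univ (fun i ↦ LinearMap.piApply (c i) W • s i)
    (fun i _ ↦ (hc i).smul_section (hs i)) _).trans (Finset.sum_eq_zero fun i _ ↦ ?_)
  rw [cov_smul (hc i) (hs i)]
  have h1 : LinearMap.piApply (c i) W (f x) = 0 := by
    simp [h0.self_of_nhds]
  have h2 : d% (LinearMap.piApply (c i) W) (f x) (mfderiv 𝓘(ℝ, E) 𝓘(ℝ, E') f x u) = 0 := by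
    have h3 := mfderiv_comp_apply x (hc i) hf u
    have h4 : (LinearMap.piApply (c i) W) ∘ f =ᶠ[𝓝 x] fun _ ↦ (0 : ℝ) :=
      h0.mono fun p hp ↦ by simp [hp]
    rw [h4.mfderiv_eq, mfderiv_const] at h3
    exact h3.symm
  rw [h1, h2]
  simp

/-- The derivative of a vector field in directions tangent to `f` depends only on the values of
the field along `f`. -/
theorem cov_mfderiv_congr (hf : MDiffAt f x) {W W' : ∀ q : N, TangentSpace 𝓘(ℝ, E') q}
    (hW : MDiffAt (T% W) (f x)) (hW' : MDiffAt (T% W') (f x))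
    (h : ∀ᶠ p in 𝓝 x, W (f p) = W' (f p)) (u : TangentSpace 𝓘(ℝ, E) x) :
    cov W (f x) (mfderiv 𝓘(ℝ, E) 𝓘(ℝ, E') f x u) =
      cov W' (f x) (mfderiv 𝓘(ℝ, E) 𝓘(ℝ, E') f x u) := by
  have hsub : MDiffAt (T% (W - W')) (f x) := mdifferentiableAt_sub_section hW hW'
  have h0 := cov_mfderiv_eq_zero (cov := cov) hf hsub
    (h.mono fun p hp ↦ by simp [hp]) u
  have h1 : W = W' + (W - W') := by abel
  conv_lhs => rw [h1]
  rw [cov_add hW' hsub, h0, add_zero]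

/-- Lie brackets of `f`-related vector fields are `f`-related. -/
theorem mlieBracket_related [FiniteDimensional ℝ E] (hf : CMDiffAt ∞ f x)
    {X Y : ∀ p : M, TangentSpace 𝓘(ℝ, E) p} {X' Y' : ∀ q : N, TangentSpace 𝓘(ℝ, E') q}
    (hX : CMDiffAt ∞ (T% X) x) (hY : CMDiffAt ∞ (T% Y) x)
    (hX' : CMDiffAt ∞ (T% X') (f x)) (hY' : CMDiffAt ∞ (T% Y') (f x))
    (hXX' : ∀ᶠ p in 𝓝 x, X' (f p) = mfderiv 𝓘(ℝ, E) 𝓘(ℝ, E') f p (X p))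
    (hYY' : ∀ᶠ p in 𝓝 x, Y' (f p) = mfderiv 𝓘(ℝ, E) 𝓘(ℝ, E') f p (Y p)) :
    mlieBracket 𝓘(ℝ, E') X' Y' (f x) =
      mfderiv 𝓘(ℝ, E) 𝓘(ℝ, E') f x (mlieBracket 𝓘(ℝ, E) X Y x) := by
  have hf1 : ∀ᶠ p in 𝓝 x, MDiffAt f p := by
    have h1 : CMDiffAt 1 f x := hf.of_le ENat.LEInfty.out
    exact ((contMDiffAt_iff_contMDiffAt_nhds (by simp)).1 h1).mono
      fun p hp ↦ hp.mdifferentiableAt (by simp)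
  have hd : ∀ {φ : N → ℝ}, CMDiffAt ∞ φ (f x) → ∀ {Z : ∀ p : M, TangentSpace 𝓘(ℝ, E) p}
      {Z' : ∀ q : N, TangentSpace 𝓘(ℝ, E') q},
      (∀ᶠ p in 𝓝 x, Z' (f p) = mfderiv 𝓘(ℝ, E) 𝓘(ℝ, E') f p (Z p)) →
      (fun p ↦ d% (φ ∘ f) p (Z p)) =ᶠ[𝓝 x] (fun q ↦ d% φ q (Z' q)) ∘ f := fun {φ} hφ {Z Z'} hZ ↦ by
    filter_upwards [hZ, hf1, hf.continuousAt.eventually (eventually_mdifferentiableAt_fun hφ)]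
      with p h1 h2 h3
    simp only [Function.comp_apply]
    rw [h1]
    exact mfderiv_comp_apply p h3 h2 (Z p)
  -- both sides act in the same way on functions
  have key : ∀ φ : N → ℝ, CMDiffAt ∞ φ (f x) → d% φ (f x) (mlieBracket 𝓘(ℝ, E') X' Y' (f x)) =
      d% φ (f x) (mfderiv 𝓘(ℝ, E) 𝓘(ℝ, E') f x (mlieBracket 𝓘(ℝ, E) X Y x)) := fun φ hφ ↦ by
    have hφf : CMDiffAt ∞ (φ ∘ f) x := hφ.comp x hf
    have h1 := mvfderiv_mvfderiv_sub hφf hX hY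
    have h2 := mvfderiv_mvfderiv_sub hφ hX' hY'
    have h3 : d% (φ ∘ f) x (mlieBracket 𝓘(ℝ, E) X Y x) =
        d% φ (f x) (mfderiv 𝓘(ℝ, E) 𝓘(ℝ, E') f x (mlieBracket 𝓘(ℝ, E) X Y x)) :=
      mfderiv_comp_apply x (hφ.mdifferentiableAt (by simp)) (hf.mdifferentiableAt (by simp)) _
    have h4 : ∀ {Z W : ∀ p : M, TangentSpace 𝓘(ℝ, E) p}
        {Z' W' : ∀ q : N, TangentSpace 𝓘(ℝ, E') q}, CMDiffAt ∞ (T% Z') (f x) →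
        (∀ᶠ p in 𝓝 x, Z' (f p) = mfderiv 𝓘(ℝ, E) 𝓘(ℝ, E') f p (Z p)) →
        (∀ᶠ p in 𝓝 x, W' (f p) = mfderiv 𝓘(ℝ, E) 𝓘(ℝ, E') f p (W p)) →
        d% (fun p ↦ d% (φ ∘ f) p (Z p)) x (W x) =
          d% (fun q ↦ d% φ q (Z' q)) (f x) (W' (f x)) := fun {Z W Z' W'} hZ' hZZ hWW ↦ by
      rw [mvfderiv, (hd hφ hZZ).mfderiv_eq, hWW.self_of_nhds]
      exact mfderiv_comp_apply x ((contMDiffAt_mfderiv_apply hφ hZ').mdifferentiableAt (by simp))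
        (hf.mdifferentiableAt (by simp)) _
    rw [← h2, ← h3, ← h1, h4 hY' hYY' hXX', h4 hX' hXX' hYY']
  -- the coordinate functions of a chart separate tangent vectors
  have hinj : Function.Injective
      (mfderiv 𝓘(ℝ, E') 𝓘(ℝ, E') (extChartAt 𝓘(ℝ, E') (f x)) (f x)) :=
    (isInvertible_mfderiv_extChartAt (mem_extChartAt_source (I := 𝓘(ℝ, E')) (f x))).injective
  apply hinj
  have hext : CMDiffAt ∞ (extChartAt 𝓘(ℝ, E') (f x)) (f x) := contMDiffAt_extChartAt
  refine (Module.forall_dual_apply_eq_zero_iff ℝ (V := E') _).1 ?_ |> sub_eq_zero.1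
  intro ℓ
  let ℓ' : E' →L[ℝ] ℝ := LinearMap.toContinuousLinearMap ℓ
  have h1 := key (ℓ' ∘ extChartAt 𝓘(ℝ, E') (f x)) (ℓ'.contMDiff.contMDiffAt.comp _ hext)
  have h2 : ∀ w : TangentSpace 𝓘(ℝ, E') (f x),
      d% (ℓ' ∘ extChartAt 𝓘(ℝ, E') (f x)) (f x) w =
        ℓ (mfderiv 𝓘(ℝ, E') 𝓘(ℝ, E') (extChartAt 𝓘(ℝ, E') (f x)) (f x) w) := fun w ↦ by
    have h3 := mfderiv_comp_apply (f x) (g := ℓ')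
      (ℓ'.contMDiff.mdifferentiable (n := ∞) (by simp) _) (hext.mdifferentiableAt (by simp)) w
    rw [ContinuousLinearMap.mfderiv_eq] at h3
    exact h3
  rw [h2, h2] at h1
  exact (map_sub ℓ _ _).trans (sub_eq_zero.2 h1)

end AlongMap

end Immersion

/-! ### Invariant submanifolds are totally geodesic -/

section TotalGeodesy

open VectorField

variable {E : Type*} [NormedAddCommGroup E] [NormedSpace ℝ E] [FiniteDimensional ℝ E]
  {M : Type*} [TopologicalSpace M] [ChartedSpace E M] [IsManifold 𝓘(ℝ, E) ∞ M]
  {E' : Type*} [NormedAddCommGroup E'] [NormedSpace ℝ E'] [FiniteDimensional ℝ E']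
  {N : Type*} [TopologicalSpace N] [ChartedSpace E' N] [IsManifold 𝓘(ℝ, E') ∞ N]
  {f : M → N} {x : M} {g : BilinField E' N} {Q : EndSubspaceField E' N} {cov : Connection E' N}

/-- A left inverse `T_{f x} N → T_x M` of the differential of `f` at `x`. It is arbitrary off the
tangent space of the submanifold. -/
noncomputable def tangentProj (E : Type*) [NormedAddCommGroup E] [NormedSpace ℝ E]
    {M : Type*} [TopologicalSpace M] [ChartedSpace E M]
    {E' : Type*} [NormedAddCommGroup E'] [NormedSpace ℝ E'] [FiniteDimensional ℝ E']
    {N : Type*} [TopologicalSpace N] [ChartedSpace E' N] (f : M → N) (x : M) :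
    TangentSpace 𝓘(ℝ, E') (f x) →L[ℝ] TangentSpace 𝓘(ℝ, E) x :=
  have : FiniteDimensional ℝ (TangentSpace 𝓘(ℝ, E') (f x)) :=
    inferInstanceAs (FiniteDimensional ℝ E')
  have : T2Space (TangentSpace 𝓘(ℝ, E') (f x)) := inferInstanceAs (T2Space E')
  LinearMap.toContinuousLinearMap
    (LinearMap.leftInverse (mfderiv 𝓘(ℝ, E) 𝓘(ℝ, E') f x).toLinearMap)

theorem tangentProj_mfderiv (h : Function.Injective (mfderiv 𝓘(ℝ, E) 𝓘(ℝ, E') f x))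
    (u : TangentSpace 𝓘(ℝ, E) x) :
    tangentProj E f x (mfderiv 𝓘(ℝ, E) 𝓘(ℝ, E') f x u) = u :=
  LinearMap.leftInverse_apply_of_inj (f := (mfderiv 𝓘(ℝ, E) 𝓘(ℝ, E') f x).toLinearMap)
    (LinearMap.ker_eq_bot.2 h) u

theorem mfderiv_tangentProj (h : Function.Injective (mfderiv 𝓘(ℝ, E) 𝓘(ℝ, E') f x))
    {w : TangentSpace 𝓘(ℝ, E') (f x)} (hw : w ∈ tangentRange E f x) :
    mfderiv 𝓘(ℝ, E) 𝓘(ℝ, E') f x (tangentProj E f x w) = w := by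
  obtain ⟨u, rfl⟩ := hw
  exact congrArg (mfderiv 𝓘(ℝ, E) 𝓘(ℝ, E') f x) (tangentProj_mfderiv h u)

theorem mfderiv_mem_tangentRange (u : TangentSpace 𝓘(ℝ, E) x) :
    mfderiv 𝓘(ℝ, E) 𝓘(ℝ, E') f x u ∈ tangentRange E f x := ⟨u, rfl⟩

variable {r : M → N → M} (hr : ∀ x, IsLocalRetraction E E' f (r x) x)
include hr

/-- The normal components of `∇_X Y` and `∇_Y X` agree for tangent fields `X`, `Y`. -/
theorem cov_sub_cov_mem (hc : IsLeviCivita g cov)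
    {X Y : ∀ p : M, TangentSpace 𝓘(ℝ, E) p} {X' Y' : ∀ q : N, TangentSpace 𝓘(ℝ, E') q}
    (hX' : CMDiffAt ∞ (T% X') (f x)) (hY' : CMDiffAt ∞ (T% Y') (f x))
    (hXX' : ∀ᶠ p in 𝓝 x, X' (f p) = mfderiv 𝓘(ℝ, E) 𝓘(ℝ, E') f p (X p))
    (hYY' : ∀ᶠ p in 𝓝 x, Y' (f p) = mfderiv 𝓘(ℝ, E) 𝓘(ℝ, E') f p (Y p)) :
    cov Y' (f x) (X' (f x)) - cov X' (f x) (Y' (f x)) ∈ tangentRange E f x := by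
  have hX := (hr x).contMDiffAt_of_related hX' hXX'
  have hY := (hr x).contMDiffAt_of_related hY' hYY'
  rw [hc.torsion_free _ _ _ (mdiffAt hX') (mdiffAt hY'),
    mlieBracket_related (hr x).smooth hX hY hX' hY' hXX' hYY']
  exact mfderiv_mem_tangentRange _

/-- The images of tangent fields under sections of `Q` are tangent fields. -/
theorem related_apply (hQ : IsAlmostParaQuaternionicSubmanifold E f Q) {A : EndField E' N}
    (hAQ : ∀ᶠ q in 𝓝 (f x), A q ∈ Q q)
    {X : ∀ p : M, TangentSpace 𝓘(ℝ, E) p} {X' : ∀ q : N, TangentSpace 𝓘(ℝ, E') q}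
    (hXX' : ∀ᶠ p in 𝓝 x, X' (f p) = mfderiv 𝓘(ℝ, E) 𝓘(ℝ, E') f p (X p)) :
    ∀ᶠ p in 𝓝 x, A (f p) (X' (f p)) = mfderiv 𝓘(ℝ, E) 𝓘(ℝ, E') f p
      (tangentProj E f p (A (f p) (mfderiv 𝓘(ℝ, E) 𝓘(ℝ, E') f p (X p)))) := by
  filter_upwards [hXX', (hr x).smooth.continuousAt.eventually hAQ] with p h1 h2
  rw [h1, mfderiv_tangentProj (hr p).injective_mfderiv
    (hQ p _ h2 _ (mfderiv_mem_tangentRange _))]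

theorem cov_apply_sub_mem (hQ : IsAlmostParaQuaternionicSubmanifold E f Q)
    (hP : Preserves cov Q) {A : EndField E' N} (hA : SmoothEndFieldAt A (f x))
    (hAQ : ∀ᶠ q in 𝓝 (f x), A q ∈ Q q)
    {X : ∀ p : M, TangentSpace 𝓘(ℝ, E) p} {X' : ∀ q : N, TangentSpace 𝓘(ℝ, E') q}
    (hX' : MDiffAt (T% X') (f x))
    (hXX' : ∀ᶠ p in 𝓝 x, X' (f p) = mfderiv 𝓘(ℝ, E) 𝓘(ℝ, E') f p (X p))
    (w : TangentSpace 𝓘(ℝ, E') (f x)) :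
    cov (fun q ↦ A q (X' q)) (f x) w - A (f x) (cov X' (f x) w) ∈ tangentRange E f x := by
  obtain ⟨B, hB, h⟩ := hP (f x) A hA hAQ w
  rw [h X' hX']
  refine hQ x B hB _ ?_
  rw [hXX'.self_of_nhds]
  exact mfderiv_mem_tangentRange _

/-- For sections `A`, `B` of `Q`, the normal components of `∇_{A X} (B Y)` and `B A ∇_Y X` agree:
the second fundamental form is symmetric and commutes with `Q` in its second argument. -/
theorem cov_apply_apply_mem (hQ : IsAlmostParaQuaternionicSubmanifold E f Q)
    (hP : Preserves cov Q) (hc : IsLeviCivita g cov) {A B : EndField E' N}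
    (hA : SmoothEndFieldAt A (f x)) (hAQ : ∀ᶠ q in 𝓝 (f x), A q ∈ Q q)
    (hB : SmoothEndFieldAt B (f x)) (hBQ : ∀ᶠ q in 𝓝 (f x), B q ∈ Q q)
    {X Y : ∀ p : M, TangentSpace 𝓘(ℝ, E) p} {X' Y' : ∀ q : N, TangentSpace 𝓘(ℝ, E') q}
    (hX' : CMDiffAt ∞ (T% X') (f x)) (hY' : CMDiffAt ∞ (T% Y') (f x))
    (hXX' : ∀ᶠ p in 𝓝 x, X' (f p) = mfderiv 𝓘(ℝ, E) 𝓘(ℝ, E') f p (X p))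
    (hYY' : ∀ᶠ p in 𝓝 x, Y' (f p) = mfderiv 𝓘(ℝ, E) 𝓘(ℝ, E') f p (Y p)) :
    cov (fun q ↦ B q (Y' q)) (f x) (A (f x) (X' (f x))) -
      B (f x) (A (f x) (cov X' (f x) (Y' (f x)))) ∈ tangentRange E f x := by
  have h1 := cov_apply_sub_mem hr hQ hP hB hBQ (mdiffAt hY') hYY' (A (f x) (X' (f x)))
  have h2 := hQ x _ hBQ.self_of_nhds _
    (cov_sub_cov_mem hr hc (hA.apply hX') hY' (related_apply hr hQ hAQ hXX') hYY')
  have h3 := hQ x _ hBQ.self_of_nhds _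
    (cov_apply_sub_mem hr hQ hP hA hAQ (mdiffAt hX') hXX' (Y' (f x)))
  have h4 := add_mem (add_mem h1 h2) h3
  simp only [map_sub] at h4
  convert h4 using 1
  abel

/-- The derivatives of smooth tangent fields in tangent directions are tangent: comparing
`∇_{J₁ X} (J₂ Y)` with `∇_{J₂ Y} (J₁ X)`, one sees that `J₁ J₂ - J₂ J₁ = 2 J₃` annihilates the
normal component of `∇_X Y`. -/
theorem cov_mem_of_smooth (hQ : IsAlmostParaQuaternionicSubmanifold E f Q)
    (hQ' : IsAlmostParaQuaternionic Q) (hP : Preserves cov Q) (hc : IsLeviCivita g cov)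
    {X Y : ∀ p : M, TangentSpace 𝓘(ℝ, E) p} {X' Y' : ∀ q : N, TangentSpace 𝓘(ℝ, E') q}
    (hX' : CMDiffAt ∞ (T% X') (f x)) (hY' : CMDiffAt ∞ (T% Y') (f x))
    (hXX' : ∀ᶠ p in 𝓝 x, X' (f p) = mfderiv 𝓘(ℝ, E) 𝓘(ℝ, E') f p (X p))
    (hYY' : ∀ᶠ p in 𝓝 x, Y' (f p) = mfderiv 𝓘(ℝ, E) 𝓘(ℝ, E') f p (Y p)) :
    cov Y' (f x) (X' (f x)) ∈ tangentRange E f x := by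
  obtain ⟨U, hU, hxU, J₁, J₂, J₃, hJ⟩ := hQ'.2 (f x)
  have hUn := hU.mem_nhds hxU
  have hQ₁ : ∀ᶠ q in 𝓝 (f x), J₁ q ∈ Q q := by
    filter_upwards [hUn] with q hq
    rw [(hJ q hq).2.2.2.2]
    exact Submodule.subset_span (by simp)
  have hQ₂ : ∀ᶠ q in 𝓝 (f x), J₂ q ∈ Q q := by
    filter_upwards [hUn] with q hq
    rw [(hJ q hq).2.2.2.2]
    exact Submodule.subset_span (by simp)
  have hQ₃ : J₃ (f x) ∈ Q (f x) := by
    rw [(hJ _ hxU).2.2.2.2]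
    exact Submodule.subset_span (by simp)
  obtain ⟨s₁, s₂, -, hst, -⟩ := hJ _ hxU
  have h1 := cov_apply_apply_mem hr hQ hP hc s₁ hQ₁ s₂ hQ₂ hX' hY' hXX' hYY'
  have h2 := cov_apply_apply_mem hr hQ hP hc s₂ hQ₂ s₁ hQ₁ hY' hX' hYY' hXX'
  have h3 := cov_sub_cov_mem hr hc (s₁.apply hX') (s₂.apply hY')
    (related_apply hr hQ hQ₁ hXX') (related_apply hr hQ hQ₂ hYY')
  have h4 := hQ x _ hQ₂.self_of_nhds _ (hQ x _ hQ₁.self_of_nhds _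
    (cov_sub_cov_mem hr hc hX' hY' hXX' hYY'))
  simp only [map_sub] at h4
  rw [hst.mul] at h2
  rw [hst.anti] at h1 h4
  rw [hst.anti] at h4
  set w := cov Y' (f x) (X' (f x))
  have h5 : (2 : ℝ) • J₃ (f x) w ∈ tangentRange E f x := by
    have := add_mem (sub_mem h1 h2) (neg_mem (add_mem h3 h4))
    convert this using 1
    module
  have h6 : J₃ (f x) w ∈ tangentRange E f x := by
    have := Submodule.smul_mem _ (1 / 2 : ℝ) h5
    rwa [smul_smul, show (1 / 2 : ℝ) * 2 = 1 by norm_num, one_smul] at this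
  have h7 := hQ x _ hQ₃ _ h6
  rwa [hst.sq₃] at h7

omit hr in
theorem mvfderiv_comp_retraction {r : N → M} (h : IsLocalRetraction E E' f r x) {φ : M → ℝ}
    (hφ : MDiffAt φ x) (u : TangentSpace 𝓘(ℝ, E) x) :
    d% (φ ∘ r) (f x) (mfderiv 𝓘(ℝ, E) 𝓘(ℝ, E') f x u) = d% φ x u := by
  have h1 : MDiffAt (φ ∘ r) (f x) := by
    refine MDifferentiableAt.comp (f x) ?_ (h.smooth_retraction.mdifferentiableAt (by simp))
    rw [h.eq]; exact hφ
  have h2 := mfderiv_comp_apply x h1 (h.smooth.mdifferentiableAt (by simp)) u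
  have h3 : (φ ∘ r) ∘ f =ᶠ[𝓝 x] φ := h.left_inverse.mono fun p hp ↦ by simp [hp]
  rw [h3.mfderiv_eq] at h2
  exact h2.symm

/-- The derivatives of differentiable tangent fields in tangent directions are tangent. -/
theorem cov_mem (hQ : IsAlmostParaQuaternionicSubmanifold E f Q)
    (hQ' : IsAlmostParaQuaternionic Q) (hP : Preserves cov Q) (hc : IsLeviCivita g cov)
    {Y : ∀ p : M, TangentSpace 𝓘(ℝ, E) p} {Y' : ∀ q : N, TangentSpace 𝓘(ℝ, E') q}
    (hY : MDiffAt (T% Y) x) (hY' : MDiffAt (T% Y') (f x))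
    (hYY' : ∀ᶠ p in 𝓝 x, Y' (f p) = mfderiv 𝓘(ℝ, E) 𝓘(ℝ, E') f p (Y p))
    (u : TangentSpace 𝓘(ℝ, E) x) :
    cov Y' (f x) (mfderiv 𝓘(ℝ, E) 𝓘(ℝ, E') f x u) ∈ tangentRange E f x := by
  have h := hr x
  -- modulo tangent vectors the derivative is tensorial in `Y`
  have hΦ : TensorialAt 𝓘(ℝ, E) E (V := (TangentSpace 𝓘(ℝ, E) : M → Type _))
      (fun Y ↦ (tangentRange E f x).mkQ (cov (extendAlong E' f (r x) x Y) (f x)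
        (mfderiv 𝓘(ℝ, E) 𝓘(ℝ, E') f x u))) x :=
    { smul := fun {φ Z} hφ hZ ↦ by
        have h1 : MDiffAt (φ ∘ r x) (f x) := by
          refine MDifferentiableAt.comp (f x) ?_ (h.smooth_retraction.mdifferentiableAt (by simp))
          rw [h.eq]; exact hφ
        rw [extendAlong_smul, cov_smul h1 (h.mdifferentiableAt_extendAlong hZ), map_add, map_smul,
          map_smul, (h.extendAlong_related Z).self_of_nhds]
        have h2 : (tangentRange E f x).mkQ (mfderiv 𝓘(ℝ, E) 𝓘(ℝ, E') f x (Z x)) = 0 := by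
          rw [Submodule.mkQ_apply, Submodule.Quotient.mk_eq_zero]
          exact mfderiv_mem_tangentRange _
        rw [h2, smul_zero, add_zero, Function.comp_apply, h.eq]
      add := fun {Z Z'} hZ hZ' ↦ by
        rw [extendAlong_add, cov_add (h.mdifferentiableAt_extendAlong hZ)
          (h.mdifferentiableAt_extendAlong hZ'), map_add] }
  set Z : ∀ p : M, TangentSpace 𝓘(ℝ, E) p := FiberBundle.extend E (Y x) with hZdef
  set X : ∀ p : M, TangentSpace 𝓘(ℝ, E) p := FiberBundle.extend E u with hXdef
  have hZ : CMDiffAt ∞ (T% Z) x := contMDiffAt_extend_tangent x _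
  have hX : CMDiffAt ∞ (T% X) x := contMDiffAt_extend_tangent x _
  have h1 := hΦ.pointwise hY (mdiffAt hZ) (by simp [hZdef])
  have h2 := cov_mem_of_smooth hr hQ hQ' hP hc (h.contMDiffAt_extendAlong hX)
    (h.contMDiffAt_extendAlong hZ) (h.extendAlong_related X) (h.extendAlong_related Z)
  have hXx : extendAlong E' f (r x) x X (f x) = mfderiv 𝓘(ℝ, E) 𝓘(ℝ, E') f x u := by
    rw [(h.extendAlong_related X).self_of_nhds]; simp [hXdef]
  rw [hXx] at h2
  have h3 : (tangentRange E f x).mkQ (cov (extendAlong E' f (r x) x Z) (f x)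
      (mfderiv 𝓘(ℝ, E) 𝓘(ℝ, E') f x u)) = 0 := by
    rw [Submodule.mkQ_apply, Submodule.Quotient.mk_eq_zero]; exact h2
  simp only [h3] at h1
  rw [Submodule.mkQ_apply, Submodule.Quotient.mk_eq_zero] at h1
  rw [cov_mfderiv_congr (h.smooth.mdifferentiableAt (by simp)) hY'
    (h.mdifferentiableAt_extendAlong hY)
    (by filter_upwards [hYY', h.extendAlong_related Y] with p h1 h2; rw [h1, h2])]
  exact h1

end TotalGeodesy

/-! ### The induced connection of a totally geodesic submanifold -/

section InducedConnection

open VectorField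

variable {E : Type*} [NormedAddCommGroup E] [NormedSpace ℝ E] [FiniteDimensional ℝ E]
  {M : Type*} [TopologicalSpace M] [ChartedSpace E M] [IsManifold 𝓘(ℝ, E) ∞ M]
  {E' : Type*} [NormedAddCommGroup E'] [NormedSpace ℝ E'] [FiniteDimensional ℝ E']
  {N : Type*} [TopologicalSpace N] [ChartedSpace E' N] [IsManifold 𝓘(ℝ, E') ∞ N]
  {f : M → N} {x : M} {g : BilinField E' N} {cov : Connection E' N}
  {r : M → N → M} (hr : ∀ x, IsLocalRetraction E E' f (r x) x)

/-- The connection induced on `M`: a vector field is extended to `N` near the point in question,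
differentiated there, and projected back to the tangent space of `M`. -/
noncomputable def inducedConnection (cov : Connection E' N) : Connection E M where
  toFun Y x := (tangentProj E f x).comp
    ((cov (extendAlong E' f (r x) x Y) (f x)).comp (mfderiv 𝓘(ℝ, E) 𝓘(ℝ, E') f x))
  isCovariantDerivativeOnUniv :=
    { add := fun {Y Y' x} hY hY' _ ↦ by
        ext u
        simp only [ContinuousLinearMap.comp_apply, add_apply]
        rw [extendAlong_add, cov_add ((hr x).mdifferentiableAt_extendAlong hY)
          ((hr x).mdifferentiableAt_extendAlong hY'), map_add]
      leibniz := fun {Y φ x} hY hφ _ ↦ by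
        have h := hr x
        ext u
        have h1 : MDiffAt (φ ∘ r x) (f x) := by
          refine MDifferentiableAt.comp (f x) ?_ (h.smooth_retraction.mdifferentiableAt (by simp))
          rw [h.eq]; exact hφ
        simp only [ContinuousLinearMap.comp_apply, add_apply, smul_apply]
        rw [extendAlong_smul, cov_smul h1 (h.mdifferentiableAt_extendAlong hY), map_add, map_smul,
          map_smul, (h.extendAlong_related Y).self_of_nhds, mvfderiv_comp_retraction h hφ,
          tangentProj_mfderiv h.injective_mfderiv, Function.comp_apply, h.eq]
        rfl }

theorem inducedConnection_apply (Y : ∀ p : M, TangentSpace 𝓘(ℝ, E) p) (x : M)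
    (u : TangentSpace 𝓘(ℝ, E) x) :
    inducedConnection hr cov Y x u = tangentProj E f x (cov (extendAlong E' f (r x) x Y) (f x)
      (mfderiv 𝓘(ℝ, E) 𝓘(ℝ, E') f x u)) := rfl

/-- The ambient derivatives of tangent fields in tangent directions are tangent to the submanifold.
This is total geodesy, phrased for fields that are merely differentiable at the point. -/
def IsGeodesicMap (E : Type*) [NormedAddCommGroup E] [NormedSpace ℝ E]
    {M : Type*} [TopologicalSpace M] [ChartedSpace E M] [IsManifold 𝓘(ℝ, E) ∞ M]
    {E' : Type*} [NormedAddCommGroup E'] [NormedSpace ℝ E']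
    {N : Type*} [TopologicalSpace N] [ChartedSpace E' N] [IsManifold 𝓘(ℝ, E') ∞ N]
    (f : M → N) (cov : Connection E' N) : Prop :=
  ∀ (x : M) (Y : ∀ p : M, TangentSpace 𝓘(ℝ, E) p) (Y' : ∀ q : N, TangentSpace 𝓘(ℝ, E') q),
    MDiffAt (T% Y) x → MDiffAt (T% Y') (f x) →
    (∀ᶠ p in 𝓝 x, Y' (f p) = mfderiv 𝓘(ℝ, E) 𝓘(ℝ, E') f p (Y p)) →
    ∀ u : TangentSpace 𝓘(ℝ, E) x,
      cov Y' (f x) (mfderiv 𝓘(ℝ, E) 𝓘(ℝ, E') f x u) ∈ tangentRange E f x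

section

variable (hT : IsGeodesicMap E f cov)
include hT

/-- The Gauss formula of a totally geodesic submanifold. -/
theorem mfderiv_inducedConnection
    {Y : ∀ p : M, TangentSpace 𝓘(ℝ, E) p} {Y' : ∀ q : N, TangentSpace 𝓘(ℝ, E') q}
    (hY : MDiffAt (T% Y) x) (hY' : MDiffAt (T% Y') (f x))
    (hYY' : ∀ᶠ p in 𝓝 x, Y' (f p) = mfderiv 𝓘(ℝ, E) 𝓘(ℝ, E') f p (Y p))
    (u : TangentSpace 𝓘(ℝ, E) x) :
    mfderiv 𝓘(ℝ, E) 𝓘(ℝ, E') f x (inducedConnection hr cov Y x u) =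
      cov Y' (f x) (mfderiv 𝓘(ℝ, E) 𝓘(ℝ, E') f x u) := by
  have h := hr x
  have h1 := h.mdifferentiableAt_extendAlong hY
  rw [inducedConnection_apply, mfderiv_tangentProj h.injective_mfderiv
    (hT x Y _ hY h1 (h.extendAlong_related Y) u)]
  exact cov_mfderiv_congr (h.smooth.mdifferentiableAt (by simp)) h1 hY'
    (by filter_upwards [hYY', h.extendAlong_related Y] with p h1 h2; rw [h1, h2]) u

/-- The induced connection is the Levi-Civita connection of the induced metric. -/
theorem isLeviCivita_inducedConnection (hc : IsLeviCivita g cov) (hg : IsPseudoRiemannian g) :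
    IsLeviCivita (inducedMetric f g) (inducedConnection hr cov) where
  torsion_free x X Y hX hY := by
    have h := hr x
    -- the torsion is a tensor, which may be computed with smooth fields
    suffices hts : (inducedConnection hr cov).torsion x (X x) (Y x) = 0 by
      rw [CovariantDerivative.torsion_apply _ hX hY] at hts
      exact sub_eq_zero.1 hts
    set X₁ : ∀ p : M, TangentSpace 𝓘(ℝ, E) p := FiberBundle.extend E (X x) with hX₁
    set Y₁ : ∀ p : M, TangentSpace 𝓘(ℝ, E) p := FiberBundle.extend E (Y x) with hY₁
    have hXs : CMDiffAt ∞ (T% X₁) x := contMDiffAt_extend_tangent x _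
    have hYs : CMDiffAt ∞ (T% Y₁) x := contMDiffAt_extend_tangent x _
    have hXx : X₁ x = X x := by simp [hX₁]
    have hYx : Y₁ x = Y x := by simp [hY₁]
    rw [← hXx, ← hYx, CovariantDerivative.torsion_apply _ (mdiffAt hXs) (mdiffAt hYs)]
    apply h.injective_mfderiv
    have hX' := h.contMDiffAt_extendAlong hXs
    have hY' := h.contMDiffAt_extendAlong hYs
    have rX := h.extendAlong_related X₁
    have rY := h.extendAlong_related Y₁
    rw [map_sub, map_sub, map_zero,
      mfderiv_inducedConnection hr hT (mdiffAt hYs) (mdiffAt hY') rY,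
      mfderiv_inducedConnection hr hT (mdiffAt hXs) (mdiffAt hX') rX,
      ← mlieBracket_related h.smooth hXs hYs hX' hY' rX rY,
      ← hc.torsion_free _ _ _ (mdiffAt hX') (mdiffAt hY'), rX.self_of_nhds, rY.self_of_nhds,
      sub_self]
  metric x X Y v hX hY := by
    have h := hr x
    have hX' := h.mdifferentiableAt_extendAlong hX
    have hY' := h.mdifferentiableAt_extendAlong hY
    have rX := h.extendAlong_related X
    have rY := h.extendAlong_related Y
    have e₁ : inducedMetric f g x (inducedConnection hr cov X x v) (Y x) =
        g (f x) (cov (extendAlong E' f (r x) x X) (f x) (mfderiv 𝓘(ℝ, E) 𝓘(ℝ, E') f x v))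
          (extendAlong E' f (r x) x Y (f x)) := by
      rw [inducedMetric_apply, mfderiv_inducedConnection hr hT hX hX' rX, rY.self_of_nhds]
    have e₂ : inducedMetric f g x (X x) (inducedConnection hr cov Y x v) =
        g (f x) (extendAlong E' f (r x) x X (f x))
          (cov (extendAlong E' f (r x) x Y) (f x) (mfderiv 𝓘(ℝ, E) 𝓘(ℝ, E') f x v)) := by
      rw [inducedMetric_apply, mfderiv_inducedConnection hr hT hY hY' rY, rX.self_of_nhds]
    have e : (fun p ↦ inducedMetric f g p (X p) (Y p)) =ᶠ[𝓝 x]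
        (fun q ↦ g q (extendAlong E' f (r x) x X q) (extendAlong E' f (r x) x Y q)) ∘ f := by
      filter_upwards [rX, rY] with p h1 h2
      rw [inducedMetric_apply, Function.comp_apply, h1, h2]
    have h1 := mfderiv_comp_apply x (hg.mdifferentiableAt_apply hX' hY')
      (h.smooth.mdifferentiableAt (by simp)) v
    rw [← e.mfderiv_eq] at h1
    exact h1.trans ((hc.metric _ _ _ _ hX' hY').trans (congrArg₂ (· + ·) e₁.symm e₂.symm))

/-- The curvature tensor of the induced connection of a totally geodesic submanifold is the
restriction of the ambient curvature tensor. -/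
theorem mfderiv_curvature (hc : IsLeviCivita g cov) (hg : IsPseudoRiemannian g)
    (hg' : IsPseudoRiemannian (inducedMetric (E := E) f g))
    {R : TangentSpace 𝓘(ℝ, E) x →ₗ[ℝ] TangentSpace 𝓘(ℝ, E) x →ₗ[ℝ]
      TangentSpace 𝓘(ℝ, E) x →ₗ[ℝ] TangentSpace 𝓘(ℝ, E) x}
    (hR : IsCurvatureAt (inducedConnection hr cov) x R)
    {R' : TangentSpace 𝓘(ℝ, E') (f x) →ₗ[ℝ] TangentSpace 𝓘(ℝ, E') (f x) →ₗ[ℝ]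
      TangentSpace 𝓘(ℝ, E') (f x) →ₗ[ℝ] TangentSpace 𝓘(ℝ, E') (f x)}
    (hR' : IsCurvatureAt cov (f x) R') (u v w : TangentSpace 𝓘(ℝ, E) x) :
    mfderiv 𝓘(ℝ, E) 𝓘(ℝ, E') f x (R u v w) =
      R' (mfderiv 𝓘(ℝ, E) 𝓘(ℝ, E') f x u) (mfderiv 𝓘(ℝ, E) 𝓘(ℝ, E') f x v)
        (mfderiv 𝓘(ℝ, E) 𝓘(ℝ, E') f x w) := by
  have h := hr x
  have hc' := isLeviCivita_inducedConnection hr hT hc hg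
  let ext : ∀ v : TangentSpace 𝓘(ℝ, E) x, ∀ y : M, TangentSpace 𝓘(ℝ, E) y :=
    fun v ↦ FiberBundle.extend E v
  have hext : ∀ v, CMDiffAt ∞ (T% (ext v)) x := contMDiffAt_extend_tangent x
  have hextx : ∀ v, ext v x = v := fun v ↦ by simp [ext]
  let ext' : ∀ v : TangentSpace 𝓘(ℝ, E) x, ∀ q : N, TangentSpace 𝓘(ℝ, E') q :=
    fun v ↦ extendAlong E' f (r x) x (ext v)
  have hext' : ∀ v, CMDiffAt ∞ (T% (ext' v)) (f x) := fun v ↦ h.contMDiffAt_extendAlong (hext v)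
  have hrel : ∀ v, ∀ᶠ p in 𝓝 x, ext' v (f p) = mfderiv 𝓘(ℝ, E) 𝓘(ℝ, E') f p (ext v p) :=
    fun v ↦ h.extendAlong_related _
  have hrelx : ∀ v, ext' v (f x) = mfderiv 𝓘(ℝ, E) 𝓘(ℝ, E') f x v := fun v ↦ by
    rw [(hrel v).self_of_nhds, hextx]
  have key : ∀ u v w, mfderiv 𝓘(ℝ, E) 𝓘(ℝ, E') f x
      (inducedConnection hr cov (fun p ↦ inducedConnection hr cov (ext w) p (ext v p)) x u) =
      cov (fun q ↦ cov (ext' w) q (ext' v q)) (f x) (mfderiv 𝓘(ℝ, E) 𝓘(ℝ, E') f x u) :=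
    fun u v w ↦ by
      refine mfderiv_inducedConnection hr hT (mdiffAt (hc'.contMDiffAt_cov hg' (hext v) (hext w)))
        (mdiffAt (hc.contMDiffAt_cov hg (hext' v) (hext' w))) ?_ u
      filter_upwards [hrel v, (hrel w).eventually_nhds, eventually_mdifferentiableAt (hext w),
        h.smooth.continuousAt.eventually (eventually_mdifferentiableAt (hext' w))]
        with p h1 h2 h3 h4
      rw [h1, mfderiv_inducedConnection hr hT h3 h4 h2]
  have h1 := hR _ _ _ (hext u) (hext v) (hext w)
  have h2 := hR' _ _ _ (hext' u) (hext' v) (hext' w)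
  rw [hextx, hextx, hextx] at h1
  rw [hrelx, hrelx, hrelx] at h2
  rw [h1, h2, map_sub, map_sub, key, key,
    mfderiv_inducedConnection hr hT (mdiffAt (hext w)) (mdiffAt (hext' w)) (hrel w),
    mlieBracket_related h.smooth (hext u) (hext v) (hext' u) (hext' v) (hrel u) (hrel v)]

end

include hr in
theorem isPseudoRiemannian_inducedMetric (hg : IsPseudoRiemannian g)
    (hnd : IsNondegenerate E f g) : IsPseudoRiemannian (inducedMetric (E := E) f g) where
  symm x u v := by rw [inducedMetric_apply, inducedMetric_apply, hg.symm]
  nondegenerate := hnd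
  smooth x := contMDiffAt_bilinField_of_apply fun _ _ hX hY ↦
    hg.contMDiffAt_apply (b := f) (contMDiffAt_pushforward (b := id) (hr x).smooth hX)
      (contMDiffAt_pushforward (b := id) (hr x).smooth hY)

end InducedConnection

/-! ### Local frames of an almost para-quaternionic structure -/

section Span

variable {V : Type*} [AddCommGroup V] [Module ℝ V] [TopologicalSpace V]
  [IsTopologicalAddGroup V] [ContinuousSMul ℝ V]

theorem IsSkewTriple.exists_self_ne_zero [Nontrivial V] {b : V →L[ℝ] V →L[ℝ] ℝ}
    {J₁ J₂ J₃ : V →L[ℝ] V} (h : IsSkewTriple b J₁ J₂ J₃) : ∃ z, b z z ≠ 0 := by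
  obtain ⟨z, -, hz⟩ := exists_self_ne_zero_of_nondegenerate h.symm (L := ⊤) top_ne_bot
    (fun u _ hu ↦ h.nondegenerate u fun v ↦ hu v trivial)
  exact ⟨z, hz⟩

theorem IsSkewTriple.finrank_span [Nontrivial V] {b : V →L[ℝ] V →L[ℝ] ℝ}
    {J₁ J₂ J₃ : V →L[ℝ] V} (h : IsSkewTriple b J₁ J₂ J₃) :
    Module.finrank ℝ (Submodule.span ℝ {J₁, J₂, J₃}) = 3 := by
  obtain ⟨z, hz⟩ := h.exists_self_ne_zero
  have hli : LinearIndependent ℝ ![J₁, J₂, J₃] := by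
    refine Fintype.linearIndependent_iff.2 fun a ha ↦ ?_
    have h0 : (0 : ℝ) • z + a 0 • J₁ z + a 1 • J₂ z + a 2 • J₃ z = 0 := by
      simpa [Fin.sum_univ_three] using congrArg (fun J : V →L[ℝ] V ↦ J z) ha
    obtain ⟨-, h1, h2, h3⟩ := h.coeff_eq_zero hz h0
    intro i
    fin_cases i <;> assumption
  have hr : Set.range ![J₁, J₂, J₃] = {J₁, J₂, J₃} := by
    rw [Matrix.range_cons, Matrix.range_cons_cons_empty, Set.singleton_union]
  have := finrank_span_eq_card hli
  rwa [hr, Fintype.card_fin] at this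

end Span

section InducedStructure

variable {E : Type*} [NormedAddCommGroup E] [NormedSpace ℝ E]
  {M : Type*} [TopologicalSpace M] [ChartedSpace E M] [IsManifold 𝓘(ℝ, E) ∞ M]
  {x : M} {g : BilinField E M} {Q : EndSubspaceField E M} {J₁ J₂ J₃ : EndField E M}

theorem isSkewTriple_of_span (hg : IsPseudoRiemannian g)
    (hs : ∀ J ∈ Q x, ∀ u v, g x (J u) v = -g x u (J v))
    (hJ : IsStandardTriple (J₁ x) (J₂ x) (J₃ x))
    (hQ : Q x = Submodule.span ℝ {J₁ x, J₂ x, J₃ x}) :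
    IsSkewTriple (g x) (J₁ x) (J₂ x) (J₃ x) where
  toIsStandardTriple := hJ
  symm := hg.symm x
  nondegenerate := hg.nondegenerate x
  skew₁ := hs _ (by rw [hQ]; exact Submodule.subset_span (by simp))
  skew₂ := hs _ (by rw [hQ]; exact Submodule.subset_span (by simp))
  skew₃ := hs _ (by rw [hQ]; exact Submodule.subset_span (by simp))

theorem SmoothEndFieldAt.linearCombination [FiniteDimensional ℝ E] {a₁ a₂ a₃ : M → ℝ}
    (h₁ : CMDiffAt ∞ a₁ x) (h₂ : CMDiffAt ∞ a₂ x) (h₃ : CMDiffAt ∞ a₃ x)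
    (hJ₁ : SmoothEndFieldAt J₁ x) (hJ₂ : SmoothEndFieldAt J₂ x) (hJ₃ : SmoothEndFieldAt J₃ x) :
    SmoothEndFieldAt (fun y ↦ a₁ y • J₁ y + a₂ y • J₂ y + a₃ y • J₃ y) x :=
  smoothEndFieldAt_of_apply fun _ hX ↦
    ((h₁.smul_section (hJ₁.apply hX)).add_section (h₂.smul_section (hJ₂.apply hX))).add_section
      (h₃.smul_section (hJ₃.apply hX))

/-- The coefficients of a smooth section of `Q` with respect to a smooth standard triple are
smooth: they are found by pairing with `J_α Y` for a field `Y` which is not null. -/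
theorem exists_smooth_coeff [FiniteDimensional ℝ E] [Nontrivial E] (hg : IsPseudoRiemannian g)
    (hs : ∀ y, ∀ J ∈ Q y, ∀ u v, g y (J u) v = -g y u (J v)) {U : Set M} (hU : IsOpen U)
    (hxU : x ∈ U)
    (hJ : ∀ y ∈ U, SmoothEndFieldAt J₁ y ∧ SmoothEndFieldAt J₂ y ∧ SmoothEndFieldAt J₃ y ∧
      IsStandardTriple (J₁ y) (J₂ y) (J₃ y) ∧ Q y = Submodule.span ℝ {J₁ y, J₂ y, J₃ y})
    {A : EndField E M} (hA : SmoothEndFieldAt A x) (hAQ : ∀ᶠ y in 𝓝 x, A y ∈ Q y) :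
    ∃ a₁ a₂ a₃ : M → ℝ, CMDiffAt ∞ a₁ x ∧ CMDiffAt ∞ a₂ x ∧ CMDiffAt ∞ a₃ x ∧
      ∀ᶠ y in 𝓝 x, A y = a₁ y • J₁ y + a₂ y • J₂ y + a₃ y • J₃ y := by
  have hsk : ∀ y ∈ U, IsSkewTriple (g y) (J₁ y) (J₂ y) (J₃ y) := fun y hy ↦
    isSkewTriple_of_span hg (hs y) (hJ y hy).2.2.2.1 (hJ y hy).2.2.2.2
  have : Nontrivial (TangentSpace 𝓘(ℝ, E) x) := inferInstanceAs (Nontrivial E)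
  obtain ⟨z, hz⟩ := (hsk x hxU).exists_self_ne_zero
  set Y : ∀ y : M, TangentSpace 𝓘(ℝ, E) y := FiberBundle.extend E z with hYdef
  have hY : CMDiffAt ∞ (T% Y) x := contMDiffAt_extend_tangent x _
  have hYx : Y x = z := by simp [hYdef]
  obtain ⟨s₁, s₂, s₃, -⟩ := hJ x hxU
  have hYY : CMDiffAt ∞ (fun y ↦ g y (Y y) (Y y)) x := hg.contMDiffAt_apply (b := id) hY hY
  have hc : ∀ {K : EndField E M}, SmoothEndFieldAt K x →
      CMDiffAt ∞ (fun y ↦ g y (A y (Y y)) (K y (Y y)) / g y (Y y) (Y y)) x := fun hK ↦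
    (hg.contMDiffAt_apply (b := id) (hA.apply hY) (hK.apply hY)).div₀ hYY (by rwa [hYx])
  refine ⟨_, _, _, hc s₁, (hc s₂).neg, (hc s₃).neg, ?_⟩
  have hne : ∀ᶠ y in 𝓝 x, g y (Y y) (Y y) ≠ 0 :=
    hYY.continuousAt.eventually_ne (by rwa [hYx])
  filter_upwards [hne, hAQ, hU.mem_nhds hxU] with y h0 h1 h2
  rw [(hJ y h2).2.2.2.2, Submodule.mem_span_triple] at h1
  obtain ⟨a₁, a₂, a₃, h1⟩ := h1
  obtain ⟨⟨f11, f21, f31⟩, ⟨f12, f22, f32⟩, ⟨f13, f23, f33⟩⟩ := (hsk y h2).forms_apply (Y y)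
  rw [← h1]
  simp [f11, f21, f31, f12, f22, f32, f13, f23, f33, h0, neg_div]

end InducedStructure

/-! ### The structure induced on an invariant submanifold -/

section InducedStructure

variable {E : Type*} [NormedAddCommGroup E] [NormedSpace ℝ E]
  {M : Type*} [TopologicalSpace M] [ChartedSpace E M]
  {E' : Type*} [NormedAddCommGroup E'] [NormedSpace ℝ E'] [FiniteDimensional ℝ E']
  {N : Type*} [TopologicalSpace N] [ChartedSpace E' N]

/-- The field of endomorphisms of `TM` that is obtained by restricting a field `J` of
endomorphisms of `TN` which preserve the tangent spaces of the submanifold. -/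
noncomputable def restrictEnd (f : M → N) (J : EndField E' N) : EndField E M := fun p ↦
  (tangentProj E f p).comp ((J (f p)).comp (mfderiv 𝓘(ℝ, E) 𝓘(ℝ, E') f p))

variable [IsManifold 𝓘(ℝ, E) ∞ M] [IsManifold 𝓘(ℝ, E') ∞ N] [FiniteDimensional ℝ E]
  {f : M → N} {x : M} {g : BilinField E' N} {Q : EndSubspaceField E' N}
  {r : M → N → M} (hr : ∀ x, IsLocalRetraction E E' f (r x) x)
  (hQ : IsAlmostParaQuaternionicSubmanifold E f Q)
include hr hQ

theorem mfderiv_restrictEnd {J : EndField E' N} (hJ : J (f x) ∈ Q (f x))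
    (u : TangentSpace 𝓘(ℝ, E) x) :
    mfderiv 𝓘(ℝ, E) 𝓘(ℝ, E') f x (restrictEnd f J x u) =
      J (f x) (mfderiv 𝓘(ℝ, E) 𝓘(ℝ, E') f x u) :=
  mfderiv_tangentProj (hr x).injective_mfderiv (hQ x _ hJ _ (mfderiv_mem_tangentRange _))

theorem smoothEndFieldAt_restrictEnd {J : EndField E' N} (hJ : SmoothEndFieldAt J (f x))
    (hJQ : ∀ᶠ q in 𝓝 (f x), J q ∈ Q q) : SmoothEndFieldAt (restrictEnd (E := E) f J) x :=
  smoothEndFieldAt_of_apply fun X hX ↦ (hr x).contMDiffAt_of_related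
    (hJ.apply ((hr x).contMDiffAt_extendAlong hX))
    (related_apply hr hQ hJQ ((hr x).extendAlong_related X))

section Triple

variable {J₁ J₂ J₃ : EndField E' N}
  (hJ : IsStandardTriple (J₁ (f x)) (J₂ (f x)) (J₃ (f x)))
  (hspan : Q (f x) = Submodule.span ℝ {J₁ (f x), J₂ (f x), J₃ (f x)})
include hJ hspan

theorem isStandardTriple_restrictEnd :
    IsStandardTriple (restrictEnd (E := E) f J₁ x) (restrictEnd (E := E) f J₂ x)
      (restrictEnd (E := E) f J₃ x) := by
  have h₁ := mfderiv_restrictEnd hr hQ (x := x) (J := J₁)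
    (by rw [hspan]; exact Submodule.subset_span (by simp))
  have h₂ := mfderiv_restrictEnd hr hQ (x := x) (J := J₂)
    (by rw [hspan]; exact Submodule.subset_span (by simp))
  have h₃ := mfderiv_restrictEnd hr hQ (x := x) (J := J₃)
    (by rw [hspan]; exact Submodule.subset_span (by simp))
  constructor <;> intro v <;> apply (hr x).injective_mfderiv <;>
    simp only [h₁, h₂, h₃, hJ.sq₁, hJ.sq₂, hJ.sq₃, hJ.mul, hJ.anti, map_neg]

omit hJ in
theorem inducedStructure_eq_span : inducedStructure f Q x =
    Submodule.span ℝ {restrictEnd (E := E) f J₁ x, restrictEnd (E := E) f J₂ x,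
      restrictEnd (E := E) f J₃ x} := by
  have m₁ : J₁ (f x) ∈ Q (f x) := by rw [hspan]; exact Submodule.subset_span (by simp)
  have m₂ : J₂ (f x) ∈ Q (f x) := by rw [hspan]; exact Submodule.subset_span (by simp)
  have m₃ : J₃ (f x) ∈ Q (f x) := by rw [hspan]; exact Submodule.subset_span (by simp)
  have h₁ := mfderiv_restrictEnd hr hQ m₁
  have h₂ := mfderiv_restrictEnd hr hQ m₂
  have h₃ := mfderiv_restrictEnd hr hQ m₃
  apply le_antisymm
  · rintro A ⟨J, hJQ, hA⟩
    rw [hspan, Submodule.mem_span_triple] at hJQ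
    obtain ⟨a₁, a₂, a₃, rfl⟩ := hJQ
    refine Submodule.mem_span_triple.2 ⟨a₁, a₂, a₃, ?_⟩
    ext u
    apply (hr x).injective_mfderiv
    rw [hA]
    simp only [add_apply, smul_apply, map_add, map_smul, h₁, h₂, h₃]
  · rw [Submodule.span_le]
    rintro A (rfl | rfl | rfl)
    · exact ⟨_, m₁, h₁⟩
    · exact ⟨_, m₂, h₂⟩
    · exact ⟨_, m₃, h₃⟩

end Triple

omit hr hQ [FiniteDimensional ℝ E'] [FiniteDimensional ℝ E] in
theorem skew_inducedStructure (hs : ∀ q, ∀ J ∈ Q q, ∀ u v, g q (J u) v = -g q u (J v))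
    (x : M) : ∀ A ∈ inducedStructure f Q x, ∀ u v : TangentSpace 𝓘(ℝ, E) x,
      inducedMetric f g x (A u) v = -inducedMetric f g x u (A v) := by
  rintro A ⟨J, hJ, hA⟩ u v
  rw [inducedMetric_apply, inducedMetric_apply, hA, hA, hs _ _ hJ]

/-- A local frame of `Q` restricts to a local frame of the induced structure. -/
theorem exists_local_frame (hQ' : IsAlmostParaQuaternionic Q) (x₀ : M) :
    ∃ V : Set N, IsOpen V ∧ f x₀ ∈ V ∧ ∃ U : Set M, IsOpen U ∧ x₀ ∈ U ∧ Set.MapsTo f U V ∧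
      ∃ J₁ J₂ J₃ : EndField E' N,
      (∀ q ∈ V, SmoothEndFieldAt J₁ q ∧ SmoothEndFieldAt J₂ q ∧ SmoothEndFieldAt J₃ q ∧
        IsStandardTriple (J₁ q) (J₂ q) (J₃ q) ∧ Q q = Submodule.span ℝ {J₁ q, J₂ q, J₃ q}) ∧
      ∀ x ∈ U, SmoothEndFieldAt (restrictEnd (E := E) f J₁) x ∧
        SmoothEndFieldAt (restrictEnd (E := E) f J₂) x ∧
        SmoothEndFieldAt (restrictEnd (E := E) f J₃) x ∧
        IsStandardTriple (restrictEnd (E := E) f J₁ x) (restrictEnd (E := E) f J₂ x)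
          (restrictEnd (E := E) f J₃ x) ∧
        inducedStructure f Q x = Submodule.span ℝ {restrictEnd (E := E) f J₁ x,
          restrictEnd (E := E) f J₂ x, restrictEnd (E := E) f J₃ x} := by
  obtain ⟨V, hV, hxV, J₁, J₂, J₃, hJ⟩ := hQ'.2 (f x₀)
  have hf : Continuous f := continuous_iff_continuousAt.2 fun x ↦ (hr x).smooth.continuousAt
  refine ⟨V, hV, hxV, f ⁻¹' V, hV.preimage hf, hxV, fun _ h ↦ h, J₁, J₂, J₃, hJ, fun x hx ↦ ?_⟩
  have hmem : ∀ {K : EndField E' N}, (∀ q, K q ∈ ({J₁ q, J₂ q, J₃ q} : Set _)) →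
      ∀ᶠ q in 𝓝 (f x), K q ∈ Q q := fun {K} hK ↦ by
    filter_upwards [hV.mem_nhds hx] with q hq
    rw [(hJ q hq).2.2.2.2]
    exact Submodule.subset_span (hK q)
  obtain ⟨s₁, s₂, s₃, hst, hspan⟩ := hJ (f x) hx
  exact ⟨smoothEndFieldAt_restrictEnd hr hQ s₁ (hmem (by simp)),
    smoothEndFieldAt_restrictEnd hr hQ s₂ (hmem (by simp)),
    smoothEndFieldAt_restrictEnd hr hQ s₃ (hmem (by simp)),
    isStandardTriple_restrictEnd hr hQ hst hspan, inducedStructure_eq_span hr hQ hspan⟩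

variable (hN : IsParaQuaternionicKahler g Q) (hnd : IsNondegenerate E f g)
include hN hnd

theorem isAlmostParaQuaternionic_inducedStructure [Nontrivial E] :
    IsAlmostParaQuaternionic (inducedStructure (E := E) f Q) := by
  refine ⟨fun x ↦ ?_, fun x ↦ ?_⟩
  · obtain ⟨-, -, -, U, -, hxU, -, J₁, J₂, J₃, -, hJ⟩ := exists_local_frame hr hQ hN.structure_ x
    have : Nontrivial (TangentSpace 𝓘(ℝ, E) x) := inferInstanceAs (Nontrivial E)
    have h := isSkewTriple_of_span (isPseudoRiemannian_inducedMetric hr hN.metric hnd)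
      (skew_inducedStructure hN.skew x) (hJ x hxU).2.2.2.1 (hJ x hxU).2.2.2.2
    rw [(hJ x hxU).2.2.2.2]
    exact h.finrank_span
  · obtain ⟨-, -, -, U, hU, hxU, -, J₁, J₂, J₃, -, hJ⟩ :=
      exists_local_frame hr hQ hN.structure_ x
    exact ⟨U, hU, hxU, _, _, _, hJ⟩

/-- The induced connection preserves the induced structure: a smooth section of the latter is
the restriction of a smooth section of `Q`, namely of the one which has the same coefficients
with respect to a local frame, continued by means of a local retraction. -/
theorem preserves_inducedStructure [Nontrivial E] {cov : Connection E' N}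
    (hT : IsGeodesicMap E f cov) (hP : Preserves cov Q) :
    Preserves (inducedConnection hr cov) (inducedStructure (E := E) f Q) := by
  intro x A hA hAQ v
  obtain ⟨V, hV, hxV, U, hU, hxU, hUV, J₁, J₂, J₃, hJN, hJ⟩ :=
    exists_local_frame hr hQ hN.structure_ x
  have h := hr x
  obtain ⟨a₁, a₂, a₃, s₁, s₂, s₃, ha⟩ :=
    exists_smooth_coeff (isPseudoRiemannian_inducedMetric hr hN.metric hnd)
      (skew_inducedStructure hN.skew) hU hxU hJ hA hAQ
  have hcomp : ∀ {a : M → ℝ}, CMDiffAt ∞ a x → CMDiffAt ∞ (a ∘ r x) (f x) := fun {a} ha ↦ by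
    refine ContMDiffAt.comp (f x) ?_ h.smooth_retraction
    rw [h.eq]; exact ha
  obtain ⟨t₁, t₂, t₃, -⟩ := hJN _ hxV
  set A' : EndField E' N := fun q ↦
    (a₁ ∘ r x) q • J₁ q + (a₂ ∘ r x) q • J₂ q + (a₃ ∘ r x) q • J₃ q with hA'
  have hA's : SmoothEndFieldAt A' (f x) :=
    .linearCombination (hcomp s₁) (hcomp s₂) (hcomp s₃) t₁ t₂ t₃
  have hA'Q : ∀ᶠ q in 𝓝 (f x), A' q ∈ Q q := by
    filter_upwards [hV.mem_nhds hxV] with q hq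
    rw [(hJN q hq).2.2.2.2, Submodule.mem_span_triple]
    exact ⟨_, _, _, rfl⟩
  have hAA' : ∀ᶠ p in 𝓝 x, ∀ u : TangentSpace 𝓘(ℝ, E) p,
      A' (f p) (mfderiv 𝓘(ℝ, E) 𝓘(ℝ, E') f p u) = mfderiv 𝓘(ℝ, E) 𝓘(ℝ, E') f p (A p u) := by
    filter_upwards [ha, h.left_inverse, hU.mem_nhds hxU] with p h1 h2 h3 u
    have hspan := (hJN _ (hUV h3)).2.2.2.2
    rw [h1]
    simp only [hA', Function.comp_apply, h2, add_apply, smul_apply, map_add, map_smul]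
    rw [mfderiv_restrictEnd hr hQ (by rw [hspan]; exact Submodule.subset_span (by simp)),
      mfderiv_restrictEnd hr hQ (by rw [hspan]; exact Submodule.subset_span (by simp)),
      mfderiv_restrictEnd hr hQ (by rw [hspan]; exact Submodule.subset_span (by simp))]
  obtain ⟨B, hB, hcov⟩ := hP (f x) A' hA's hA'Q (mfderiv 𝓘(ℝ, E) 𝓘(ℝ, E') f x v)
  have hBr := fun u ↦ mfderiv_tangentProj h.injective_mfderiv
    (hQ x _ hB _ (mfderiv_mem_tangentRange u))
  refine ⟨(tangentProj E f x).comp (B.comp (mfderiv 𝓘(ℝ, E) 𝓘(ℝ, E') f x)), ⟨B, hB, hBr⟩,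
    fun Y hY ↦ ?_⟩
  have hY' := h.mdifferentiableAt_extendAlong hY
  have rY := h.extendAlong_related Y
  apply h.injective_mfderiv
  rw [map_sub, ← hAA'.self_of_nhds, mfderiv_inducedConnection hr hT hY hY' rY,
    mfderiv_inducedConnection hr hT (hA.mdiff_apply hY) (hA's.mdiff_apply hY')
      (by filter_upwards [rY, hAA'] with p h1 h2; rw [h1, h2]), hcov _ hY', rY.self_of_nhds]
  exact (hBr _).symm

end InducedStructure

/-! ### The curvature of an invariant submanifold -/

section InducedCurvature

variable {E : Type*} [NormedAddCommGroup E] [NormedSpace ℝ E] [FiniteDimensional ℝ E]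
  {M : Type*} [TopologicalSpace M] [ChartedSpace E M] [IsManifold 𝓘(ℝ, E) ∞ M]
  {E' : Type*} [NormedAddCommGroup E'] [NormedSpace ℝ E'] [FiniteDimensional ℝ E']
  {N : Type*} [TopologicalSpace N] [ChartedSpace E' N] [IsManifold 𝓘(ℝ, E') ∞ N]
  {f : M → N} {x : M} {g : BilinField E' N} {Q : EndSubspaceField E' N} {cov : Connection E' N}
  {r : M → N → M} (hr : ∀ x, IsLocalRetraction E E' f (r x) x)

/-- The commutators of the curvature with the members of `Q` at a point belong to `Q`. -/
theorem Preserves.exists_curvature_commutator {Q : EndSubspaceField E M} {cov : Connection E M}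
    {g : BilinField E M} (hQ : IsAlmostParaQuaternionic Q) (hP : Preserves cov Q)
    (hc : IsLeviCivita g cov) (hg : IsPseudoRiemannian g)
    {R : TangentSpace 𝓘(ℝ, E) x →ₗ[ℝ] TangentSpace 𝓘(ℝ, E) x →ₗ[ℝ]
      TangentSpace 𝓘(ℝ, E) x →ₗ[ℝ] TangentSpace 𝓘(ℝ, E) x} (hR : IsCurvatureAt cov x R)
    (u v : TangentSpace 𝓘(ℝ, E) x) {J : TangentSpace 𝓘(ℝ, E) x →L[ℝ] TangentSpace 𝓘(ℝ, E) x}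
    (hJ : J ∈ Q x) : ∃ C ∈ Q x, ∀ z, R u v (J z) - J (R u v z) = C z := by
  obtain ⟨U, hU, hxU, J₁, J₂, J₃, hf⟩ := hQ.2 x
  rw [(hf x hxU).2.2.2.2, Submodule.mem_span_triple] at hJ
  obtain ⟨a₁, a₂, a₃, rfl⟩ := hJ
  refine hP.curvature_commutator (A := fun y ↦ a₁ • J₁ y + a₂ • J₂ y + a₃ • J₃ y) hc hg hR hU hxU
    (fun y hy ↦ ?_) (fun y hy ↦ ?_) u v
  · obtain ⟨s₁, s₂, s₃, -⟩ := hf y hy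
    exact .linearCombination contMDiffAt_const contMDiffAt_const contMDiffAt_const s₁ s₂ s₃
  · rw [(hf y hy).2.2.2.2]
    exact Submodule.mem_span_triple.2 ⟨a₁, a₂, a₃, rfl⟩

include hr in
/-- The curvature of a submanifold of dimension `4` admits the decomposition. If the submanifold
is open, this is the assumption on the ambient manifold. Otherwise it comes from the commutators
of the ambient curvature with `Q`, because there is room for a normal vector. -/
theorem admitsDecomposition_induced (hQ : IsAlmostParaQuaternionicSubmanifold E f Q)
    (hN : IsParaQuaternionicKahler g Q) (hnd : IsNondegenerate E f g)
    (hc : IsLeviCivita g cov) (hP : Preserves cov Q)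
    (hdec : Module.finrank ℝ E' = 4 → ∀ q, ∃ R, IsCurvatureAt cov q R ∧
      AdmitsDecomposition 1 (g q) (Q q) R)
    (hT : IsGeodesicMap E f cov) (hE : Module.finrank ℝ E = 4) (x : M) :
    ∃ R, IsCurvatureAt (inducedConnection hr cov) x R ∧
      AdmitsDecomposition 1 (inducedMetric (E := E) f g x) (inducedStructure f Q x) R := by
  have h := hr x
  have hg := isPseudoRiemannian_inducedMetric hr hN.metric hnd
  have hc' := isLeviCivita_inducedConnection hr hT hc hN.metric
  have : Nontrivial E := Module.nontrivial_of_finrank_pos (R := ℝ) (by omega)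
  have : Nontrivial (TangentSpace 𝓘(ℝ, E) x) := inferInstanceAs (Nontrivial E)
  have : FiniteDimensional ℝ (TangentSpace 𝓘(ℝ, E) x) :=
    inferInstanceAs (FiniteDimensional ℝ E)
  have : FiniteDimensional ℝ (TangentSpace 𝓘(ℝ, E') (f x)) :=
    inferInstanceAs (FiniteDimensional ℝ E')
  obtain ⟨R, hR⟩ := exists_isCurvatureAt (cov := inducedConnection hr cov)
    (fun _ _ _ hX hY ↦ hc'.contMDiffAt_cov hg hX hY) x
  refine ⟨R, hR, ?_⟩
  by_cases htop : tangentRange E f x = (⊤ : Submodule ℝ (TangentSpace 𝓘(ℝ, E') (f x)))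
  -- `M` is open in the ambient manifold
  · have hsurj : Function.Surjective (mfderiv 𝓘(ℝ, E) 𝓘(ℝ, E') f x).toLinearMap :=
      LinearMap.range_eq_top.1 htop
    let φ₀ : TangentSpace 𝓘(ℝ, E) x ≃ₗ[ℝ] TangentSpace 𝓘(ℝ, E') (f x) :=
      LinearEquiv.ofBijective (mfderiv 𝓘(ℝ, E) 𝓘(ℝ, E') f x).toLinearMap
        ⟨h.injective_mfderiv, hsurj⟩
    have hE' : Module.finrank ℝ E' = 4 := by
      rw [← hE]; exact φ₀.finrank_eq.symm
    have : T2Space (TangentSpace 𝓘(ℝ, E) x) := inferInstanceAs (T2Space E)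
    have : T2Space (TangentSpace 𝓘(ℝ, E') (f x)) := inferInstanceAs (T2Space E')
    obtain ⟨R', hR', hdec'⟩ := hdec hE' (f x)
    exact hdec'.transport φ₀.toContinuousLinearEquiv (fun _ _ ↦ rfl) (fun _ ↦ Iff.rfl)
      (mfderiv_curvature hr hT hc hN.metric hg hR hR')
  -- `M` has positive codimension
  · obtain ⟨V, hV, hxV, U, hU, hxU, hUV, J₁, J₂, J₃, hJN, hJ⟩ :=
      exists_local_frame hr hQ hN.structure_ x
    obtain ⟨-, -, -, hst, hspan⟩ := hJN _ hxV
    obtain ⟨-, -, -, hst', hspan'⟩ := hJ _ hxU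
    have hsk := isSkewTriple_of_span hN.metric (hN.skew _) hst hspan
    have hsk' := isSkewTriple_of_span hg (skew_inducedStructure hN.skew x) hst' hspan'
    obtain ⟨R', hR'⟩ := exists_isCurvatureAt (cov := cov)
      (fun _ _ _ hX hY ↦ hc.contMDiffAt_cov hN.metric hX hY) (f x)
    have hcurv := mfderiv_curvature hr hT hc hN.metric hg hR hR'
    have hbot : tangentRange E f x ≠ (⊥ : Submodule ℝ (TangentSpace 𝓘(ℝ, E') (f x))) := by
      obtain ⟨u, hu⟩ := exists_ne (0 : TangentSpace 𝓘(ℝ, E) x)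
      intro hb
      have := mfderiv_mem_tangentRange (E' := E') (f := f) u
      rw [hb, Submodule.mem_bot] at this
      exact hu (h.injective_mfderiv (this.trans (map_zero _).symm))
    obtain ⟨c, hcomm⟩ := hsk.exists_commutators_on (L := tangentRange E f x)
      (hc.isAlgebraicCurvature hN.metric hR')
      (fun u v J hJ ↦ by
        rw [← hspan] at hJ ⊢
        exact hP.exists_curvature_commutator hN.structure_ hc hN.metric hR' u v hJ)
      (fun J hJ ↦ hQ x J (by rwa [hspan]))
      (by
        rintro _ ⟨u, rfl⟩ hu
        have : u = 0 := hnd x u fun v ↦ hu _ (mfderiv_mem_tangentRange v)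
        rw [this]; exact map_zero _)
      hbot htop
    have m₁ : J₁ (f x) ∈ Q (f x) := by rw [hspan]; exact Submodule.subset_span (by simp)
    have m₂ : J₂ (f x) ∈ Q (f x) := by rw [hspan]; exact Submodule.subset_span (by simp)
    have m₃ : J₃ (f x) ∈ Q (f x) := by rw [hspan]; exact Submodule.subset_span (by simp)
    have e₁ := mfderiv_restrictEnd hr hQ m₁
    have e₂ := mfderiv_restrictEnd hr hQ m₂
    have e₃ := mfderiv_restrictEnd hr hQ m₃
    have hcomm' := fun u v w : TangentSpace 𝓘(ℝ, E) x ↦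
      hcomm _ (mfderiv_mem_tangentRange (E' := E') (f := f) u) _
        (mfderiv_mem_tangentRange (E' := E') (f := f) v) (mfderiv 𝓘(ℝ, E) 𝓘(ℝ, E') f x w)
    rw [hspan']
    refine hsk'.admitsDecomposition one_pos (by rw [mul_one]; exact hE)
      (hc'.isAlgebraicCurvature hg hR) (c := c) ⟨?_, ?_, ?_⟩ <;> intro u v w <;>
      apply h.injective_mfderiv <;>
      simp only [map_sub, map_smul, inducedMetric_apply, hcurv, e₁, e₂, e₃]
    · exact (hcomm' u v w).1
    · exact (hcomm' u v w).2.1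
    · exact (hcomm' u v w).2.2

end InducedCurvature

end ParaQuaternionic

open ParaQuaternionic in
theorem proposition3p8 (m n : ℕ) (hm : 0 < m)
    {E : Type*} [NormedAddCommGroup E] [NormedSpace ℝ E] [FiniteDimensional ℝ E]
    (hE : Module.finrank ℝ E = 4 * m)
    {E' : Type*} [NormedAddCommGroup E'] [NormedSpace ℝ E'] [FiniteDimensional ℝ E']
    (hE' : Module.finrank ℝ E' = 4 * n)
    {M : Type*} [TopologicalSpace M] [T2Space M] [SecondCountableTopology M]
    [ChartedSpace E M] [IsManifold 𝓘(ℝ, E) ∞ M]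
    {N : Type*} [TopologicalSpace N] [T2Space N] [SecondCountableTopology N]
    [ChartedSpace E' N] [IsManifold 𝓘(ℝ, E') ∞ N]
    (g : ParaQuaternionic.BilinField E' N) (Q : ParaQuaternionic.EndSubspaceField E' N)
    (hN : ParaQuaternionic.IsParaQuaternionicKahler g Q)
    (f : M → N) (hf : Manifold.IsImmersion 𝓘(ℝ, E) 𝓘(ℝ, E') ∞ f)
    (hnd : ParaQuaternionic.IsNondegenerate E f g)
    (hQ : ParaQuaternionic.IsAlmostParaQuaternionicSubmanifold E f Q) :
    ParaQuaternionic.IsTotallyGeodesic E f g ∧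
      ParaQuaternionic.IsParaQuaternionicKahler
        (ParaQuaternionic.inducedMetric (E := E) f g)
        (ParaQuaternionic.inducedStructure (E := E) f Q) := by
  have : Nontrivial E := Module.nontrivial_of_finrank_pos (R := ℝ) (by omega)
  choose r hr using fun x ↦ exists_isLocalRetraction (hf.isImmersionAt x)
  obtain ⟨cov, hc, hP, hdec⟩ := hN.parallel
  have hT : IsGeodesicMap E f cov := fun x Y Y' hY hY' hYY' u ↦
    cov_mem hr hQ hN.structure_ hP hc hY hY' hYY' u
  refine ⟨⟨cov, hc, 0, ⟨fun x u v w _ ↦ by simp, fun x u Y Y' hY hY' hYY' ↦ ?_⟩,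
    fun _ _ _ ↦ rfl⟩, ?_⟩
  · have := hT x Y Y' (mdiffAt hY) (mdiffAt hY') hYY' u
    simpa using this
  · exact
      { metric := isPseudoRiemannian_inducedMetric hr hN.metric hnd
        structure_ := isAlmostParaQuaternionic_inducedStructure hr hQ hN hnd
        skew := skew_inducedStructure hN.skew
        parallel := ⟨inducedConnection hr cov,
          isLeviCivita_inducedConnection hr hT hc hN.metric,
          preserves_inducedStructure hr hQ hN hnd hT hP,
          admitsDecomposition_induced hr hQ hN hnd hc hP hdec hT⟩ }
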